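/- Let $n\ge 2$. Identify an oriented geodesic of hyperbolic space $\mathbb{H}^n$ with its ordered pair of distinct endpoints $(x,y)$ on the sphere at infinity, and let $\mu$ be the Liouville measure $d\mu = \frac{2\,dV_x\,dV_y}{|x-y|^{2n-2}}$ on the space $G(\mathbb{H}^n)$ of oriented geodesics, where $V$ is the surface measure of the unit sphere $\mathbb{S}^{n-1}$ (equivalently, Lebesgue measure on $\mathbb{R}^{n-1}$ in the upper half-space model). Let $V_{n-1}(r)$ be the volume of a ball of radius $r$ in $\mathbb{H}^{n-1}$. There is a constant $K_n>0$, depending only on $n$, with the following two properties. (1) For every hyperplane $P\subset\mathbb{H}^n$ and every Borel set $U\subseteq P$, the set $G(U)$ of oriented geodesics that meet $U$ transversely to $P$ satisfies $\mu(G(U)) = K_n\,\mathrm{Vol}_{n-1}(U)$. (This determines $K_n$.) (2) Let $X$ be a connected complete hyperbolic $n$-manifold with totally geodesic boundary, written $X=\tilde X/\Gamma$, where the universal cover $\tilde X$ is a closed connected subset of $\mathbb{H}^n$ that near each of its points is all of $\mathbb{H}^n$ or a half-space bounded by a hyperplane through that point, and $\Gamma$ is a group of isometries of $\mathbb{H}^n$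 that preserves $\tilde X$ and acts on it freely and properly discontinuously. Let $G(X)=G(\tilde X)/\Gamma$ be the space of oriented geodesics of $X$, where $G(\tilde X)$ is the set of geodesics of $\mathbb{H}^n$ that meet $\tilde X$, with the measure, again called $\mu$, to which the Liouville measure descends (the least measure on $G(X)$ that dominates the image of $\mu|_T$ for every measurable $T\subseteq G(\tilde X)$ that is mapped injectively to $G(X)$; if there is a measurable fundamental domain it is the image of $\mu$ restricted to it). Let $\alpha$ be an orthogeodesic of $X$, that is, a compact geodesic arc of positive length $l(\alpha)$ in $X$ with endpoints on $\partial X$ that is perpendicular to $\partial X$ at both ends, and let $F_\alpha\subseteq G(X)$ be the set of geodesics that meet $X$ in a compact arc which, traversed in one of its two directions, is homotopic to $\alpha$ relative to $\partial X$ (the endpoints stay on $\partial X$ during the homotopy, but may move in it). Then $$\mu(F_\alpha) = K_n\cdot V_{n-1}\!\left(\log\coth\frac{l(\alpha)}{2}\right).$$ -/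

import Mathlib

open MeasureTheory Set Filter Topology

namespace HypGeom

noncomputable section

/-! ### Hyperbolic space (hyperboloid model) -/

/-- Minkowski space `ℝ^{n,1}`; the second component is the time coordinate. -/
abbrev Mink (n : ℕ) : Type := EuclideanSpace ℝ (Fin n) × ℝ

/-- The Lorentz form `x₁ y₁ + ⋯ + xₙ yₙ - s t`. -/
def lor {n : ℕ} (v w : Mink n) : ℝ := inner ℝ v.1 w.1 - v.2 * w.2

/-- Hyperbolic `n`-space, as the upper sheet of the hyperboloid. -/
def Hyp (n : ℕ) : Set (Mink n) := {v | lor v v = -1 ∧ 0 < v.2}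

/-- The hyperbolic distance between points of `Hyp n`. -/
def hdist {n : ℕ} (v w : Mink n) : ℝ := Real.arcosh (-lor v w)

/-- The group of isometries of hyperbolic space, `O⁺(n,1)`. -/
def isomGroup (n : ℕ) : Subgroup (Mink n ≃ₗ[ℝ] Mink n) where
  carrier := {A | (∀ v w, lor (A v) (A w) = lor v w) ∧ ∀ v, A v ∈ Hyp n ↔ v ∈ Hyp n}
  mul_mem' := by
    rintro A B ⟨hA, hA'⟩ ⟨hB, hB'⟩
    exact ⟨fun v w => by simp [hA, hB], fun v => by simp [hA', hB']⟩
  one_mem' := ⟨fun _ _ => rfl, fun _ => Iff.rfl⟩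
  inv_mem' := by
    rintro A ⟨hA, hA'⟩
    refine ⟨fun v w => ?_, fun v => ?_⟩
    · rw [← hA]; simp
    · rw [← hA']; simp

/-- Isometries of hyperbolic `n`-space. -/
abbrev HypIsom (n : ℕ) : Type := ↥(isomGroup n)

/-- The Riemannian volume measure of `Hyp k`, as a measure on `Mink k` carried by `Hyp k`: the
hyperboloid is the graph of `√(1 + ‖x‖²)`, and its volume element in the coordinate `x` is
`dx / √(1 + ‖x‖²)`. -/
def hypVolume (k : ℕ) : Measure (Mink k) :=
  ((volume : Measure (EuclideanSpace ℝ (Fin k))).withDensity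
    (fun x => ENNReal.ofReal (1 / Real.sqrt (1 + ‖x‖ ^ 2)))).map
      (fun x => ((x, Real.sqrt (1 + ‖x‖ ^ 2)) : Mink k))

/-- The volume of a ball of radius `r` in hyperbolic `k`-space. -/
def ballVolume (k : ℕ) (r : ℝ) : ENNReal :=
  hypVolume k {v ∈ Hyp k | hdist ((0, 1) : Mink k) v < r}

/-- Isometric linear embeddings of hyperbolic `k`-space into hyperbolic `n`-space. The
images of `Hyp (n - 1)` under such maps are the hyperplanes of `Hyp n`. -/
def IsHypEmbedding {k n : ℕ} (φ : Mink k →ₗ[ℝ] Mink n) : Prop :=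
  (∀ v w, lor (φ v) (φ w) = lor v w) ∧ ∀ v ∈ Hyp k, φ v ∈ Hyp n

/-- The point at time `t ∈ [0,1]` of the geodesic segment from `p` to `q` in `Hyp n`
(the radial projection of the affine segment). -/
def seg {n : ℕ} (p q : Mink n) (t : unitInterval) : Mink n :=
  (Real.sqrt (-lor ((1 - (t : ℝ)) • p + (t : ℝ) • q) ((1 - (t : ℝ)) • p + (t : ℝ) • q)))⁻¹ •
    ((1 - (t : ℝ)) • p + (t : ℝ) • q)

/-! ### Oriented geodesics and the Liouville measure -/

/-- The sphere at infinity of hyperbolic `n`-space. -/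
abbrev SphereInf (n : ℕ) : Type := Metric.sphere (0 : EuclideanSpace ℝ (Fin n)) 1

/-- The light-like vector that represents a point at infinity. -/
def nullVec {n : ℕ} (x : SphereInf n) : Mink n := ((x : EuclideanSpace ℝ (Fin n)), 1)

theorem isom_nullVec {n : ℕ} (A : HypIsom n) (x : SphereInf n) :
    0 < (A.1 (nullVec x)).2 ∧ ‖(A.1 (nullVec x)).1‖ = (A.1 (nullVec x)).2 := by
  have hx : ‖(x : EuclideanSpace ℝ (Fin n))‖ = 1 := norm_eq_of_mem_sphere x
  set y := A.1 (nullVec x) with hy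
  have h0 : lor y y = 0 := by
    rw [hy, A.2.1]
    simp [lor, nullVec, hx]
  have ho : ((0, 1) : Mink n) ∈ Hyp n := by constructor <;> simp [lor]
  obtain ⟨hz, hz'⟩ := (A.2.2 _).2 ho
  have h1 : lor y (A.1 ((0, 1) : Mink n)) = -1 := by
    rw [hy, A.2.1]
    simp [lor, nullVec]
  set z := A.1 ((0, 1) : Mink n) with hzdef
  simp only [lor, real_inner_self_eq_norm_sq] at h0 hz h1
  have hsq : ‖y.1‖ ^ 2 = y.2 ^ 2 := by linarith [sq y.2]
  have hzn : ‖z.1‖ < z.2 := by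
    nlinarith [norm_nonneg z.1]
  have hCS := (abs_le.1 (abs_real_inner_le_norm y.1 z.1)).1
  have hpos : 0 < y.2 := by
    by_contra hneg
    push Not at hneg
    have hn : ‖y.1‖ = -y.2 := by
      have : ‖y.1‖ ^ 2 = (-y.2) ^ 2 := by rw [hsq]; ring
      exact (pow_left_inj₀ (norm_nonneg _) (by linarith) two_ne_zero).1 this
    rw [hn] at hCS
    nlinarith
  exact ⟨hpos, (pow_left_inj₀ (norm_nonneg _) hpos.le two_ne_zero).1 hsq⟩

/-- The action of isometries on the sphere at infinity: `A • x` is the point that the light ray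
of `A (nullVec x)` represents. -/
instance sphereAction (n : ℕ) : MulAction (HypIsom n) (SphereInf n) where
  smul A x := ⟨(A.1 (nullVec x)).2⁻¹ • (A.1 (nullVec x)).1, by
    obtain ⟨h, h'⟩ := isom_nullVec A x
    rw [mem_sphere_zero_iff_norm, norm_smul, h', Real.norm_of_nonneg (inv_nonneg.2 h.le),
      inv_mul_cancel₀ h.ne']⟩
  one_smul x := by
    apply Subtype.ext
    change ((1 : ℝ)⁻¹ • (x : EuclideanSpace ℝ (Fin n))) = x
    simp
  mul_smul A B x := by
    apply Subtype.ext
    have hB := (isom_nullVec B x).1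
    set t := (B.1 (nullVec x)).2 with ht
    change (A.1 (B.1 (nullVec x))).2⁻¹ • (A.1 (B.1 (nullVec x))).1 =
      (A.1 ((t⁻¹ • (B.1 (nullVec x)).1, 1) : Mink n)).2⁻¹ •
        (A.1 ((t⁻¹ • (B.1 (nullVec x)).1, 1) : Mink n)).1
    have hv : ((t⁻¹ • (B.1 (nullVec x)).1, 1) : Mink n) = t⁻¹ • B.1 (nullVec x) := by
      ext1
      · rfl
      · simp [← ht, hB.ne']
    rw [hv, map_smul, Prod.smul_fst, Prod.smul_snd, smul_eq_mul, mul_inv, inv_inv, smul_smul]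
    congr 1
    field_simp

/-- The space of oriented geodesics of `Hyp n`: ordered pairs of distinct points at infinity. -/
abbrev Geod (n : ℕ) : Type := {g : SphereInf n × SphereInf n // g.1 ≠ g.2}

/-- The action of isometries on oriented geodesics. -/
instance geodAction (n : ℕ) : MulAction (HypIsom n) (Geod n) where
  smul A g := ⟨(A • g.1.1, A • g.1.2), fun h => g.2 (MulAction.injective A h)⟩
  one_smul g := Subtype.ext (Prod.ext (one_smul _ g.1.1) (one_smul _ g.1.2))
  mul_smul A B g := Subtype.ext (Prod.ext (mul_smul A B g.1.1) (mul_smul A B g.1.2))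

/-- The set of points of a geodesic. -/
def Geod.line {n : ℕ} (g : Geod n) : Set (Mink n) :=
  {v ∈ Hyp n | ∃ a b : ℝ, v = a • nullVec g.1.1 + b • nullVec g.1.2}

/-- The Liouville measure `2 dV(x) dV(y) / |x - y|^{2n-2}`, where `V` is the surface measure of
the unit sphere. Stereographic projection takes it to the measure given by the same formula, with
Lebesgue measure for `V`, in the upper half-space model. -/
def liouville (n : ℕ) : Measure (Geod n) :=
  (((volume : Measure (EuclideanSpace ℝ (Fin n))).toSphere.prod
      (volume : Measure (EuclideanSpace ℝ (Fin n))).toSphere).withDensity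
    (fun g => ENNReal.ofReal
      (2 / ‖(g.1 : EuclideanSpace ℝ (Fin n)) - (g.2 : EuclideanSpace ℝ (Fin n))‖ ^ (2 * n - 2)))
    ).comap (Subtype.val : Geod n → SphereInf n × SphereInf n)

/-- For a hyperplane `P = φ (Hyp k)` and a set `U ⊆ Hyp k`, the geodesics that meet `φ U ⊆ P`
transversely (a geodesic that meets a hyperplane is transverse to it unless it lies in it). -/
def transverseTo {k n : ℕ} (φ : Mink k →ₗ[ℝ] Mink n) (U : Set (Mink k)) : Set (Geod n) :=
  {g | (g.line ∩ φ '' U).Nonempty ∧ ¬ g.line ⊆ φ '' Hyp k}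

/-! ### Hyperbolic manifolds with totally geodesic boundary -/

/-- `u` is the inward unit normal at `x` of a set `Y ⊆ Hyp n` that coincides near `x` with a
closed half-space whose bounding hyperplane passes through `x`. -/
def IsInwardNormal {n : ℕ} (Y : Set (Mink n)) (x u : Mink n) : Prop :=
  lor u u = 1 ∧ lor u x = 0 ∧ ∀ᶠ y in 𝓝[Hyp n] x, (y ∈ Y ↔ 0 ≤ lor u y)

/-- A connected complete hyperbolic `n`-manifold `X` with totally geodesic boundary, given by its
universal cover, as a subset of `Hyp n`, and the group of deck transformations. The universal
cover is a closed connected set that near each of its points is all of `Hyp n` or a half-space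
(hence it is convex, and its boundary is a disjoint union of hyperplanes). -/
structure HypManifold (n : ℕ) where
  cover : Set (Mink n)
  group : Subgroup (HypIsom n)
  cover_subset : cover ⊆ Hyp n
  isClosed_cover : IsClosed cover
  isConnected_cover : IsConnected cover
  locally_halfspace : ∀ x ∈ cover, cover ∈ 𝓝[Hyp n] x ∨ ∃ u, IsInwardNormal cover x u
  group_invariant : ∀ γ ∈ group, ∀ x ∈ cover, γ.1 x ∈ cover
  group_free : ∀ γ ∈ group, ∀ x ∈ cover, γ.1 x = x → γ = 1
  group_properlyDiscontinuous : ∀ K ⊆ cover, IsCompact K →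
    {γ : HypIsom n | γ ∈ group ∧ ((γ.1 '' K) ∩ K).Nonempty}.Finite

namespace HypManifold

variable {n : ℕ} (M : HypManifold n)

/-- The action of the deck group on the universal cover. -/
instance coverAction : MulAction M.group M.cover where
  smul γ x := ⟨γ.1.1 x.1, M.group_invariant γ.1 γ.2 x.1 x.2⟩
  one_smul _ := rfl
  mul_smul _ _ _ := rfl

/-- The manifold `X` itself, with the quotient topology. -/
abbrev Space : Type := Quotient (MulAction.orbitRel M.group M.cover)

/-- The covering projection. -/
def proj (x : M.cover) : M.Space := Quotient.mk _ x

/-- The boundary of `X`. -/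
def boundary : Set M.Space := M.proj '' {x | ∃ u, IsInwardNormal M.cover x.1 u}

/-- The orbit space of all oriented geodesics of `Hyp n` under the deck group. -/
abbrev GeodQuot : Type := Quotient (MulAction.orbitRel M.group (Geod n))

/-- The projection of geodesics of `Hyp n` to the orbit space. -/
def geodProj (g : Geod n) : M.GeodQuot := Quotient.mk _ g

/-- The oriented geodesics that meet the universal cover of `X`. -/
def coverGeod : Set (Geod n) := {g | (g.line ∩ M.cover).Nonempty}

/-- The space of oriented geodesics of `X`: the geodesics that meet the universal cover, modulo
the deck group. -/
def geodSpace : Set M.GeodQuot := M.geodProj '' M.coverGeod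

/-- The measure on the space of geodesics of `X` to which the Liouville measure descends: the
least measure which, for each measurable set `T` of geodesics meeting the universal cover that is
mapped injectively to the quotient, dominates the image of the Liouville measure of `T`. If there
is a measurable fundamental domain, then this is the image of the Liouville measure on it. -/
def liouville : Measure M.GeodQuot :=
  ⨆ (T : Set (Geod n)) (_ : MeasurableSet T) (_ : T ⊆ M.coverGeod) (_ : InjOn M.geodProj T),
    ((HypGeom.liouville n).restrict T).map M.geodProj

/-- A compact geodesic arc of `X`, given by a lift to the universal cover. -/
structure GeodArc where
  source : Mink n
  target : Mink n
  source_ne_target : source ≠ target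
  seg_mem : ∀ t, seg source target t ∈ M.cover
  source_mem : source ∈ M.cover
  target_mem : target ∈ M.cover

variable {M}

/-- The lift of the arc to the universal cover. -/
def GeodArc.lift (c : M.GeodArc) (t : unitInterval) : M.cover :=
  ⟨seg c.source c.target t, c.seg_mem t⟩

/-- The arc as a path in `X`. -/
def GeodArc.path (c : M.GeodArc) (t : unitInterval) : M.Space := M.proj (c.lift t)

/-- The length of the arc. -/
def GeodArc.length (c : M.GeodArc) : ℝ := hdist c.source c.target

/-- The geodesic from `p` to `q` starts at the boundary point `p` perpendicularly to the boundary: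
its initial velocity, a positive multiple of `q + lor p q • p`, is orthogonal to all vectors `w`
tangent to the boundary at `p`. -/
def PerpAt (M : HypManifold n) (p q : Mink n) : Prop :=
  ∃ u, IsInwardNormal M.cover p u ∧
    ∀ w, lor w p = 0 → lor w u = 0 → lor w (q + lor p q • p) = 0

/-- The arc is an orthogeodesic: its endpoints are on the boundary and it is perpendicular to the
boundary there. -/
def GeodArc.IsOrthogeodesic (c : M.GeodArc) : Prop :=
  PerpAt M c.source c.target ∧ PerpAt M c.target c.source

/-- Two paths of `X` with endpoints on the boundary are homotopic relative to the boundary: the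
endpoints stay on the boundary during the homotopy, but may move in it. -/
def HomotopicRelBoundary (c d : unitInterval → M.Space) : Prop :=
  ∃ H : C(unitInterval × unitInterval, M.Space),
    (∀ t, H (0, t) = c t) ∧ (∀ t, H (1, t) = d t) ∧
      ∀ s, H (s, 0) ∈ M.boundary ∧ H (s, 1) ∈ M.boundary

/-- The geodesics of `X` that are homotopic rel boundary to `α`: the geodesics `g` that meet the
universal cover in a compact segment whose image in `X`, traversed in one of its two directions, is
homotopic rel boundary to `α`. -/
def GeodArc.homotopicGeod (α : M.GeodArc) : Set M.GeodQuot :=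
  {x ∈ M.geodSpace | ∃ g : Geod n, M.geodProj g = x ∧ ∃ c : M.GeodArc,
    g.line ∩ M.cover = range (seg c.source c.target) ∧ HomotopicRelBoundary c.path α.path}

end HypManifold

end

end HypGeom

namespace HypGeom

noncomputable section

/-! ### Lorentz algebra -/

section Lorentz

variable {n : ℕ}

/-! The geometric half identifies `homotopicGeod` in the universal cover. There `α` joins two
boundary walls with inward unit normals `u` at `p` and `w` at `q`, and perpendicularity gives `q = C
• p + S • u` and `w = -(S • p + C • u)`, with `C`, `S` the hyperbolic cosine and sine of the length.
Lifting a homotopy rel boundary keeps its ends on the same two walls, and conversely convexity of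
the cover lets a chord between the walls slide to `α`. So the homotopic geodesics are exactly the
images of those that cross both walls (`homotopicGeod_eq`). A deck transformation that carries one
such geodesic to another preserves the pair of walls, hence fixes a point of the arc and is trivial
(`eq_one_of_smul_mem`). The measure in the quotient is therefore the Liouville measure of the
crossing geodesics in hyperbolic space (`liouville_image`).

The measure half uses one coordinate system for both claims. Write `n = k + 1` and fix a hyperplane.
A geodesic that crosses it has its endpoints on opposite sides; let `p`, `q` be their orthogonal
projections to the hyperplane. In these coordinates the Liouville measure is `kernel p q` times the
product of two hyperbolic volumes, and `kernel` depends only on the distance of `p` and `q`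
(`Frame.liouville_eq`). The crossing point is the midpoint of `p` and `q`. By homogeneity the
midpoint is distributed with density `kernelMass k`, the integral of the kernel in one variable
(`lintegral_kernel_midpoint`); this is the first claim. If instead one endpoint is to lie beyond a
second wall at distance `l`, the condition says that its projection lies in the ball of radius `r`
with `cosh r = coth l`, while the other projection is free; integrating the latter out gives the
same factor `kernelMass k` (`lintegral_kernel_left`, `lintegral_kernel_right`). Since `cosh (log
(coth (l / 2))) = coth l`, this is the second claim. Both carry a factor 2 for the two orientations.

Invariance of all measures under isometries comes from one Jacobian: a reflection preserves `dx /
√(m + ‖x‖ ^ 2)` on the shell `lor v v = -m` (`lintegral_shellMap`). The case `m = 1` is the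
hyperbolic volume; `m = 0` is the light cone and yields the conformal factor on the sphere at
infinity. -/

theorem lor_comm (v w : Mink n) : lor v w = lor w v := by
  simp only [lor, real_inner_comm, mul_comm]

theorem lor_add_left (v v' w : Mink n) : lor (v + v') w = lor v w + lor v' w := by
  simp only [lor, Prod.fst_add, Prod.snd_add, inner_add_left]; ring

theorem lor_smul_left (a : ℝ) (v w : Mink n) : lor (a • v) w = a * lor v w := by
  simp only [lor, Prod.smul_fst, Prod.smul_snd, real_inner_smul_left, smul_eq_mul]; ring

theorem lor_neg_left (v w : Mink n) : lor (-v) w = -lor v w := by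
  simpa using lor_smul_left (-1) v w

theorem lor_sub_left (v v' w : Mink n) : lor (v - v') w = lor v w - lor v' w := by
  rw [sub_eq_add_neg, lor_add_left, lor_neg_left, sub_eq_add_neg]

theorem lor_add_right (v w w' : Mink n) : lor v (w + w') = lor v w + lor v w' := by
  rw [lor_comm, lor_add_left, lor_comm w, lor_comm w']

theorem lor_smul_right (a : ℝ) (v w : Mink n) : lor v (a • w) = a * lor v w := by
  rw [lor_comm, lor_smul_left, lor_comm]

theorem lor_neg_right (v w : Mink n) : lor v (-w) = -lor v w := by
  rw [lor_comm, lor_neg_left, lor_comm]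

theorem lor_sub_right (v w w' : Mink n) : lor v (w - w') = lor v w - lor v w' := by
  rw [lor_comm, lor_sub_left, lor_comm w, lor_comm w']

theorem continuous_lor : Continuous fun v : Mink n × Mink n => lor v.1 v.2 := by
  unfold lor; fun_prop

@[fun_prop]
theorem _root_.Continuous.lor {Z : Type*} [TopologicalSpace Z] {f g : Z → Mink n}
    (hf : Continuous f) (hg : Continuous g) : Continuous fun z => lor (f z) (g z) :=
  continuous_lor.comp (hf.prodMk hg)

/-- The base point of hyperbolic space. -/
def origin (n : ℕ) : Mink n := (0, 1)

theorem origin_mem : origin n ∈ Hyp n := by constructor <;> simp [lor, origin]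

theorem lor_origin (v : Mink n) : lor v (origin n) = -v.2 := by simp [lor, origin]

theorem lor_self (v : Mink n) : lor v v = ‖v.1‖ ^ 2 - v.2 ^ 2 := by
  simp only [lor, real_inner_self_eq_norm_sq]; ring

theorem norm_lt_of_lor_neg {v : Mink n} (h : lor v v < 0) (h0 : 0 < v.2) : ‖v.1‖ < v.2 := by
  rw [lor_self] at h
  exact lt_of_pow_lt_pow_left₀ 2 h0.le (by linarith)

theorem norm_lt_of_mem {v : Mink n} (h : v ∈ Hyp n) : ‖v.1‖ < v.2 :=
  norm_lt_of_lor_neg (by rw [h.1]; norm_num) h.2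

theorem lor_neg_of_future {v w : Mink n} (hv : ‖v.1‖ < v.2) (hw : ‖w.1‖ ≤ w.2) (hw0 : 0 < w.2) :
    lor v w < 0 := by
  have h := real_inner_le_norm v.1 w.1
  have h2 : ‖v.1‖ * ‖w.1‖ ≤ ‖v.1‖ * w.2 := mul_le_mul_of_nonneg_left hw (norm_nonneg _)
  have h3 : ‖v.1‖ * w.2 < v.2 * w.2 := mul_lt_mul_of_pos_right hv hw0
  unfold lor; linarith

theorem lor_neg_of_mem {v w : Mink n} (hv : v ∈ Hyp n) (hw : w ∈ Hyp n) : lor v w < 0 :=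
  lor_neg_of_future (norm_lt_of_mem hv) (norm_lt_of_mem hw).le hw.2

/-- Cauchy–Schwarz applied to `⟪h.1, p.1⟫ = h.2 * p.2`. It makes the form positive definite on
tangent spaces, quantitatively. -/
theorem norm_sq_le_of_orth {p h : Mink n} (hp : p ∈ Hyp n) (h0 : lor h p = 0) :
    ‖h.1‖ ^ 2 ≤ lor h h * (1 + ‖p.1‖ ^ 2) := by
  have h1 := hp.1
  rw [lor_self] at h1
  have h2 : |inner ℝ h.1 p.1| ≤ _ := abs_real_inner_le_norm h.1 p.1
  have h3 : inner ℝ h.1 p.1 = h.2 * p.2 := by unfold lor at h0; linarith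
  have h4 : (h.2 * p.2) ^ 2 ≤ (‖h.1‖ * ‖p.1‖) ^ 2 := by
    rw [← h3, ← sq_abs (inner ℝ h.1 p.1)]; gcongr
  rw [lor_self]
  have h5 : p.2 ^ 2 = 1 + ‖p.1‖ ^ 2 := by linarith
  rw [mul_pow, mul_pow, h5] at h4
  nlinarith

theorem lor_self_nonneg_of_orth {p h : Mink n} (hp : p ∈ Hyp n) (h0 : lor h p = 0) :
    0 ≤ lor h h := by
  have := norm_sq_le_of_orth hp h0
  by_contra! hn
  nlinarith [sq_nonneg ‖h.1‖, sq_nonneg ‖p.1‖]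

theorem eq_zero_of_orth {p h : Mink n} (hp : p ∈ Hyp n) (h0 : lor h p = 0) (hh : lor h h = 0) :
    h = 0 := by
  have h1 := norm_sq_le_of_orth hp h0
  rw [hh, zero_mul] at h1
  have h2 : ‖h.1‖ = 0 := by nlinarith [norm_nonneg h.1]
  rw [lor_self, h2] at hh
  have h3 : h.2 = 0 := by nlinarith
  ext1
  · exact norm_eq_zero.1 h2
  · exact h3

/-- The tangential part `q + lor p q • p` of `q` at `p` has square `lor p q ^ 2 - 1`, which must be
nonnegative; both points are on the upper sheet, so the sign is determined. -/
theorem lor_le_neg_one {p q : Mink n} (hp : p ∈ Hyp n) (hq : q ∈ Hyp n) : lor p q ≤ -1 := by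
  have h0 : lor (q + lor p q • p) p = 0 := by
    rw [lor_add_left, lor_smul_left, hp.1, lor_comm q p]; ring
  have h1 := lor_self_nonneg_of_orth hp h0
  rw [lor_add_right, lor_smul_right, h0, lor_add_left, lor_smul_left, hq.1] at h1
  have := lor_neg_of_mem hp hq
  nlinarith

theorem eq_of_lor_eq_neg_one {p q : Mink n} (hp : p ∈ Hyp n) (hq : q ∈ Hyp n)
    (h : lor p q = -1) : p = q := by
  have h0 : lor (q - p) p = 0 := by rw [lor_sub_left, hp.1, lor_comm q p, h]; ring
  have h1 : lor (q - p) (q - p) = 0 := by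
    rw [lor_sub_right, h0, lor_sub_left, hq.1, h]; ring
  exact (sub_eq_zero.1 (eq_zero_of_orth hp h0 h1)).symm

theorem mem_Hyp_of_lor_neg {p v : Mink n} (hp : p ∈ Hyp n) (hv : lor v v = -1)
    (h : lor v p < 0) : v ∈ Hyp n := by
  refine ⟨hv, ?_⟩
  by_contra! hn
  have h1 : -v ∈ Hyp n := by
    refine ⟨by rw [lor_neg_left, lor_neg_right, neg_neg, hv], ?_⟩
    rcases hn.lt_or_eq with h2 | h2
    · simpa using h2
    · rw [lor_self, h2] at hv
      nlinarith [sq_nonneg ‖v.1‖]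
  have := lor_neg_of_mem h1 hp
  rw [lor_neg_left] at this
  linarith

theorem smul_eq_self_of_mem {p : Mink n} {r : ℝ} (hp : p ∈ Hyp n) (hr : 0 ≤ r)
    (h : r • p ∈ Hyp n) : r = 1 := by
  have h1 := h.1
  rw [lor_smul_left, lor_smul_right, hp.1] at h1
  nlinarith

/-! ### Isometries -/

theorem HypIsom.lor_map (A : HypIsom n) (v w : Mink n) : lor (A.1 v) (A.1 w) = lor v w := A.2.1 v w

theorem HypIsom.map_mem (A : HypIsom n) {v : Mink n} (hv : v ∈ Hyp n) : A.1 v ∈ Hyp n :=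
  (A.2.2 v).2 hv

theorem HypIsom.continuous (A : HypIsom n) : Continuous A.1 :=
  A.1.toLinearMap.continuous_of_finiteDimensional

theorem HypIsom.inv_apply_self (A : HypIsom n) (v : Mink n) : A⁻¹.1 (A.1 v) = v :=
  A.1.symm_apply_apply v

theorem HypIsom.apply_inv_self (A : HypIsom n) (v : Mink n) : A.1 (A⁻¹.1 v) = v :=
  A.1.apply_symm_apply v

theorem HypIsom.mul_apply (A B : HypIsom n) (v : Mink n) : (A * B).1 v = A.1 (B.1 v) := rfl

/-- An isometry is only required to preserve the hyperboloid. The closed future cone follows,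
because its nonzero vectors are recognised by the sign of the product with a point of the
hyperboloid. -/
theorem HypIsom.snd_pos (A : HypIsom n) {v : Mink n} (hv : ‖v.1‖ ≤ v.2) (h0 : 0 < v.2) :
    0 < (A.1 v).2 := by
  by_contra! hn
  have ho := A.map_mem (origin_mem (n := n))
  have h1 := A.lor_map v (origin n)
  rw [lor_origin] at h1
  have h3 : lor (A.1 v) (A.1 v) ≤ 0 := by
    rw [A.lor_map, lor_self]
    nlinarith [norm_nonneg v.1]
  rw [lor_self] at h3
  have h4 : ‖(A.1 v).1‖ ≤ -(A.1 v).2 := by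
    refine abs_le_of_sq_le_sq' ?_ (by linarith) |>.2
    linarith [neg_sq (A.1 v).2]
  rcases hn.lt_or_eq with h2 | h2
  · have := lor_neg_of_future (v := A.1 (origin n)) (w := -(A.1 v)) (norm_lt_of_mem ho)
      (by simpa using h4) (by simpa using h2)
    rw [lor_neg_right, lor_comm] at this
    linarith
  · have h5 : A.1 v = 0 := by
      rw [h2, neg_zero] at h4
      ext1
      · exact norm_le_zero_iff.1 h4
      · exact h2
    have : v = 0 := by simpa using h5
    rw [this] at h0
    simp at h0

/-- The linear reflection in the orthogonal complement of a non-null vector. -/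
def reflMap (b : Mink n) : Mink n →ₗ[ℝ] Mink n where
  toFun v := v - (2 * lor v b / lor b b) • b
  map_add' v w := by rw [lor_add_left, mul_add, add_div, add_smul]; abel
  map_smul' a v := by
    rw [lor_smul_left, RingHom.id_apply, smul_sub, smul_smul]; congr 2; ring

theorem reflMap_apply (b v : Mink n) : reflMap b v = v - (2 * lor v b / lor b b) • b := rfl

theorem lor_reflMap {b : Mink n} (hb : 0 < lor b b) (v w : Mink n) :
    lor (reflMap b v) (reflMap b w) = lor v w := by
  simp only [reflMap_apply, lor_sub_left, lor_sub_right, lor_smul_left, lor_smul_right]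
  rw [lor_comm b w]
  field_simp
  ring

theorem reflMap_reflMap {b : Mink n} (hb : 0 < lor b b) (v : Mink n) :
    reflMap b (reflMap b v) = v := by
  have h : lor (reflMap b v) b = -lor v b := by
    rw [reflMap_apply, lor_sub_left, lor_smul_left]; field_simp; ring
  rw [reflMap_apply b (reflMap b v), h, reflMap_apply, sub_sub, ← add_smul,
    mul_neg, neg_div, add_neg_cancel, zero_smul, sub_zero]

theorem reflMap_mem {b v : Mink n} (hb : 0 < lor b b) (hv : v ∈ Hyp n) :
    reflMap b v ∈ Hyp n := by
  refine mem_Hyp_of_lor_neg hv (by rw [lor_reflMap hb, hv.1]) ?_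
  rw [reflMap_apply, lor_sub_left, lor_smul_left, hv.1, lor_comm b v]
  have : 0 ≤ 2 * lor v b / lor b b * lor v b := by
    rw [div_mul_eq_mul_div]; refine div_nonneg ?_ hb.le; nlinarith [sq_nonneg (lor v b)]
  linarith

/-- The reflection in a hyperplane, as an isometry of hyperbolic space. -/
def reflIsom (b : Mink n) (hb : 0 < lor b b) : HypIsom n :=
  ⟨LinearEquiv.ofInvolutive (reflMap b) (reflMap_reflMap hb), lor_reflMap hb, fun v =>
    ⟨fun h => by
      have := reflMap_mem hb h
      rwa [← reflMap_reflMap hb v], reflMap_mem hb⟩⟩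

theorem reflIsom_apply (b : Mink n) (hb : 0 < lor b b) (v : Mink n) :
    (reflIsom b hb).1 v = reflMap b v := rfl

theorem lor_sub_self_pos {p q : Mink n} (hp : p ∈ Hyp n) (hq : q ∈ Hyp n) (h : p ≠ q) :
    0 < lor (p - q) (p - q) := by
  have h1 : lor p q ≠ -1 := fun h' => h (eq_of_lor_eq_neg_one hp hq h')
  have h2 := lt_of_le_of_ne (lor_le_neg_one hp hq) h1
  rw [lor_sub_left, lor_sub_right, lor_sub_right, hp.1, hq.1, lor_comm q p]
  linarith

/-- The reflection is the one in the perpendicular bisector of `p` and `q`. Such swaps stand in for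
transitivity of the isometry group throughout. -/
theorem reflMap_sub_left {p q : Mink n} (hp : p ∈ Hyp n) (hq : q ∈ Hyp n) (h : p ≠ q) :
    reflMap (p - q) p = q := by
  have h0 := lor_sub_self_pos hp hq h
  have h1 : 2 * lor p (p - q) = lor (p - q) (p - q) := by
    rw [lor_sub_left, lor_sub_right, lor_sub_right, hp.1, hq.1, lor_comm q p]; ring
  rw [reflMap_apply, h1, div_self h0.ne', one_smul, sub_sub_cancel]

end Lorentz

end

end HypGeom

namespace HypGeom

noncomputable section

/-! ### Segments and lines -/

section Segments

variable {n : ℕ}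

/-- Radial projection to the hyperboloid. -/
def nrm (v : Mink n) : Mink n := (Real.sqrt (-lor v v))⁻¹ • v

theorem seg_eq_nrm (p q : Mink n) (t : unitInterval) :
    seg p q t = nrm ((1 - (t : ℝ)) • p + (t : ℝ) • q) := rfl

theorem nrm_eq_smul {v : Mink n} (hv : lor v v < 0) : ∃ r : ℝ, 0 < r ∧ nrm v = r • v :=
  ⟨_, inv_pos.2 (Real.sqrt_pos.2 (neg_pos.2 hv)), rfl⟩

theorem nrm_mem {v : Mink n} (hv : lor v v < 0) (h0 : 0 < v.2) : nrm v ∈ Hyp n := by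
  refine ⟨?_, mul_pos (inv_pos.2 (Real.sqrt_pos.2 (neg_pos.2 hv))) h0⟩
  have h := Real.mul_self_sqrt (neg_pos.2 hv).le
  have h1 := (Real.sqrt_pos.2 (neg_pos.2 hv)).ne'
  rw [nrm, lor_smul_left, lor_smul_right]
  field_simp
  linarith [sq (√(-lor v v))]

theorem nrm_of_mem {v : Mink n} (hv : v ∈ Hyp n) : nrm v = v := by
  simp [nrm, hv.1]

theorem nrm_smul {v : Mink n} {r : ℝ} (hr : 0 < r) : nrm (r • v) = nrm v := by
  rw [nrm, nrm, lor_smul_left, lor_smul_right, smul_smul]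
  have : -(r * (r * lor v v)) = r ^ 2 * -lor v v := by ring
  rw [this, Real.sqrt_mul (sq_nonneg r), Real.sqrt_sq hr.le, mul_inv, mul_right_comm,
    inv_mul_cancel₀ hr.ne', one_mul]

theorem lor_nrm_nonneg_iff {u v : Mink n} (hv : lor v v < 0) : 0 ≤ lor u (nrm v) ↔ 0 ≤ lor u v := by
  obtain ⟨r, hr, h⟩ := nrm_eq_smul hv
  rw [h, lor_smul_right, mul_nonneg_iff_of_pos_left hr]

theorem lor_nrm_eq_zero_iff {u v : Mink n} (hv : lor v v < 0) : lor u (nrm v) = 0 ↔ lor u v = 0 := by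
  obtain ⟨r, hr, h⟩ := nrm_eq_smul hv
  rw [h, lor_smul_right, mul_eq_zero, or_iff_right hr.ne']

theorem continuousAt_nrm {v : Mink n} (hv : lor v v < 0) : ContinuousAt nrm v := by
  have h : Continuous fun v : Mink n => Real.sqrt (-lor v v) := by fun_prop
  exact (h.continuousAt.inv₀ (Real.sqrt_pos.2 (neg_pos.2 hv)).ne').smul continuousAt_id

theorem HypIsom.nrm_map (A : HypIsom n) (v : Mink n) : nrm (A.1 v) = A.1 (nrm v) := by
  rw [nrm, nrm, A.lor_map, map_smul]

theorem HypIsom.seg_map (A : HypIsom n) (p q : Mink n) (t : unitInterval) :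
    seg (A.1 p) (A.1 q) t = A.1 (seg p q t) := by
  rw [seg_eq_nrm, seg_eq_nrm, ← map_smul, ← map_smul, ← map_add, A.nrm_map]

/-- The cone condition is weak so that the lemma serves both points of the hyperboloid and
light-like vectors at infinity; strictness comes from `hpq` alone. -/
theorem timelike_combination {p q : Mink n} (hp : ‖p.1‖ ≤ p.2) (hq : ‖q.1‖ ≤ q.2)
    (hp0 : 0 < p.2) (hq0 : 0 < q.2) (hpq : lor p q < 0) {a b : ℝ} (ha : 0 < a) (hb : 0 < b) :
    lor (a • p + b • q) (a • p + b • q) < 0 ∧ 0 < (a • p + b • q).2 := by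
  have h1 : lor p p ≤ 0 := by rw [lor_self]; nlinarith [norm_nonneg p.1]
  have h2 : lor q q ≤ 0 := by rw [lor_self]; nlinarith [norm_nonneg q.1]
  constructor
  · simp only [lor_add_left, lor_add_right, lor_smul_left, lor_smul_right]
    rw [lor_comm q p]
    have := mul_pos ha hb
    nlinarith [mul_pos ha ha, mul_pos hb hb]
  · simp only [Prod.snd_add, Prod.smul_snd, smul_eq_mul]; positivity

theorem timelike_of_mem {p q : Mink n} (hp : p ∈ Hyp n) (hq : q ∈ Hyp n) {a b : ℝ} (ha : 0 ≤ a)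
    (hb : 0 ≤ b) (hab : 0 < a + b) :
    lor (a • p + b • q) (a • p + b • q) < 0 ∧ 0 < (a • p + b • q).2 := by
  rcases ha.eq_or_lt with rfl | ha
  · simp only [zero_smul, zero_add] at hab ⊢
    rw [lor_smul_left, lor_smul_right, hq.1]
    exact ⟨by nlinarith [mul_pos hab hab], mul_pos hab hq.2⟩
  rcases hb.eq_or_lt with rfl | hb
  · simp only [zero_smul, add_zero] at hab ⊢
    rw [lor_smul_left, lor_smul_right, hp.1]
    exact ⟨by nlinarith [mul_pos hab hab], mul_pos hab hp.2⟩
  exact timelike_combination (norm_lt_of_mem hp).le (norm_lt_of_mem hq).le hp.2 hq.2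
    (lor_neg_of_mem hp hq) ha hb

theorem seg_timelike {p q : Mink n} (hp : p ∈ Hyp n) (hq : q ∈ Hyp n) (t : unitInterval) :
    lor ((1 - (t : ℝ)) • p + (t : ℝ) • q) ((1 - (t : ℝ)) • p + (t : ℝ) • q) < 0 ∧
      0 < ((1 - (t : ℝ)) • p + (t : ℝ) • q).2 :=
  timelike_of_mem hp hq (by linarith [t.2.2]) t.2.1 (by linarith)

theorem seg_mem_Hyp {p q : Mink n} (hp : p ∈ Hyp n) (hq : q ∈ Hyp n) (t : unitInterval) :
    seg p q t ∈ Hyp n :=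
  nrm_mem (seg_timelike hp hq t).1 (seg_timelike hp hq t).2

theorem seg_zero {p q : Mink n} (hp : p ∈ Hyp n) : seg p q 0 = p := by
  simp [seg_eq_nrm, nrm_of_mem hp]

theorem seg_one {p q : Mink n} (hq : q ∈ Hyp n) : seg p q 1 = q := by
  simp [seg_eq_nrm, nrm_of_mem hq]

theorem continuous_seg {Z : Type*} [TopologicalSpace Z] {p q : Z → Mink n} {t : Z → unitInterval}
    (hp : Continuous p) (hq : Continuous q) (ht : Continuous t) (hp' : ∀ z, p z ∈ Hyp n)
    (hq' : ∀ z, q z ∈ Hyp n) : Continuous fun z => seg (p z) (q z) (t z) := by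
  rw [continuous_iff_continuousAt]
  intro z
  have h1 : Continuous fun z => ((1 - (t z : ℝ)) • p z + (t z : ℝ) • q z) := by fun_prop
  exact ContinuousAt.comp (f := fun z => (1 - (t z : ℝ)) • p z + (t z : ℝ) • q z)
    (continuousAt_nrm (seg_timelike (hp' z) (hq' z) (t z)).1) h1.continuousAt

theorem seg_eq_combination {p q : Mink n} (hp : p ∈ Hyp n) (hq : q ∈ Hyp n) (t : unitInterval) :
    ∃ a b : ℝ, 0 ≤ a ∧ 0 ≤ b ∧ seg p q t = a • p + b • q := by
  obtain ⟨r, hr, h⟩ := nrm_eq_smul (seg_timelike hp hq t).1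
  refine ⟨r * (1 - t), r * t, mul_nonneg hr.le (by linarith [t.2.2]), mul_nonneg hr.le t.2.1, ?_⟩
  rw [seg_eq_nrm, h, smul_add, smul_smul, smul_smul]

theorem mem_range_seg {p q : Mink n} {y : Mink n}
    (hy : y ∈ Hyp n) {a b : ℝ} (ha : 0 ≤ a) (hb : 0 ≤ b) (h : y = a • p + b • q) :
    y ∈ range (seg p q) := by
  have hab : 0 < a + b := by
    by_contra! hn
    have h1 : a = 0 := by linarith
    have h2 : b = 0 := by linarith
    have := hy.2
    rw [h, h1, h2] at this
    simp at this
  refine ⟨⟨b / (a + b), by positivity, by rw [div_le_one hab]; linarith⟩, ?_⟩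
  have h1 : ((1 - b / (a + b)) • p + (b / (a + b)) • q) = (a + b)⁻¹ • y := by
    rw [h, smul_add, smul_smul, smul_smul]
    congr 2 <;> field_simp
    ring
  rw [seg_eq_nrm]
  simp only [h1]
  rw [nrm_smul (inv_pos.2 hab), nrm_of_mem hy]

theorem lor_seg_nonneg {u p q : Mink n} (hp : p ∈ Hyp n) (hq : q ∈ Hyp n) (h1 : 0 ≤ lor u p)
    (h2 : 0 ≤ lor u q) (t : unitInterval) : 0 ≤ lor u (seg p q t) := by
  obtain ⟨a, b, ha, hb, h⟩ := seg_eq_combination hp hq t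
  rw [h, lor_add_right, lor_smul_right, lor_smul_right]
  positivity

theorem lor_seg_eq_zero {u p q : Mink n} (hp : p ∈ Hyp n) (hq : q ∈ Hyp n) (h1 : lor u p = 0)
    (h2 : lor u q = 0) (t : unitInterval) : lor u (seg p q t) = 0 := by
  obtain ⟨a, b, ha, hb, h⟩ := seg_eq_combination hp hq t
  rw [h, lor_add_right, lor_smul_right, lor_smul_right, h1, h2]
  ring

theorem tendsto_seg {p q : Mink n} (hp : p ∈ Hyp n) (hq : q ∈ Hyp n) (t : unitInterval) :
    Tendsto (seg p q) (𝓝 t) (𝓝[Hyp n] (seg p q t)) :=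
  tendsto_nhdsWithin_of_tendsto_nhds_of_eventually_within _
    ((continuous_seg continuous_const continuous_const continuous_id (fun _ => hp)
      fun _ => hq).tendsto t) (Eventually.of_forall fun s => seg_mem_Hyp hp hq s)

/-! ### Points at infinity -/

theorem norm_nullVec (x : SphereInf n) : ‖(nullVec x).1‖ = (nullVec x).2 :=
  norm_eq_of_mem_sphere x

theorem nullVec_snd (x : SphereInf n) : (nullVec x).2 = 1 := rfl

theorem lor_nullVec_self (x : SphereInf n) : lor (nullVec x) (nullVec x) = 0 := by
  rw [lor_self, norm_nullVec, sub_self]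

theorem lor_nullVec_neg {v : Mink n} (hv : v ∈ Hyp n) (x : SphereInf n) :
    lor v (nullVec x) < 0 :=
  lor_neg_of_future (norm_lt_of_mem hv) (norm_nullVec x).le one_pos

theorem norm_sub_sq_eq (x y : SphereInf n) :
    ‖(x : EuclideanSpace ℝ (Fin n)) - y‖ ^ 2 = -2 * lor (nullVec x) (nullVec y) := by
  rw [norm_sub_sq_real, norm_eq_of_mem_sphere x, norm_eq_of_mem_sphere y]
  simp only [lor, nullVec]; ring

theorem lor_nullVec_nullVec_neg {x y : SphereInf n} (h : x ≠ y) :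
    lor (nullVec x) (nullVec y) < 0 := by
  have h1 := norm_sub_sq_eq x y
  have h2 : 0 < ‖(x : EuclideanSpace ℝ (Fin n)) - y‖ :=
    norm_pos_iff.2 (sub_ne_zero.2 fun h' => h (Subtype.ext h'))
  nlinarith

theorem HypIsom.nullVec_smul (A : HypIsom n) (x : SphereInf n) :
    nullVec (A • x) = (A.1 (nullVec x)).2⁻¹ • A.1 (nullVec x) := by
  ext1
  · rfl
  · simp [nullVec_snd, (isom_nullVec A x).1.ne']

/-- Reversal of the orientation. -/
def Geod.flip (g : Geod n) : Geod n := ⟨(g.1.2, g.1.1), g.2.symm⟩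

theorem Geod.line_flip (g : Geod n) : g.flip.line = g.line := by
  ext v
  constructor <;> rintro ⟨hv, a, b, h⟩ <;> exact ⟨hv, b, a, by rw [h, add_comm]; rfl⟩

theorem Geod.lor_neg (g : Geod n) : lor (nullVec g.1.1) (nullVec g.1.2) < 0 :=
  lor_nullVec_nullVec_neg g.2

theorem Geod.pos_of_mem {g : Geod n} {a b : ℝ}
    (h : a • nullVec g.1.1 + b • nullVec g.1.2 ∈ Hyp n) : 0 < a ∧ 0 < b := by
  have h1 := h.1
  have h2 := h.2
  simp only [lor_add_left, lor_add_right, lor_smul_left, lor_smul_right, lor_nullVec_self] at h1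
  rw [lor_comm (nullVec g.1.2)] at h1
  simp only [Prod.snd_add, Prod.smul_snd, nullVec_snd, smul_eq_mul, mul_one] at h2
  have h3 := g.lor_neg
  have h4 : 0 < a * b := by
    by_contra! hn
    nlinarith
  rcases pos_and_pos_or_neg_and_neg_of_mul_pos h4 with h5 | h5
  · exact h5
  · linarith [h5.1, h5.2]

theorem Geod.timelike (g : Geod n) {a b : ℝ} (ha : 0 < a) (hb : 0 < b) :
    lor (a • nullVec g.1.1 + b • nullVec g.1.2) (a • nullVec g.1.1 + b • nullVec g.1.2) < 0 ∧
      0 < (a • nullVec g.1.1 + b • nullVec g.1.2).2 :=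
  timelike_combination (norm_nullVec _).le (norm_nullVec _).le one_pos one_pos g.lor_neg ha hb

theorem Geod.nrm_mem_line (g : Geod n) {a b : ℝ} (ha : 0 < a) (hb : 0 < b) :
    nrm (a • nullVec g.1.1 + b • nullVec g.1.2) ∈ g.line := by
  obtain ⟨h1, h2⟩ := g.timelike ha hb
  obtain ⟨r, -, h⟩ := nrm_eq_smul h1
  exact ⟨nrm_mem h1 h2, r * a, r * b, by rw [h, smul_add, smul_smul, smul_smul]⟩

theorem Geod.line_smul (A : HypIsom n) (g : Geod n) : (A • g).line = A.1 '' g.line := by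
  have h1 : nullVec (A • g).1.1 = (A.1 (nullVec g.1.1)).2⁻¹ • A.1 (nullVec g.1.1) :=
    A.nullVec_smul g.1.1
  have h2 : nullVec (A • g).1.2 = (A.1 (nullVec g.1.2)).2⁻¹ • A.1 (nullVec g.1.2) :=
    A.nullVec_smul g.1.2
  have p1 := (isom_nullVec A g.1.1).1
  have p2 := (isom_nullVec A g.1.2).1
  ext v
  constructor
  · rintro ⟨hv, a, b, h⟩
    refine ⟨A⁻¹.1 v, ⟨A⁻¹.map_mem hv, a * (A.1 (nullVec g.1.1)).2⁻¹,
      b * (A.1 (nullVec g.1.2)).2⁻¹, ?_⟩, A.apply_inv_self v⟩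
    rw [h, h1, h2, smul_smul, smul_smul, map_add, map_smul, map_smul, A.inv_apply_self,
      A.inv_apply_self]
  · rintro ⟨w, ⟨hw, a, b, rfl⟩, rfl⟩
    refine ⟨A.map_mem hw, a * (A.1 (nullVec g.1.1)).2, b * (A.1 (nullVec g.1.2)).2, ?_⟩
    rw [h1, h2, smul_smul, smul_smul, mul_assoc, mul_assoc, mul_inv_cancel₀ p1.ne',
      mul_inv_cancel₀ p2.ne', map_add, map_smul, map_smul, mul_one, mul_one]

end Segments

/-! ### The universal cover of a hyperbolic manifold with boundary -/

section Normals

variable {n : ℕ} {Y : Set (Mink n)} {x u : Mink n}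

/-- The germ of `Y` at `x` can be tested along rays: a small move in direction `v` stays in `Y`
exactly when `v` does not point outwards. Thus the germ determines the half-space of directions. -/
theorem IsInwardNormal.eventually_nrm (h : IsInwardNormal Y x u) (hx : x ∈ Hyp n) (v : Mink n) :
    ∀ᶠ ε in 𝓝[>] (0 : ℝ), (nrm (x + ε • v) ∈ Y ↔ 0 ≤ lor u v) := by
  have hc : Continuous fun ε : ℝ => x + ε • v := by fun_prop
  have h0 : lor (x + (0 : ℝ) • v) (x + (0 : ℝ) • v) < 0 := by
    rw [zero_smul, add_zero, hx.1]; norm_num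
  have h1 : ∀ᶠ ε in 𝓝 (0 : ℝ), lor (x + ε • v) (x + ε • v) < 0 :=
    (by fun_prop : Continuous fun ε : ℝ => lor (x + ε • v) (x + ε • v)).continuousAt.eventually_lt
      continuousAt_const h0
  have h2 : ∀ᶠ ε in 𝓝 (0 : ℝ), 0 < (x + ε • v).2 :=
    continuousAt_const.eventually_lt
      (by fun_prop : Continuous fun ε : ℝ => (x + ε • v).2).continuousAt (by simpa using hx.2)
  have h3 : Tendsto (fun ε : ℝ => nrm (x + ε • v)) (𝓝 0) (𝓝[Hyp n] x) := by
    refine tendsto_nhdsWithin_of_tendsto_nhds_of_eventually_within _ ?_ ?_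
    · have := (continuousAt_nrm h0).comp (f := fun ε : ℝ => x + ε • v) hc.continuousAt
      have h4 : nrm (x + (0 : ℝ) • v) = x := by rw [zero_smul, add_zero, nrm_of_mem hx]
      rw [ContinuousAt] at this
      simpa only [Function.comp_def, h4] using this
    · filter_upwards [h1, h2] with ε h1 h2 using nrm_mem h1 h2
  filter_upwards [nhdsWithin_le_nhds (h3.eventually h.2.2), nhdsWithin_le_nhds h1,
    self_mem_nhdsWithin] with ε e1 e2 e3
  rw [e1, lor_nrm_nonneg_iff e2, lor_add_right, h.2.1, zero_add, lor_smul_right,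
    mul_nonneg_iff_of_pos_left e3]

theorem IsInwardNormal.notMem_nhdsWithin (h : IsInwardNormal Y x u) (hx : x ∈ Hyp n) :
    Y ∉ 𝓝[Hyp n] x := by
  intro hY
  have hu : IsInwardNormal univ x u := by
    refine ⟨h.1, h.2.1, ?_⟩
    filter_upwards [h.2.2, hY] with y e1 e2
    exact ⟨fun _ => e1.1 e2, fun _ => trivial⟩
  obtain ⟨ε, e⟩ := (hu.eventually_nrm hx (-u)).exists
  have := e.1 (mem_univ _)
  rw [lor_neg_right, h.1] at this
  linarith

/-- Both normals have the same nonnegative half-space. The part of `u'` orthogonal to `u` lies in it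
together with its negative, so it is also orthogonal to `u'`, hence null and tangent, hence zero. -/
theorem IsInwardNormal.unique {u' : Mink n} (h : IsInwardNormal Y x u)
    (h' : IsInwardNormal Y x u') (hx : x ∈ Hyp n) : u = u' := by
  have key (v : Mink n) : 0 ≤ lor u v ↔ 0 ≤ lor u' v := by
    obtain ⟨ε, e1, e2⟩ := ((h.eventually_nrm hx v).and (h'.eventually_nrm hx v)).exists
    exact e1.symm.trans e2
  set a := lor u u' with ha
  have e1 : lor u (u' - a • u) = 0 := by
    rw [lor_sub_right, lor_smul_right, h.1, ← ha]; ring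
  have e2 : lor u' (u' - a • u) = 1 - a ^ 2 := by
    rw [lor_sub_right, lor_smul_right, h'.1, lor_comm u' u, ← ha]; ring
  have k1 := (key (u' - a • u)).1 e1.ge
  have k2 := (key (-(u' - a • u))).1 (by rw [lor_neg_right, e1, neg_zero])
  rw [lor_neg_right, e2] at k2
  rw [e2] at k1
  have e3 : u' - a • u = 0 := by
    refine eq_zero_of_orth hx ?_ ?_
    · rw [lor_sub_left, lor_smul_left, h.2.1, h'.2.1]; ring
    · rw [lor_sub_left, lor_smul_left, e1, e2]; linarith
  have e4 : 0 ≤ a := by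
    have := (key u').2 (by rw [h'.1]; norm_num)
    rwa [← ha] at this
  have e5 : a = 1 := by nlinarith
  rw [e5, one_smul, sub_eq_zero] at e3
  exact e3.symm

theorem IsInwardNormal.mem (h : IsInwardNormal Y x u) (hx : x ∈ Hyp n) : x ∈ Y :=
  (h.2.2.self_of_nhdsWithin hx).2 h.2.1.ge

theorem IsInwardNormal.eventually_isInwardNormal (h : IsInwardNormal Y x u) :
    ∀ᶠ y in 𝓝[Hyp n] x, lor u y = 0 → IsInwardNormal Y y u := by
  filter_upwards [eventually_eventually_nhdsWithin.2 h.2.2] with y hy h0 using ⟨h.1, h0, hy⟩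

theorem IsInwardNormal.eventually_mem_nhdsWithin (h : IsInwardNormal Y x u) :
    ∀ᶠ y in 𝓝[Hyp n] x, 0 < lor u y → Y ∈ 𝓝[Hyp n] y := by
  filter_upwards [eventually_eventually_nhdsWithin.2 h.2.2] with y hy h0
  have : ∀ᶠ z in 𝓝[Hyp n] y, 0 < lor u z := nhdsWithin_le_nhds
    (continuousAt_const.eventually_lt (by fun_prop : Continuous fun z => lor u z).continuousAt h0)
  filter_upwards [hy, this] with z h1 h2 using h1.2 h2.le

theorem IsInwardNormal.map {A : HypIsom n} (hA : ∀ y, A.1 y ∈ Y ↔ y ∈ Y)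
    (h : IsInwardNormal Y x u) : IsInwardNormal Y (A.1 x) (A.1 u) := by
  refine ⟨by rw [A.lor_map, h.1], by rw [A.lor_map, h.2.1], ?_⟩
  have h1 : Tendsto A⁻¹.1 (𝓝[Hyp n] (A.1 x)) (𝓝[Hyp n] x) := by
    refine tendsto_nhdsWithin_of_tendsto_nhds_of_eventually_within _ ?_ ?_
    · have := (A⁻¹.continuous.tendsto (A.1 x)).mono_left (nhdsWithin_le_nhds (s := Hyp n))
      rwa [A.inv_apply_self] at this
    · filter_upwards [self_mem_nhdsWithin] with y hy using A⁻¹.map_mem hy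
  filter_upwards [h1.eventually h.2.2] with y hy
  rw [← hA, A.apply_inv_self] at hy
  rw [hy, ← A.lor_map, A.apply_inv_self]

end Normals

end

end HypGeom

namespace HypGeom

noncomputable section

/-! ### Boundary walls and convexity of the universal cover. -/

namespace HypManifold

variable {n : ℕ} {M : HypManifold n}

theorem smul_mem_iff {γ : HypIsom n} (hγ : γ ∈ M.group) (x : Mink n) :
    γ.1 x ∈ M.cover ↔ x ∈ M.cover :=
  ⟨fun h => by simpa [γ.inv_apply_self] using M.group_invariant _ (M.group.inv_mem hγ) _ h,
    M.group_invariant γ hγ x⟩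

/-- A connectedness argument along the segment: the parameters at which `u` is the inward normal
form a clopen set. Openness is part of the local model; closedness uses it at a limit point,
together with uniqueness of the normal. -/
theorem isInwardNormal_seg {x y u : Mink n} (hx : x ∈ Hyp n) (hy : y ∈ Hyp n)
    (hu : IsInwardNormal M.cover x u) (h : lor u y = 0) (t : unitInterval) :
    IsInwardNormal M.cover (seg x y t) u := by
  have hlor (s : unitInterval) : lor u (seg x y s) = 0 := lor_seg_eq_zero hx hy hu.2.1 h s
  have hmem (s : unitInterval) : seg x y s ∈ Hyp n := seg_mem_Hyp hx hy s
  set T : Set unitInterval := {s | IsInwardNormal M.cover (seg x y s) u} with hT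
  suffices hclopen : IsClopen T by
    have h0 : (0 : unitInterval) ∈ T := by
      change IsInwardNormal M.cover (seg x y 0) u
      rwa [seg_zero hx]
    have := hclopen.eq_univ ⟨0, h0⟩
    exact this.ge (mem_univ t)
  constructor
  · rw [← closure_subset_iff_isClosed]
    intro s hs
    have hf : ∃ᶠ r in 𝓝 s, r ∈ T := mem_closure_iff_frequently.1 hs
    have ht := tendsto_seg hx hy s
    have hsY : seg x y s ∈ M.cover := by
      refine M.isClosed_cover.mem_of_frequently_of_tendsto ?_ (ht.mono_right nhdsWithin_le_nhds)
      exact hf.mono fun r hr => IsInwardNormal.mem hr (hmem r)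
    rcases M.locally_halfspace _ hsY with hnb | ⟨u', hu'⟩
    · obtain ⟨r, hr, hr'⟩ := (hf.and_eventually
        (ht.eventually (eventually_eventually_nhdsWithin.2 hnb))).exists
      exact absurd hr' (IsInwardNormal.notMem_nhdsWithin hr (hmem r))
    -- A nearby boundary point lies on the wall of the limit point, since off the wall it would be
    -- interior. There the two normals agree.
    · obtain ⟨r, hr, h1, h2, h3⟩ := (hf.and_eventually (ht.eventually
        (hu'.2.2.and (hu'.eventually_isInwardNormal.and hu'.eventually_mem_nhdsWithin)))).exists
      have h4 := h1.1 (IsInwardNormal.mem hr (hmem r))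
      rcases h4.eq_or_lt with h5 | h5
      · have := IsInwardNormal.unique hr (h2 h5.symm) (hmem r)
        rw [hT, mem_ofPred_eq, this]
        exact hu'
      · exact absurd (h3 h5) (IsInwardNormal.notMem_nhdsWithin hr (hmem r))
  · rw [isOpen_iff_mem_nhds]
    intro s hs
    filter_upwards [(tendsto_seg hx hy s).eventually (IsInwardNormal.eventually_isInwardNormal hs)]
      with r hr using hr (hlor r)

/-- The whole hyperplane through a boundary point of the cover belongs to the boundary. -/
theorem isInwardNormal_of_lor_eq_zero {x y u : Mink n} (hx : x ∈ Hyp n) (hy : y ∈ Hyp n)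
    (hu : IsInwardNormal M.cover x u) (h : lor u y = 0) : IsInwardNormal M.cover y u := by
  have := isInwardNormal_seg hx hy hu h 1
  rwa [seg_one hy] at this

/-- The set of points of the connected cover on the nonnegative side of the wall is clopen: where
`lor u` vanishes, the point is on the wall itself, and near it the cover is the half-space of `u`.
-/
theorem lor_nonneg_of_mem {x y u : Mink n} (hx : x ∈ Hyp n) (hu : IsInwardNormal M.cover x u)
    (hy : y ∈ M.cover) : 0 ≤ lor u y := by
  have : PreconnectedSpace M.cover := isPreconnected_iff_preconnectedSpace.1
    M.isConnected_cover.isPreconnected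
  have hc : Continuous fun z : M.cover => lor u z.1 := by fun_prop
  have hclopen : IsClopen {z : M.cover | 0 ≤ lor u z.1} := by
    refine ⟨isClosed_le continuous_const hc, isOpen_iff_mem_nhds.2 fun z hz => ?_⟩
    have hz0 : 0 ≤ lor u z.1 := hz
    rcases hz0.eq_or_lt with h0 | h0
    · have h1 := isInwardNormal_of_lor_eq_zero hx (M.cover_subset z.2) hu h0.symm
      have h2 : Tendsto (Subtype.val : M.cover → Mink n) (𝓝 z) (𝓝[Hyp n] z.1) :=
        tendsto_nhdsWithin_of_tendsto_nhds_of_eventually_within _ continuousAt_subtype_val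
          (Eventually.of_forall fun y => M.cover_subset y.2)
      filter_upwards [h2.eventually h1.2.2] with y hy using hy.1 y.2
    · filter_upwards [continuousAt_const.eventually_lt hc.continuousAt h0] with y hy using le_of_lt hy
  have := hclopen.eq_univ ⟨⟨x, hu.mem hx⟩, hu.2.1.ge⟩
  exact this.ge (mem_univ (⟨y, hy⟩ : M.cover))

/-- The universal cover is convex. -/
theorem seg_mem_cover {a b : Mink n} (ha : a ∈ M.cover) (hb : b ∈ M.cover) (t : unitInterval) :
    seg a b t ∈ M.cover := by
  have ha' := M.cover_subset ha
  have hb' := M.cover_subset hb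
  have hclopen : IsClopen {s : unitInterval | seg a b s ∈ M.cover} := by
    refine ⟨M.isClosed_cover.preimage (continuous_seg continuous_const continuous_const
      continuous_id (fun _ => ha') fun _ => hb'), isOpen_iff_mem_nhds.2 fun s hs => ?_⟩
    have ht := tendsto_seg ha' hb' s
    rcases M.locally_halfspace _ hs with hnb | ⟨u, hu⟩
    · exact ht.eventually hnb
    · filter_upwards [ht.eventually hu.2.2] with r hr
      refine hr.2 (lor_seg_nonneg ha' hb' ?_ ?_ r)
      · exact lor_nonneg_of_mem (seg_mem_Hyp ha' hb' s) hu ha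
      · exact lor_nonneg_of_mem (seg_mem_Hyp ha' hb' s) hu hb
  have h0 : (0 : unitInterval) ∈ {s : unitInterval | seg a b s ∈ M.cover} := by
    change seg a b 0 ∈ M.cover
    rwa [seg_zero ha']
  exact (hclopen.eq_univ ⟨0, h0⟩).ge (mem_univ t)

/-- A hyperplane of the boundary that contains an interior point of a segment contains the whole
segment. -/
theorem isInwardNormal_endpoints {a b v : Mink n} {s r : ℝ} (ha : a ∈ M.cover) (hb : b ∈ M.cover)
    (hs : 0 < s) (hr : 0 < r) (hz : s • a + r • b ∈ Hyp n)
    (hv : IsInwardNormal M.cover (s • a + r • b) v) :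
    IsInwardNormal M.cover a v ∧ IsInwardNormal M.cover b v := by
  have h1 := lor_nonneg_of_mem hz hv ha
  have h2 := lor_nonneg_of_mem hz hv hb
  have h3 := hv.2.1
  rw [lor_add_right, lor_smul_right, lor_smul_right] at h3
  have h4 := mul_nonneg hs.le h1
  have h5 := mul_nonneg hr.le h2
  have h6 : s * lor v a = 0 := by linarith
  have h7 : r * lor v b = 0 := by linarith
  exact ⟨isInwardNormal_of_lor_eq_zero hz (M.cover_subset ha) hv
    ((mul_eq_zero.1 h6).resolve_left hs.ne'), isInwardNormal_of_lor_eq_zero hz (M.cover_subset hb) hv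
    ((mul_eq_zero.1 h7).resolve_left hr.ne')⟩

/-! ### Orthogeodesics -/

/-- Perpendicularity makes the tangential part of `q` at `p` a multiple of `u`. Its length is fixed
by `lor q q = -1`, and its sign is nonnegative because `q` is in the cover. -/
theorem PerpAt.exists_eq {p q : Mink n} (hp : p ∈ M.cover) (hq : q ∈ M.cover)
    (h : PerpAt M p q) : ∃ u, IsInwardNormal M.cover p u ∧
      q = (-lor p q) • p + Real.sqrt (lor p q ^ 2 - 1) • u := by
  obtain ⟨u, hu, hw⟩ := h
  have hp' := M.cover_subset hp
  have hq' := M.cover_subset hq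
  refine ⟨u, hu, ?_⟩
  set r := q + lor p q • p with hr
  have h1 : lor r p = 0 := by
    rw [hr, lor_add_left, lor_smul_left, hp'.1, lor_comm q p]; ring
  have h2 : lor u r = lor u q := by
    rw [hr, lor_add_right, lor_smul_right, hu.2.1]; ring
  have h0 : 0 ≤ lor u q := lor_nonneg_of_mem hp' hu hq
  set s := lor u q
  have z1 : lor (r - s • u) p = 0 := by rw [lor_sub_left, h1, lor_smul_left, hu.2.1]; ring
  have z2 : lor (r - s • u) u = 0 := by
    rw [lor_sub_left, lor_smul_left, hu.1, lor_comm r u, h2]; ring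
  -- The perpendicularity test is applied to the error vector `r - s • u` itself, which thereby
  -- becomes null.
  have z3 := hw _ z1 z2
  have z4 : lor (r - s • u) (r - s • u) = 0 := by
    rw [lor_sub_right, z3, lor_smul_right, z2]; ring
  have z5 := sub_eq_zero.1 (eq_zero_of_orth hp' z1 z4)
  have h3 : lor r r = s ^ 2 := by
    rw [z5, lor_smul_left, lor_smul_right, hu.1]; ring
  have h4 : lor r r = lor p q ^ 2 - 1 := by
    rw [hr, lor_add_right, lor_smul_right, ← hr, h1, hr, lor_add_left, lor_smul_left, hq'.1]; ring
  have h5 : Real.sqrt (lor p q ^ 2 - 1) = s := by rw [← h4, h3, Real.sqrt_sq h0]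
  rw [h5, ← z5, hr, neg_smul]
  abel

/-- The configuration of the endpoints and the normals of an orthogeodesic; `C` and `S` are the
hyperbolic cosine and sine of its length. -/
structure OrthoConfig (M : HypManifold n) (p q u w : Mink n) (C S : ℝ) : Prop where
  mem_left : p ∈ M.cover
  mem_right : q ∈ M.cover
  normal_left : IsInwardNormal M.cover p u
  normal_right : IsInwardNormal M.cover q w
  C_pos : 0 < C
  S_pos : 0 < S
  sq_sub_sq : C ^ 2 - S ^ 2 = 1
  right_eq : q = C • p + S • u
  normal_right_eq : w = -(S • p + C • u)

theorem GeodArc.IsOrthogeodesic.exists_config {α : M.GeodArc} (h : α.IsOrthogeodesic) :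
    ∃ u w, OrthoConfig M α.source α.target u w (-lor α.source α.target)
      (Real.sqrt (lor α.source α.target ^ 2 - 1)) := by
  obtain ⟨u, hu, e1⟩ := h.1.exists_eq α.source_mem α.target_mem
  obtain ⟨w, hw, e2⟩ := h.2.exists_eq α.target_mem α.source_mem
  have hp := M.cover_subset α.source_mem
  have hq := M.cover_subset α.target_mem
  have hL : lor α.source α.target < -1 := lt_of_le_of_ne (lor_le_neg_one hp hq)
    fun h' => α.source_ne_target (eq_of_lor_eq_neg_one hp hq h')
  rw [lor_comm α.target] at e2
  set L := lor α.source α.target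
  have hS : 0 < Real.sqrt (L ^ 2 - 1) := Real.sqrt_pos.2 (by nlinarith)
  have hSS : Real.sqrt (L ^ 2 - 1) ^ 2 = L ^ 2 - 1 := Real.sq_sqrt (by nlinarith)
  set S := Real.sqrt (L ^ 2 - 1)
  refine ⟨u, w, α.source_mem, α.target_mem, hu, hw, by linarith, hS, ?_, e1, ?_⟩
  · rw [hSS]; ring
  · have h1 : S • w = S • -(S • α.source + (-L) • u) := by
      have h2 : S • w = α.source - (-L) • α.target := eq_sub_of_add_eq' e2.symm
      rw [h2]
      nth_rewrite 1 [e1]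
      rw [smul_neg, smul_add, smul_smul, smul_add, smul_smul, smul_smul, ← sq S, hSS]
      module
    exact smul_right_injective _ hS.ne' h1

namespace OrthoConfig

variable {p q u w : Mink n} {C S : ℝ} (c : OrthoConfig M p q u w C S)

include c

theorem left_mem_Hyp : p ∈ Hyp n := M.cover_subset c.mem_left

theorem right_mem_Hyp : q ∈ Hyp n := M.cover_subset c.mem_right

theorem left_eq : p = C • q + S • w := by
  rw [c.right_eq, c.normal_right_eq]
  have : C • (C • p + S • u) + S • -(S • p + C • u) = (C ^ 2 - S ^ 2) • p := by module
  rw [this, c.sq_sub_sq, one_smul]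

theorem symm : OrthoConfig M q p w u C S where
  mem_left := c.mem_right
  mem_right := c.mem_left
  normal_left := c.normal_right
  normal_right := c.normal_left
  C_pos := c.C_pos
  S_pos := c.S_pos
  sq_sub_sq := c.sq_sub_sq
  right_eq := c.left_eq
  normal_right_eq := by
    rw [c.right_eq, c.normal_right_eq]
    have : -(S • (C • p + S • u) + C • -(S • p + C • u)) = (C ^ 2 - S ^ 2) • u := by module
    rw [this, c.sq_sub_sq, one_smul]

/-- The outer sides of the two walls are disjoint, also at infinity: `v` may be a point of the
hyperboloid or a light-like vector. The formula for `w` shows this at once, since both of its terms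
contribute with a favourable sign. -/
theorem lor_right_pos {v : Mink n} (hv : lor p v < 0) (h : lor u v ≤ 0) : 0 < lor w v := by
  rw [c.normal_right_eq, lor_neg_left, lor_add_left, lor_smul_left, lor_smul_left]
  have h1 := mul_neg_of_pos_of_neg c.S_pos hv
  have h2 := mul_nonpos_of_nonneg_of_nonpos c.C_pos.le h
  linarith

theorem lor_left_pos {v : Mink n} (hv : lor p v < 0) (h : lor w v ≤ 0) : 0 < lor u v := by
  by_contra! hn
  linarith [c.lor_right_pos hv hn]

theorem normal_ne : u ≠ w := by
  intro h
  have := c.lor_right_pos (v := p) (by rw [c.left_mem_Hyp.1]; norm_num) c.normal_left.2.1.le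
  rw [← h, c.normal_left.2.1] at this
  exact this.false

end OrthoConfig

end HypManifold

/-! ### Geodesics that cross both walls of an orthogeodesic. -/

open HypManifold

/-- The oriented geodesics that start on the negative side of `u` and end on the negative side
of `w`. -/
def fromTo {n : ℕ} (u w : Mink n) : Set (Geod n) :=
  {g | lor u (nullVec g.1.1) < 0 ∧ lor w (nullVec g.1.2) < 0}

namespace HypManifold.OrthoConfig

variable {n : ℕ} {M : HypManifold n} {p q u w : Mink n} {C S : ℝ}

/-- The geodesic enters through the wall of `u` and leaves through the wall of `w`. The two crossing
points are in the cover because entire walls are; between them convexity applies, and beyond them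
one of the half-space conditions fails. -/
theorem line_inter_cover_of_fromTo (c : OrthoConfig M p q u w C S) {g : Geod n}
    (hg : g ∈ fromTo u w) :
    ∃ a b : Mink n, a ∈ M.cover ∧ b ∈ M.cover ∧ lor u a = 0 ∧ lor w b = 0 ∧
      g.line ∩ M.cover = range (seg a b) := by
  obtain ⟨u1, w2⟩ := hg
  have hp := c.left_mem_Hyp
  have n1 := lor_nullVec_neg hp g.1.1
  have n2 := lor_nullVec_neg hp g.1.2
  have w1 : 0 < lor w (nullVec g.1.1) := c.lor_right_pos n1 u1.le
  have u2 : 0 < lor u (nullVec g.1.2) := c.lor_left_pos n2 w2.le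
  set N1 := nullVec g.1.1 with hN1
  set N2 := nullVec g.1.2 with hN2
  -- The coefficients are chosen to make `lor u`, respectively `lor w`, vanish on the combination.
  have ha := g.nrm_mem_line u2 (neg_pos.2 u1)
  have hb := g.nrm_mem_line (neg_pos.2 w2) w1
  have hat := g.timelike u2 (neg_pos.2 u1)
  have hbt := g.timelike (neg_pos.2 w2) w1
  rw [← hN1, ← hN2] at ha hb hat hbt
  set a := nrm (lor u N2 • N1 + (-lor u N1) • N2) with hadef
  set b := nrm ((-lor w N2) • N1 + lor w N1 • N2) with hbdef
  have hua : lor u a = 0 := by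
    rw [lor_nrm_eq_zero_iff hat.1, lor_add_right, lor_smul_right, lor_smul_right]; ring
  have hwb : lor w b = 0 := by
    rw [lor_nrm_eq_zero_iff hbt.1, lor_add_right, lor_smul_right, lor_smul_right]; ring
  have haY : a ∈ M.cover :=
    (isInwardNormal_of_lor_eq_zero hp ha.1 c.normal_left hua).mem ha.1
  have hbY : b ∈ M.cover :=
    (isInwardNormal_of_lor_eq_zero c.right_mem_Hyp hb.1 c.normal_right hwb).mem hb.1
  have hwa : 0 < lor w a := c.lor_right_pos (lor_neg_of_mem hp ha.1) hua.le
  have hub : 0 < lor u b := c.lor_left_pos (lor_neg_of_mem hp hb.1) hwb.le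
  refine ⟨a, b, haY, hbY, hua, hwb, Subset.antisymm ?_ ?_⟩
  · rintro y ⟨hy, hyY⟩
    have hyu := lor_nonneg_of_mem hp c.normal_left hyY
    have hyw := lor_nonneg_of_mem c.right_mem_Hyp c.normal_right hyY
    obtain ⟨-, a1, a2, hae⟩ := ha
    obtain ⟨-, b1, b2, hbe⟩ := hb
    obtain ⟨hyH, y1, y2, hye⟩ := hy
    -- Since `lor u a = 0` and `lor w b = 0`, the functionals `lor w` and `lor u` read off the
    -- coefficients of `a` and `b`.
    refine mem_range_seg hyH (div_nonneg hyw hwa.le) (div_nonneg hyu hub.le) ?_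
    rw [← sub_eq_zero]
    set s := lor w y / lor w a
    set r := lor u y / lor u b
    have zu : lor u (y - (s • a + r • b)) = 0 := by
      rw [lor_sub_right, lor_add_right, lor_smul_right, lor_smul_right, hua,
        div_mul_cancel₀ _ hub.ne']; ring
    have zw : lor w (y - (s • a + r • b)) = 0 := by
      rw [lor_sub_right, lor_add_right, lor_smul_right, lor_smul_right, hwb,
        div_mul_cancel₀ _ hwa.ne']; ring
    obtain ⟨z1, z2, hz⟩ : ∃ z1 z2 : ℝ, y - (s • a + r • b) = z1 • N1 + z2 • N2 :=
      ⟨y1 - (s * a1 + r * b1), y2 - (s * a2 + r * b2), by rw [hye, hae, hbe]; module⟩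
    rw [hz] at zu zw ⊢
    -- The error vector is orthogonal to `u` and `w`. If it were nonzero, it would be, up to sign, a
    -- nonnegative combination of the endpoints at infinity, and such a vector cannot lie on both
    -- walls.
    have key (x1 x2 : ℝ) (h1 : 0 ≤ x1) (h2 : 0 ≤ x2) (h3 : 0 < x1 + x2)
        (hu : lor u (x1 • N1 + x2 • N2) = 0) (hw : lor w (x1 • N1 + x2 • N2) = 0) : False := by
      have : lor p (x1 • N1 + x2 • N2) < 0 := by
        rw [lor_add_right, lor_smul_right, lor_smul_right]
        by_contra! hn
        have e1 := mul_nonpos_of_nonneg_of_nonpos h1 n1.le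
        have e2 := mul_nonpos_of_nonneg_of_nonpos h2 n2.le
        have e3 : x1 = 0 := by
          refine (mul_eq_zero.1 (?_ : x1 * lor p N1 = 0)).resolve_right n1.ne; linarith
        have e4 : x2 = 0 := by
          refine (mul_eq_zero.1 (?_ : x2 * lor p N2 = 0)).resolve_right n2.ne; linarith
        linarith
      linarith [c.lor_right_pos this hu.le]
    have zu' := zu
    rw [lor_add_right, lor_smul_right, lor_smul_right] at zu'
    rcases lt_trichotomy z1 0 with h1 | h1 | h1
    · have h2 : z2 ≤ 0 := by by_contra! hn; nlinarith
      refine (key (-z1) (-z2) (by linarith) (by linarith) (by linarith) ?_ ?_).elim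
      · have : -z1 • N1 + -z2 • N2 = -(z1 • N1 + z2 • N2) := by module
        rw [this, lor_neg_right, zu, neg_zero]
      · have : -z1 • N1 + -z2 • N2 = -(z1 • N1 + z2 • N2) := by module
        rw [this, lor_neg_right, zw, neg_zero]
    · rw [h1, zero_mul, zero_add] at zu'
      rw [h1, (mul_eq_zero.1 zu').resolve_right u2.ne', zero_smul, zero_smul, add_zero]
    · have h2 : 0 ≤ z2 := by by_contra! hn; nlinarith
      exact (key z1 z2 h1.le h2 (by linarith) zu zw).elim
  · rintro _ ⟨t, rfl⟩
    refine ⟨⟨seg_mem_Hyp ha.1 hb.1 t, ?_⟩, seg_mem_cover haY hbY t⟩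
    obtain ⟨s, r, -, -, h⟩ := seg_eq_combination ha.1 hb.1 t
    obtain ⟨-, a1, a2, hae⟩ := ha
    obtain ⟨-, b1, b2, hbe⟩ := hb
    refine ⟨s * a1 + r * b1, s * a2 + r * b2, ?_⟩
    rw [h, hae, hbe]
    module

/-- The oriented geodesics that cross both boundary hyperplanes. -/
def crossing (u w : Mink n) : Set (Geod n) := fromTo u w ∪ fromTo w u

theorem line_inter_cover (c : OrthoConfig M p q u w C S) {g : Geod n} (hg : g ∈ crossing u w) :
    ∃ a b : Mink n, a ∈ M.cover ∧ b ∈ M.cover ∧ lor u a = 0 ∧ lor w b = 0 ∧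
      g.line ∩ M.cover = range (seg a b) := by
  rcases hg with hg | hg
  · exact c.line_inter_cover_of_fromTo hg
  · have := c.line_inter_cover_of_fromTo (g := g.flip) ⟨hg.2, hg.1⟩
    rwa [Geod.line_flip] at this

/-- A boundary point of the chord is either an end, where the normal is known, or an inner point,
and then its wall contains the whole chord and so has the normal of the end `a`. -/
theorem normal_cases (c : OrthoConfig M p q u w C S) {a b z v : Mink n} (ha : a ∈ M.cover)
    (hb : b ∈ M.cover) (hua : lor u a = 0) (hwb : lor w b = 0) (hz : z ∈ range (seg a b))
    (hv : IsInwardNormal M.cover z v) : v = u ∨ v = w := by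
  have ha' := M.cover_subset ha
  have hb' := M.cover_subset hb
  have nu := isInwardNormal_of_lor_eq_zero c.left_mem_Hyp ha' c.normal_left hua
  have nw := isInwardNormal_of_lor_eq_zero c.right_mem_Hyp hb' c.normal_right hwb
  obtain ⟨t, rfl⟩ := hz
  have hzH := seg_mem_Hyp ha' hb' t
  obtain ⟨s, r, hs, hr, h⟩ := seg_eq_combination ha' hb' t
  rw [h] at hv hzH
  rcases hs.eq_or_lt with rfl | hs
  · rw [zero_smul, zero_add] at hv hzH
    rw [smul_eq_self_of_mem hb' hr hzH, one_smul] at hv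
    exact .inr (hv.unique nw hb')
  rcases hr.eq_or_lt with rfl | hr
  · rw [zero_smul, add_zero] at hv hzH
    rw [smul_eq_self_of_mem ha' hs.le hzH, one_smul] at hv
    exact .inl (hv.unique nu ha')
  · exact .inl ((isInwardNormal_endpoints ha hb hs hr hzH hv).1.unique nu ha')

/-- A deck transformation that takes a geodesic that crosses both boundary hyperplanes to another
one is trivial. -/
theorem eq_one_of_smul_mem (c : OrthoConfig M p q u w C S) {γ : HypIsom n} (hγ : γ ∈ M.group)
    {g : Geod n} (hg : g ∈ crossing u w) (hg' : γ • g ∈ crossing u w) : γ = 1 := by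
  obtain ⟨a, b, ha, hb, hua, hwb, h⟩ := c.line_inter_cover hg
  obtain ⟨a', b', ha', hb', hua', hwb', h'⟩ := c.line_inter_cover hg'
  have aH := M.cover_subset ha
  have bH := M.cover_subset hb
  have nu := isInwardNormal_of_lor_eq_zero c.left_mem_Hyp aH c.normal_left hua
  have nw := isInwardNormal_of_lor_eq_zero c.right_mem_Hyp bH c.normal_right hwb
  have himg (z : Mink n) (hz : z ∈ range (seg a b)) : γ.1 z ∈ range (seg a' b') := by
    rw [← h] at hz
    rw [← h', Geod.line_smul]
    exact ⟨mem_image_of_mem _ hz.1, M.group_invariant γ hγ z hz.2⟩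
  have hu := c.normal_cases ha' hb' hua' hwb' (himg a ⟨0, seg_zero aH⟩)
    (nu.map (smul_mem_iff hγ))
  have hw := c.normal_cases ha' hb' hua' hwb' (himg b ⟨1, seg_one bH⟩)
    (nw.map (smul_mem_iff hγ))
  have hne : γ.1 u ≠ γ.1 w := fun e => c.normal_ne (γ.1.injective e)
  -- The normals determine the feet of the common perpendicular, so `γ` acts on `p` and `q` as it
  -- acts on `u` and `w`.
  have hp : S • p = -(w + C • u) := by rw [c.normal_right_eq]; module
  have hq : S • q = -(u + C • w) := by rw [c.symm.normal_right_eq]; module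
  have hS := c.S_pos.ne'
  rcases hu with hu | hu <;> rcases hw with hw | hw
  · exact absurd (hu.trans hw.symm) hne
  · refine M.group_free γ hγ p c.mem_left (smul_right_injective _ hS ?_)
    change S • γ.1 p = S • p
    rw [← map_smul, hp, map_neg, map_add, map_smul, hu, hw]
  · have h1 : γ.1 p = q := smul_right_injective _ hS (by
      change S • γ.1 p = S • q
      rw [← map_smul, hp, hq, map_neg, map_add, map_smul, hu, hw])
    have h2 : γ.1 q = p := smul_right_injective _ hS (by
      change S • γ.1 q = S • p
      rw [← map_smul, hp, hq, map_neg, map_add, map_smul, hu, hw])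
    -- If the walls are exchanged, so are `p` and `q`, and the midpoint of the arc is a fixed point
    -- in the cover, against freeness.
    let t : unitInterval := ⟨1 / 2, by norm_num, by norm_num⟩
    refine M.group_free γ hγ (seg p q t) (seg_mem_cover c.mem_left c.mem_right t) ?_
    rw [← γ.seg_map, h1, h2, seg_eq_nrm, seg_eq_nrm]
    congr 1
    simp only [t]
    module
  · exact absurd (hu.trans hw.symm) hne

end HypManifold.OrthoConfig

end

end HypGeom

namespace HypGeom

noncomputable section

namespace HypManifold

variable {n : ℕ} {M : HypManifold n}

/-! ### The covering projection -/

instance : ContinuousConstSMul M.group M.cover where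
  continuous_const_smul γ :=
    (γ.1.continuous.comp continuous_subtype_val).subtype_mk _

instance : IsCancelSMul M.group M.cover where
  left_cancel' _ _ _ h := MulAction.injective _ h
  right_cancel' a b x h := by
    have h1 : (b⁻¹ * a) • x = x := by rw [mul_smul, h, inv_smul_smul]
    have h2 := M.group_free _ (b⁻¹ * a).2 x.1 x.2 (congrArg Subtype.val h1)
    exact (inv_mul_eq_one.1 (Subtype.ext h2 : b⁻¹ * a = 1)).symm

instance : LocallyCompactSpace M.cover := M.isClosed_cover.locallyCompactSpace

instance : ProperlyDiscontinuousSMul M.group M.cover where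
  finite_disjoint_inter_image {K L} hK hL := by
    have h := M.group_properlyDiscontinuous (Subtype.val '' (K ∪ L))
      (by rintro _ ⟨x, -, rfl⟩; exact x.2) ((hK.union hL).image continuous_subtype_val)
    refine (h.preimage (f := (Subtype.val : M.group → HypIsom n))
      Subtype.val_injective.injOn).subset ?_
    rintro γ ⟨_, ⟨x, hx, rfl⟩, hL⟩
    exact ⟨γ.2, γ.1.1 x.1, ⟨x.1, ⟨x, .inl hx, rfl⟩, rfl⟩, ⟨_, .inr hL, rfl⟩⟩

theorem isQuotientCoveringMap_proj : IsQuotientCoveringMap M.proj M.group :=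
  isQuotientCoveringMap_quotientMk_of_properlyDiscontinuousSMul

theorem continuous_proj : Continuous M.proj := continuous_quotient_mk'

theorem proj_eq_iff {x y : M.cover} : M.proj x = M.proj y ↔ ∃ γ : M.group, γ • y = x :=
  Quotient.eq''

theorem proj_mem_boundary_iff {x : M.cover} :
    M.proj x ∈ M.boundary ↔ ∃ u, IsInwardNormal M.cover x.1 u := by
  refine ⟨?_, fun h => ⟨x, h, rfl⟩⟩
  rintro ⟨y, ⟨u, hu⟩, h⟩
  obtain ⟨γ, rfl⟩ := proj_eq_iff.1 h.symm
  exact ⟨_, hu.map (smul_mem_iff γ.2)⟩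

/-- The cover is exhausted by countably many compact sets, and each returns to itself under finitely
many elements only. Countability allows unions of translates to be measured. -/
instance : Countable M.group := by
  have hK (j : ℕ) : IsCompact (M.cover ∩ Metric.closedBall 0 j) :=
    (isCompact_closedBall _ _).inter_left M.isClosed_cover
  have hfin (j : ℕ) := M.group_properlyDiscontinuous _ inter_subset_left (hK j)
  have hU : (M.group : Set (HypIsom n)) ⊆ ⋃ j : ℕ, {γ : HypIsom n | γ ∈ M.group ∧
      ((γ.1 '' (M.cover ∩ Metric.closedBall 0 j)) ∩
        (M.cover ∩ Metric.closedBall 0 j)).Nonempty} := by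
    intro γ hγ
    obtain ⟨x, hx⟩ := M.isConnected_cover.nonempty
    obtain ⟨j, hj⟩ := exists_nat_ge (max ‖x‖ ‖γ.1 x‖)
    refine mem_iUnion.2 ⟨j, hγ, γ.1 x, ⟨x, ⟨hx, ?_⟩, rfl⟩, M.group_invariant γ hγ x hx, ?_⟩
    · simpa using (le_max_left _ _).trans hj
    · simpa using (le_max_right _ _).trans hj
  exact ((countable_iUnion fun j => (hfin j).countable).mono hU).to_subtype

theorem continuous_lift (c : M.GeodArc) : Continuous c.lift :=
  (continuous_seg continuous_const continuous_const continuous_id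
    (fun _ => M.cover_subset c.source_mem) fun _ => M.cover_subset c.target_mem).subtype_mk _

/-- A path in the boundary of the cover stays in the same hyperplane. -/
theorem lor_eq_zero_of_path {u : Mink n} {f : unitInterval → M.cover} (hf : Continuous f)
    (hb : ∀ s, ∃ v, IsInwardNormal M.cover (f s).1 v) (hu : IsInwardNormal M.cover (f 0).1 u)
    (s : unitInterval) : lor u (f s).1 = 0 := by
  have hc : Continuous fun s => lor u (f s).1 := by fun_prop
  have hclopen : IsClopen {s | lor u (f s).1 = 0} := by
    refine ⟨isClosed_eq hc continuous_const, isOpen_iff_mem_nhds.2 fun s hs => ?_⟩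
    have hs' : lor u (f s).1 = 0 := hs
    have h1 := isInwardNormal_of_lor_eq_zero (M.cover_subset (f 0).2) (M.cover_subset (f s).2) hu hs'
    have h2 : Tendsto (fun r => (f r).1) (𝓝 s) (𝓝[Hyp n] (f s).1) :=
      tendsto_nhdsWithin_of_tendsto_nhds_of_eventually_within _
        ((continuous_subtype_val.comp hf).tendsto s)
        (Eventually.of_forall fun y => M.cover_subset (f y).2)
    filter_upwards [h2.eventually h1.2.2, h2.eventually h1.eventually_mem_nhdsWithin] with r e1 e2
    have e3 := e1.1 (f r).2
    obtain ⟨v, hv⟩ := hb r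
    by_contra hne
    exact hv.notMem_nhdsWithin (M.cover_subset (f r).2) (e2 (lt_of_le_of_ne e3 (Ne.symm hne)))
  exact (hclopen.eq_univ ⟨0, hu.2.1⟩).ge (mem_univ s)

theorem geodProj_eq_iff {g g' : Geod n} :
    M.geodProj g = M.geodProj g' ↔ ∃ γ : M.group, γ • g' = g :=
  Quotient.eq''

theorem geodProj_smul (γ : M.group) (g : Geod n) : M.geodProj (γ • g) = M.geodProj g :=
  geodProj_eq_iff.2 ⟨γ, rfl⟩

/-! ### The homotopy class rel boundary of an orthogeodesic. -/

namespace OrthoConfig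

variable {p q u w : Mink n} {C S : ℝ}

/-- A point of the line is a combination of the two endpoints with positive coefficients, so a
functional that vanishes at the point has opposite signs at the endpoints or vanishes at both. -/
theorem lor_nullVec_opposite {g : Geod n} {u a : Mink n}
    (ha : a ∈ g.line) (hua : lor u a = 0) :
    (lor u (nullVec g.1.1) = 0 ∧ lor u (nullVec g.1.2) = 0) ∨
      (lor u (nullVec g.1.1) < 0 ∧ 0 < lor u (nullVec g.1.2)) ∨
      (0 < lor u (nullVec g.1.1) ∧ lor u (nullVec g.1.2) < 0) := by
  obtain ⟨haH, x, y, rfl⟩ := ha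
  obtain ⟨hx, hy⟩ := g.pos_of_mem haH
  rw [lor_add_right, lor_smul_right, lor_smul_right] at hua
  rcases lt_trichotomy (lor u (nullVec g.1.1)) 0 with h | h | h
  · exact .inr (.inl ⟨h, by by_contra! hn; nlinarith⟩)
  · rw [h, mul_zero, zero_add] at hua
    exact .inl ⟨h, (mul_eq_zero.1 hua).resolve_left hy.ne'⟩
  · exact .inr (.inr ⟨h, by by_contra! hn; nlinarith⟩)

theorem not_isCompact_line (g : Geod n) : ¬ IsCompact g.line := by
  intro h
  obtain ⟨R, hR⟩ := h.isBounded.exists_norm_le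
  have hL := g.lor_neg
  set L := lor (nullVec g.1.1) (nullVec g.1.2) with hLdef
  have hL0 := hL.ne
  set a : ℝ := |R| + 1 with ha
  have ha0 : 0 < a := by positivity
  set b : ℝ := (-2 * L * a)⁻¹ with hb
  have hb0 : 0 < b := by rw [hb, inv_pos]; nlinarith
  have hmem : a • nullVec g.1.1 + b • nullVec g.1.2 ∈ g.line := by
    refine ⟨⟨?_, (g.timelike ha0 hb0).2⟩, a, b, rfl⟩
    simp only [lor_add_left, lor_add_right, lor_smul_left, lor_smul_right, lor_nullVec_self]
    rw [lor_comm (nullVec g.1.2), ← hLdef, hb]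
    field_simp
    ring
  have h1 := hR _ hmem
  have h2 := norm_snd_le (a • nullVec g.1.1 + b • nullVec g.1.2)
  rw [Prod.snd_add, Prod.smul_snd, Prod.smul_snd, nullVec_snd, nullVec_snd, smul_eq_mul,
    smul_eq_mul, mul_one, mul_one, Real.norm_of_nonneg (by positivity)] at h2
  linarith [le_abs_self R]

/-- A geodesic with both endpoints at the infinity of a wall lies in the wall, hence in the cover,
and then its intersection with the cover is a complete line and not compact. -/
theorem not_both_zero {x v : Mink n} (hx : x ∈ Hyp n) (hv : IsInwardNormal M.cover x v)
    {g : Geod n} {a b : Mink n} (ha : a ∈ Hyp n) (hb : b ∈ Hyp n)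
    (h : g.line ∩ M.cover = range (seg a b)) :
    ¬ (lor v (nullVec g.1.1) = 0 ∧ lor v (nullVec g.1.2) = 0) := by
  rintro ⟨h1, h2⟩
  have hsub : g.line ⊆ M.cover := by
    rintro y ⟨hy, s, r, rfl⟩
    refine (isInwardNormal_of_lor_eq_zero hx hy hv ?_).mem hy
    rw [lor_add_right, lor_smul_right, lor_smul_right, h1, h2]; ring
  rw [inter_eq_left.2 hsub] at h
  refine not_isCompact_line g ?_
  rw [h]
  exact isCompact_range (continuous_seg continuous_const continuous_const continuous_id
    (fun _ => ha) fun _ => hb)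

theorem mem_crossing (c : OrthoConfig M p q u w C S) {g : Geod n} {a b : Mink n}
    (ha : a ∈ Hyp n) (hb : b ∈ Hyp n) (h : g.line ∩ M.cover = range (seg a b))
    (hua : lor u a = 0) (hwb : lor w b = 0) : g ∈ crossing u w := by
  have hal : a ∈ g.line := (h.ge ⟨0, seg_zero ha⟩).1
  have hbl : b ∈ g.line := (h.ge ⟨1, seg_one hb⟩).1
  have h1 := (lor_nullVec_opposite hal hua).resolve_left
    (not_both_zero c.left_mem_Hyp c.normal_left ha hb h)
  have h2 := (lor_nullVec_opposite hbl hwb).resolve_left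
    (not_both_zero c.right_mem_Hyp c.normal_right ha hb h)
  have n1 := lor_nullVec_neg c.left_mem_Hyp g.1.1
  have n2 := lor_nullVec_neg c.left_mem_Hyp g.1.2
  rcases h1 with h1 | h1 <;> rcases h2 with h2 | h2
  · linarith [c.lor_right_pos n1 h1.1.le, h2.1]
  · exact .inl ⟨h1.1, h2.2⟩
  · exact .inr ⟨h2.1, h1.2⟩
  · linarith [c.lor_right_pos n2 h1.2.le, h2.2]

/-- The homotopy lifts to the cover starting from the lift of `α`. The tracks of its ends are
boundary paths, which cannot leave their walls; at the other end of the homotopy the lift is a deck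
translate of the given arc. -/
theorem homotopicGeod_subset {α : M.GeodArc}
    (c : OrthoConfig M α.source α.target u w C S) :
    α.homotopicGeod ⊆ M.geodProj '' crossing u w := by
  rintro _ ⟨-, g, rfl, d, hd, H, H0, H1, Hb⟩
  have cov := (isQuotientCoveringMap_proj (M := M)).isCoveringMap
  -- Time is reversed so that the homotopy begins at `α`, for which a lift is at hand.
  set H' : C(unitInterval × unitInterval, M.Space) :=
    H.comp ⟨fun z => (unitInterval.symm z.1, z.2), by fun_prop⟩ with hH'
  have hH0 (t : unitInterval) : H' (0, t) = M.proj ((⟨α.lift, continuous_lift α⟩ :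
      C(unitInterval, M.cover)) t) := by
    simp only [hH', ContinuousMap.comp_apply, ContinuousMap.coe_mk, unitInterval.symm_zero, H1]
    rfl
  set F := cov.liftHomotopy H' ⟨α.lift, continuous_lift α⟩ hH0 with hF
  have F0 (t : unitInterval) : F (0, t) = α.lift t := cov.liftHomotopy_zero _ _ hH0 t
  have Fl (z) : M.proj (F z) = H' z := congrFun (cov.liftHomotopy_lifts _ _ hH0) z
  have Fd (t : unitInterval) : M.proj (F (1, t)) = M.proj (d.lift t) := by
    rw [Fl]
    simp only [hH', ContinuousMap.comp_apply, ContinuousMap.coe_mk, unitInterval.symm_one, H0]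
    rfl
  obtain ⟨γ, hγ⟩ := proj_eq_iff.1 (Fd 0)
  have hFd : (fun t => F (1, t)) = fun t => γ • d.lift t := by
    refine cov.eq_of_comp_eq (by fun_prop) ((continuous_lift d).const_smul γ) ?_ 0 hγ.symm
    funext t
    exact (Fd t).trans (proj_eq_iff.2 ⟨γ⁻¹, inv_smul_smul γ _⟩)
  have hs := M.cover_subset d.source_mem
  have ht := M.cover_subset d.target_mem
  have hS := M.cover_subset α.source_mem
  have hT := M.cover_subset α.target_mem
  have hu : lor u (γ.1.1 d.source) = 0 := by
    have h1 := lor_eq_zero_of_path (M := M) (u := u) (f := fun s => F (s, 0)) (by fun_prop)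
      (fun s => proj_mem_boundary_iff.1 (by rw [Fl]; exact (Hb _).1))
      (by
        rw [F0]
        change IsInwardNormal M.cover (seg α.source α.target 0) u
        rw [seg_zero hS]; exact c.normal_left) 1
    rw [congrFun hFd 0] at h1
    change lor u (γ.1.1 (seg d.source d.target 0)) = 0 at h1
    rwa [seg_zero hs] at h1
  have hw : lor w (γ.1.1 d.target) = 0 := by
    have h1 := lor_eq_zero_of_path (M := M) (u := w) (f := fun s => F (s, 1)) (by fun_prop)
      (fun s => proj_mem_boundary_iff.1 (by rw [Fl]; exact (Hb _).2))
      (by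
        rw [F0]
        change IsInwardNormal M.cover (seg α.source α.target 1) w
        rw [seg_one hT]; exact c.normal_right) 1
    rw [congrFun hFd 1] at h1
    change lor w (γ.1.1 (seg d.source d.target 1)) = 0 at h1
    rwa [seg_one ht] at h1
  refine ⟨γ • g, c.mem_crossing (γ.1.map_mem hs) (γ.1.map_mem ht) ?_ hu hw, geodProj_smul γ g⟩
  have h1 : (γ • g).line = γ.1.1 '' g.line := Geod.line_smul γ.1 g
  have h2 : M.cover = γ.1.1 '' M.cover := by
    ext x
    refine ⟨fun hx => ⟨γ.1⁻¹.1 x, M.group_invariant _ (M.group.inv_mem γ.2) x hx,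
      γ.1.apply_inv_self x⟩, ?_⟩
    rintro ⟨y, hy, rfl⟩
    exact M.group_invariant _ γ.2 y hy
  rw [h1, h2, ← image_inter γ.1.1.injective, hd, ← range_comp]
  congr 1
  funext t
  exact (γ.1.seg_map _ _ t).symm

/-- The ends of the chord slide along their walls to the ends of `α`, and at each time they are
joined by a geodesic segment. Convexity keeps everything in the cover. -/
theorem subset_homotopicGeod {α : M.GeodArc}
    (c : OrthoConfig M α.source α.target u w C S) :
    M.geodProj '' crossing u w ⊆ α.homotopicGeod := by
  rintro _ ⟨g, hg, rfl⟩
  obtain ⟨a, b, ha, hb, hua, hwb, h⟩ := c.line_inter_cover hg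
  have haH := M.cover_subset ha
  have hbH := M.cover_subset hb
  have hS := M.cover_subset α.source_mem
  have hT := M.cover_subset α.target_mem
  refine ⟨⟨g, ⟨a, h.ge ⟨0, seg_zero haH⟩⟩, rfl⟩, g, rfl, ⟨a, b, ?_, seg_mem_cover ha hb, ha, hb⟩, h,
    ?_⟩
  · rintro rfl
    have := c.lor_right_pos (lor_neg_of_mem hS haH) hua.le
    linarith
  have m1 (s : unitInterval) : seg a α.source s ∈ M.cover := seg_mem_cover ha α.source_mem s
  have m2 (s : unitInterval) : seg b α.target s ∈ M.cover := seg_mem_cover hb α.target_mem s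
  let G : unitInterval × unitInterval → M.cover := fun z =>
    ⟨seg (seg a α.source z.1) (seg b α.target z.1) z.2, seg_mem_cover (m1 _) (m2 _) _⟩
  have hG : Continuous G := by
    refine (continuous_seg ?_ ?_ continuous_snd (fun z => M.cover_subset (m1 _))
      fun z => M.cover_subset (m2 _)).subtype_mk _
    · exact continuous_seg continuous_const continuous_const continuous_fst (fun _ => haH)
        fun _ => hS
    · exact continuous_seg continuous_const continuous_const continuous_fst (fun _ => hbH)
        fun _ => hT
  refine ⟨⟨M.proj ∘ G, continuous_proj.comp hG⟩, fun t => ?_, fun t => ?_, fun s => ⟨?_, ?_⟩⟩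
  · refine congrArg M.proj (Subtype.ext ?_)
    change seg (seg a α.source 0) (seg b α.target 0) t = seg a b t
    rw [seg_zero haH, seg_zero hbH]
  · refine congrArg M.proj (Subtype.ext ?_)
    change seg (seg a α.source 1) (seg b α.target 1) t = seg α.source α.target t
    rw [seg_one hS, seg_one hT]
  · refine proj_mem_boundary_iff.2 ⟨u, ?_⟩
    change IsInwardNormal M.cover (seg (seg a α.source s) (seg b α.target s) 0) u
    rw [seg_zero (M.cover_subset (m1 s))]
    exact isInwardNormal_of_lor_eq_zero hS (M.cover_subset (m1 s)) c.normal_left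
      (lor_seg_eq_zero haH hS hua c.normal_left.2.1 s)
  · refine proj_mem_boundary_iff.2 ⟨w, ?_⟩
    change IsInwardNormal M.cover (seg (seg a α.source s) (seg b α.target s) 1) w
    rw [seg_one (M.cover_subset (m2 s))]
    exact isInwardNormal_of_lor_eq_zero hT (M.cover_subset (m2 s)) c.normal_right
      (lor_seg_eq_zero hbH hT hwb c.normal_right.2.1 s)

theorem homotopicGeod_eq {α : M.GeodArc} (c : OrthoConfig M α.source α.target u w C S) :
    α.homotopicGeod = M.geodProj '' crossing u w :=
  Subset.antisymm c.homotopicGeod_subset c.subset_homotopicGeod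

end OrthoConfig

/-! ### The measure on the space of geodesics -/

theorem measurable_smul (A : HypIsom n) : Measurable fun x : SphereInf n => A • x := by
  have h : Continuous fun x : SphereInf n => A • x := by
    have hN : Continuous fun x : SphereInf n => A.1 (nullVec x) :=
      A.continuous.comp (continuous_subtype_val.prodMk continuous_const)
    exact ((hN.snd.inv₀ fun x => (isom_nullVec A x).1.ne').smul hN.fst).subtype_mk _
  exact h.measurable

theorem measurable_geod_smul (A : HypIsom n) : Measurable fun g : Geod n => A • g := by
  refine Measurable.subtype_mk (f := fun g : Geod n => (A • g.1.1, A • g.1.2)) ?_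
  have h := measurable_smul A
  fun_prop

theorem measurable_geodProj : Measurable M.geodProj := measurable_quotient_mk''

/-- A measurable set of geodesics that is mapped injectively to the space of geodesics, and
disjoint from its translates, has the same measure as its image. -/
theorem liouville_image (hinv : ∀ A : HypIsom n,
      MeasurePreserving (fun g : Geod n => A • g) (HypGeom.liouville n) (HypGeom.liouville n))
    {T : Set (Geod n)} (hT : MeasurableSet T) (hTX : T ⊆ M.coverGeod)
    (hfree : ∀ γ ∈ M.group, ∀ g ∈ T, γ • g ∈ T → γ = 1) :
    M.liouville (M.geodProj '' T) = HypGeom.liouville n T := by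
  set μ := HypGeom.liouville n with hμ
  have hinj : InjOn M.geodProj T := by
    intro g hg g' hg' h
    obtain ⟨γ, rfl⟩ := geodProj_eq_iff.1 h
    have h1 := hfree γ.1 γ.2 g' hg' hg
    change γ.1 • g' = g'
    rw [h1, one_smul]
  have hpre : M.geodProj ⁻¹' (M.geodProj '' T) = ⋃ γ : M.group, (fun g => γ • g) ⁻¹' T := by
    ext g
    simp only [mem_preimage, mem_image, mem_iUnion]
    constructor
    · rintro ⟨g', hg', h⟩
      obtain ⟨γ, rfl⟩ := geodProj_eq_iff.1 h
      exact ⟨γ, hg'⟩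
    · rintro ⟨γ, h⟩
      exact ⟨_, h, geodProj_smul γ g⟩
  have hmeas (γ : M.group) : Measurable fun g : Geod n => γ • g := measurable_geod_smul γ.1
  have hF : MeasurableSet (M.geodProj '' T) := by
    change MeasurableSet (M.geodProj ⁻¹' (M.geodProj '' T))
    rw [hpre]
    exact MeasurableSet.iUnion fun γ => hmeas γ hT
  set F := M.geodProj '' T with hFdef
  -- A competitor for the supremum: the measure is kept off `F` and replaced on `F` by the image of
  -- `T`. If it dominates every member of the family, the supremum gives `F` no more than `μ T`.
  set ρ : Measure M.GeodQuot := M.liouville.restrict Fᶜ + (μ.restrict T).map M.geodProj with hρ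
  have hmap (A : Set M.GeodQuot) (hA : MeasurableSet A) (V : Set (Geod n)) :
      (μ.restrict V).map M.geodProj A = μ (M.geodProj ⁻¹' A ∩ V) := by
    rw [Measure.map_apply measurable_geodProj hA, Measure.restrict_apply (measurable_geodProj hA)]
  have hle (V : Set (Geod n)) (hV : MeasurableSet V) (hVX : V ⊆ M.coverGeod)
      (hVi : InjOn M.geodProj V) : (μ.restrict V).map M.geodProj ≤ M.liouville :=
    le_iSup₂_of_le V hV (le_iSup₂_of_le hVX hVi le_rfl)
  have hdom : M.liouville ≤ ρ := by
    refine iSup₂_le fun V hV => iSup₂_le fun hVX hVi => Measure.le_iff.2 fun A hA => ?_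
    rw [← measure_inter_add_sdiff A hF, add_comm, hρ, Measure.add_apply,
      Measure.restrict_apply hA, ← sdiff_eq]
    refine add_le_add (hle V hV hVX hVi _) ?_
    rw [hmap _ (hA.inter hF), hmap _ hA]
    have h1 : M.geodProj ⁻¹' (A ∩ F) ∩ V ⊆
        ⋃ γ : M.group, (M.geodProj ⁻¹' A ∩ V) ∩ (fun g => γ • g) ⁻¹' T := by
      rintro g ⟨⟨gA, gF⟩, gV⟩
      have : g ∈ ⋃ γ : M.group, (fun g => γ • g) ⁻¹' T := hpre ▸ gF
      obtain ⟨γ, h⟩ := mem_iUnion.1 this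
      exact mem_iUnion.2 ⟨γ, ⟨gA, gV⟩, h⟩
    -- The part of `V` over `F` is cut into pieces that translates carry into `T`; invariance keeps
    -- their measure. The moved pieces are disjoint since `V` injects into the quotient and no
    -- nontrivial deck element keeps a point of `T` in `T`.
    have h2 (γ : M.group) : μ ((M.geodProj ⁻¹' A ∩ V) ∩ (fun g => γ • g) ⁻¹' T) =
        μ ((fun g => γ⁻¹ • g) ⁻¹' (M.geodProj ⁻¹' A ∩ V) ∩ T) := by
      have hm : MeasurableSet ((M.geodProj ⁻¹' A ∩ V) ∩ (fun g => γ • g) ⁻¹' T) :=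
        ((measurable_geodProj hA).inter hV).inter (hmeas γ hT)
      rw [← (hinv γ.1⁻¹).measure_preimage hm.nullMeasurableSet]
      congr 1
      ext g
      have : γ • γ⁻¹ • g = g := smul_inv_smul γ g
      change (_ ∧ γ • γ⁻¹ • g ∈ T) ↔ (_ ∧ g ∈ T)
      rw [this]
      rfl
    calc μ (M.geodProj ⁻¹' (A ∩ F) ∩ V)
        ≤ μ (⋃ γ : M.group, (M.geodProj ⁻¹' A ∩ V) ∩ (fun g => γ • g) ⁻¹' T) := measure_mono h1
      _ ≤ ∑' γ : M.group, μ ((M.geodProj ⁻¹' A ∩ V) ∩ (fun g => γ • g) ⁻¹' T) :=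
        measure_iUnion_le _
      _ = ∑' γ : M.group, μ ((fun g => γ⁻¹ • g) ⁻¹' (M.geodProj ⁻¹' A ∩ V) ∩ T) := by
        simp only [h2]
      _ = μ (⋃ γ : M.group, (fun g => γ⁻¹ • g) ⁻¹' (M.geodProj ⁻¹' A ∩ V) ∩ T) := by
        refine (measure_iUnion ?_ fun γ =>
          ((hmeas γ⁻¹) ((measurable_geodProj hA).inter hV)).inter hT).symm
        intro γ δ hne
        refine disjoint_left.2 ?_
        rintro g ⟨⟨-, h1⟩, hgT⟩ ⟨⟨-, h2⟩, -⟩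
        have h3 : γ⁻¹ • g = δ⁻¹ • g :=
          hVi h1 h2 ((geodProj_smul _ _).trans (geodProj_smul _ _).symm)
        have h4 : (γ * δ⁻¹) • g = g := by rw [mul_smul, ← h3, smul_inv_smul]
        have h5 := hfree _ (γ * δ⁻¹).2 g hgT (by
          change (γ * δ⁻¹) • g ∈ T
          rwa [h4])
        exact hne (mul_inv_eq_one.1 (Subtype.ext h5))
      _ ≤ μ (M.geodProj ⁻¹' A ∩ T) := by
        refine measure_mono (iUnion_subset fun γ => ?_)
        rintro g ⟨⟨h1, -⟩, hgT⟩
        refine ⟨?_, hgT⟩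
        have : M.geodProj (γ⁻¹ • g) ∈ A := h1
        rwa [geodProj_smul] at this
  have hTF : M.geodProj ⁻¹' F ∩ T = T := inter_eq_right.2 (subset_preimage_image _ _)
  refine le_antisymm ?_ ?_
  · refine (hdom F).trans ?_
    rw [hρ, Measure.add_apply, Measure.restrict_apply hF, inter_compl_self, measure_empty, zero_add,
      hmap F hF, hTF]
  · refine le_trans ?_ (hle T hT hTX hinj F)
    rw [hmap F hF, hTF]

theorem _root_.HypGeom.measurableSet_fromTo (u w : Mink n) : MeasurableSet (fromTo u w) := by
  have h (v : Mink n) : Continuous fun x : SphereInf n => lor v (nullVec x) :=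
    continuous_const.lor (continuous_subtype_val.prodMk continuous_const)
  have h1 : IsOpen {g : Geod n | lor u (nullVec g.1.1) < 0} :=
    isOpen_lt ((h u).comp (continuous_fst.comp continuous_subtype_val)) continuous_const
  have h2 : IsOpen {g : Geod n | lor w (nullVec g.1.2) < 0} :=
    isOpen_lt ((h w).comp (continuous_snd.comp continuous_subtype_val)) continuous_const
  exact (h1.inter h2).measurableSet

theorem OrthoConfig.liouville_homotopicGeod (hinv : ∀ A : HypIsom n,
      MeasurePreserving (fun g : Geod n => A • g) (HypGeom.liouville n) (HypGeom.liouville n))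
    {α : M.GeodArc} {u w : Mink n} {C S : ℝ} (c : OrthoConfig M α.source α.target u w C S) :
    M.liouville α.homotopicGeod =
      HypGeom.liouville n (fromTo u w) + HypGeom.liouville n (fromTo w u) := by
  rw [c.homotopicGeod_eq, liouville_image hinv, crossing, measure_union]
  · refine disjoint_left.2 fun g h1 h2 => ?_
    have := c.lor_right_pos (lor_nullVec_neg c.left_mem_Hyp g.1.1) h1.1.le
    linarith [h2.1]
  · exact measurableSet_fromTo w u
  · exact (measurableSet_fromTo u w).union (measurableSet_fromTo w u)
  · intro g hg
    obtain ⟨a, b, ha, -, -, -, h⟩ := c.line_inter_cover hg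
    exact ⟨a, h.ge ⟨0, seg_zero (M.cover_subset ha)⟩⟩
  · exact fun γ hγ g hg hg' => c.eq_one_of_smul_mem hγ hg hg'

end HypManifold

end

end HypGeom

namespace HypGeom

noncomputable section

/-! ### Reflections act on the mass shells `lor v v = -m` -/

section Shell

variable {k : ℕ}

/-- The point of the mass shell over `x`. -/
def shellLift (m : ℝ) (x : EuclideanSpace ℝ (Fin k)) : Mink k := (x, Real.sqrt (m + ‖x‖ ^ 2))

/-- The action of a reflection on the mass shell, in the space coordinate. -/
def shellMap (m : ℝ) (b : Mink k) (x : EuclideanSpace ℝ (Fin k)) : EuclideanSpace ℝ (Fin k) :=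
  (reflMap b (shellLift m x)).1

/-- The reflection preserves the form and the future cone, so it maps the shell to itself and is
determined there by the space coordinate. For `m = 0` the condition `hx` excludes the apex of the
cone. -/
theorem reflMap_shellLift {m : ℝ} (hm : 0 ≤ m) {b : Mink k} (hb : 0 < lor b b)
    {x : EuclideanSpace ℝ (Fin k)} (hx : 0 < m + ‖x‖ ^ 2) :
    reflMap b (shellLift m x) = shellLift m (shellMap m b x) := by
  have h0 : 0 < (reflMap b (shellLift m x)).2 := by
    rw [← reflIsom_apply b hb]
    refine (reflIsom b hb).snd_pos ?_ (Real.sqrt_pos.2 hx)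
    exact Real.le_sqrt_of_sq_le (by change ‖x‖ ^ 2 ≤ _; linarith)
  have h1 := lor_reflMap hb (shellLift m x) (shellLift m x)
  rw [lor_self, lor_self] at h1
  have h2 : (shellLift m x).2 ^ 2 = m + ‖x‖ ^ 2 := Real.sq_sqrt hx.le
  have h3 : (shellLift m x).1 = x := rfl
  rw [h2, h3] at h1
  refine Prod.ext rfl ?_
  change _ = Real.sqrt (m + ‖(reflMap b (shellLift m x)).1‖ ^ 2)
  rw [eq_comm, Real.sqrt_eq_iff_mul_self_eq_of_pos h0]
  linarith

theorem shell_pos_shellMap {m : ℝ} (hm : 0 ≤ m) {b : Mink k} (hb : 0 < lor b b)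
    {x : EuclideanSpace ℝ (Fin k)} (hx : 0 < m + ‖x‖ ^ 2) : 0 < m + ‖shellMap m b x‖ ^ 2 := by
  by_contra! hn
  have h : 0 < (reflMap b (shellLift m x)).2 := by
    rw [← reflIsom_apply b hb]
    refine (reflIsom b hb).snd_pos ?_ (Real.sqrt_pos.2 hx)
    exact Real.le_sqrt_of_sq_le (by change ‖x‖ ^ 2 ≤ _; linarith)
  rw [reflMap_shellLift hm hb hx] at h
  change 0 < Real.sqrt _ at h
  rw [Real.sqrt_eq_zero_of_nonpos hn] at h
  exact h.false

theorem shellMap_shellMap {m : ℝ} (hm : 0 ≤ m) {b : Mink k} (hb : 0 < lor b b)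
    {x : EuclideanSpace ℝ (Fin k)} (hx : 0 < m + ‖x‖ ^ 2) : shellMap m b (shellMap m b x) = x := by
  change (reflMap b (shellLift m (shellMap m b x))).1 = x
  rw [← reflMap_shellLift hm hb hx, reflMap_reflMap hb]
  rfl

/-- The derivative of `shellMap m b` at `x`. -/
def shellDeriv (m : ℝ) (b : Mink k) (x : EuclideanSpace ℝ (Fin k)) :
    EuclideanSpace ℝ (Fin k) →L[ℝ] EuclideanSpace ℝ (Fin k) :=
  ContinuousLinearMap.id ℝ _ - ((2 / lor b b) •
    (innerSL ℝ b.1 - (b.2 / Real.sqrt (m + ‖x‖ ^ 2)) • innerSL ℝ x)).smulRight b.1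

theorem hasFDerivAt_sqrt_add_norm_sq {m : ℝ} {x : EuclideanSpace ℝ (Fin k)}
    (hx : 0 < m + ‖x‖ ^ 2) :
    HasFDerivAt (fun y : EuclideanSpace ℝ (Fin k) => Real.sqrt (m + ‖y‖ ^ 2))
      ((1 / Real.sqrt (m + ‖x‖ ^ 2)) • innerSL ℝ x) x := by
  have h := ((hasStrictFDerivAt_norm_sq x).hasFDerivAt.const_add m).sqrt hx.ne'
  convert! h using 1
  rw [← Nat.cast_smul_eq_nsmul ℝ, smul_smul]
  congr 1
  push_cast
  field_simp

theorem hasFDerivAt_shellMap {m : ℝ} (b : Mink k) {x : EuclideanSpace ℝ (Fin k)}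
    (hx : 0 < m + ‖x‖ ^ 2) : HasFDerivAt (shellMap m b) (shellDeriv m b x) x := by
  have h1 := hasFDerivAt_sqrt_add_norm_sq hx
  have h2 : HasFDerivAt (fun y : EuclideanSpace ℝ (Fin k) => (2 * lor (shellLift m y) b / lor b b))
      ((2 / lor b b) • (innerSL ℝ b.1 - (b.2 / Real.sqrt (m + ‖x‖ ^ 2)) • innerSL ℝ x)) x := by
    have h3 := (((innerSL ℝ b.1).hasFDerivAt (x := x)).sub (h1.const_mul b.2)).const_mul
      (2 / lor b b)
    convert! h3 using 1
    · funext y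
      have : lor (shellLift m y) b = inner ℝ b.1 y - b.2 * Real.sqrt (m + ‖y‖ ^ 2) := by
        rw [lor_comm]; rfl
      rw [this]
      simp only [innerSL_apply_apply, Pi.sub_apply]
      ring
    · rw [smul_smul, mul_one_div]
  exact (hasFDerivAt_id x).sub (h2.smul_const b.1)

/-- The derivative is the identity minus a map of rank one, so its determinant is one minus a trace.
This number is, up to sign, the ratio of the time coordinates of the image and of the point. -/
theorem det_shellDeriv {m : ℝ} (hm : 0 ≤ m) {b : Mink k} (hb : 0 < lor b b)
    {x : EuclideanSpace ℝ (Fin k)} (hx : 0 < m + ‖x‖ ^ 2) :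
    |(shellDeriv m b x).det| =
      Real.sqrt (m + ‖shellMap m b x‖ ^ 2) / Real.sqrt (m + ‖x‖ ^ 2) := by
  set f : EuclideanSpace ℝ (Fin k) →L[ℝ] ℝ := (2 / lor b b) •
    (innerSL ℝ b.1 - (b.2 / Real.sqrt (m + ‖x‖ ^ 2)) • innerSL ℝ x) with hf
  have h1 : ((shellDeriv m b x : EuclideanSpace ℝ (Fin k) →L[ℝ] _) :
      EuclideanSpace ℝ (Fin k) →ₗ[ℝ] _) =
      LinearMap.transvection (-f : EuclideanSpace ℝ (Fin k) →L[ℝ] ℝ).toLinearMap b.1 := by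
    apply LinearMap.ext
    intro y
    change y - f y • b.1 = y + (-f y) • b.1
    rw [neg_smul, sub_eq_add_neg]
  have h2 : (shellDeriv m b x).det = 1 - f b.1 := by
    change LinearMap.det ((shellDeriv m b x : EuclideanSpace ℝ (Fin k) →L[ℝ] _) :
      EuclideanSpace ℝ (Fin k) →ₗ[ℝ] _) = _
    rw [h1, LinearMap.transvection.det]
    rfl
  have h3 : Real.sqrt (m + ‖shellMap m b x‖ ^ 2) = Real.sqrt (m + ‖x‖ ^ 2) -
      (2 * (inner ℝ x b.1 - Real.sqrt (m + ‖x‖ ^ 2) * b.2) / lor b b) * b.2 :=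
    (congrArg Prod.snd (reflMap_shellLift hm hb hx)).symm
  have hs := Real.sqrt_pos.2 hx
  set s := Real.sqrt (m + ‖x‖ ^ 2)
  have h4 : (shellDeriv m b x).det = -(Real.sqrt (m + ‖shellMap m b x‖ ^ 2) / s) := by
    rw [h2, h3, hf]
    simp only [smul_apply, sub_apply,
      innerSL_apply_apply, smul_eq_mul, real_inner_self_eq_norm_sq]
    have h5 := lor_self b
    field_simp
    rw [h5]
    ring
  rw [h4, abs_neg, abs_of_nonneg (by positivity)]

/-- The determinant is exactly what the density `1 / √(m + ‖x‖ ^ 2)` needs to be invariant under the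
change of variables. -/
theorem lintegral_shellMap {m : ℝ} (hm : 0 ≤ m) {b : Mink k} (hb : 0 < lor b b)
    (F : EuclideanSpace ℝ (Fin k) → ENNReal) :
    ∫⁻ x in {x | 0 < m + ‖x‖ ^ 2}, ENNReal.ofReal (1 / Real.sqrt (m + ‖x‖ ^ 2)) *
        F (shellMap m b x) =
      ∫⁻ x in {x | 0 < m + ‖x‖ ^ 2}, ENNReal.ofReal (1 / Real.sqrt (m + ‖x‖ ^ 2)) * F x := by
  set s : Set (EuclideanSpace ℝ (Fin k)) := {x | 0 < m + ‖x‖ ^ 2} with hs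
  have hsm : MeasurableSet s := (isOpen_lt continuous_const (by fun_prop)).measurableSet
  have himg : shellMap m b '' s = s := by
    ext y
    constructor
    · rintro ⟨x, hx, rfl⟩
      exact shell_pos_shellMap hm hb hx
    · intro hy
      exact ⟨_, shell_pos_shellMap hm hb hy, shellMap_shellMap hm hb hy⟩
  have hinj : InjOn (shellMap m b) s := fun x hx y hy h => by
    rw [← shellMap_shellMap hm hb hx, h, shellMap_shellMap hm hb hy]
  have := lintegral_image_eq_lintegral_abs_det_fderiv_mul volume hsm
    (fun x hx => (hasFDerivAt_shellMap b hx).hasFDerivWithinAt) hinj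
    (fun y => ENNReal.ofReal (1 / Real.sqrt (m + ‖y‖ ^ 2)) * F y)
  rw [himg] at this
  rw [this]
  refine setLIntegral_congr_fun hsm fun x hx => ?_
  have h1 := Real.sqrt_pos.2 (shell_pos_shellMap hm hb hx)
  rw [← mul_assoc, ← ENNReal.ofReal_mul (abs_nonneg _), det_shellDeriv hm hb hx]
  congr 2
  field_simp

end Shell

/-! ### Invariance of the hyperbolic volume -/

section Volume

variable {k : ℕ}

theorem measurable_shellLift (m : ℝ) : Measurable (shellLift m : EuclideanSpace ℝ (Fin k) → _) := by
  unfold shellLift; fun_prop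

theorem one_add_norm_sq_pos (x : EuclideanSpace ℝ (Fin k)) : 0 < 1 + ‖x‖ ^ 2 := by positivity

theorem shellLift_one_mem (x : EuclideanSpace ℝ (Fin k)) : shellLift 1 x ∈ Hyp k := by
  refine ⟨?_, Real.sqrt_pos.2 (one_add_norm_sq_pos x)⟩
  rw [lor_self]
  change ‖x‖ ^ 2 - Real.sqrt (1 + ‖x‖ ^ 2) ^ 2 = -1
  rw [Real.sq_sqrt (one_add_norm_sq_pos x).le]
  ring

theorem shellLift_fst {v : Mink k} (hv : v ∈ Hyp k) : shellLift 1 v.1 = v := by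
  refine Prod.ext rfl ?_
  have := hv.1
  rw [lor_self] at this
  change Real.sqrt (1 + ‖v.1‖ ^ 2) = v.2
  rw [Real.sqrt_eq_iff_mul_self_eq_of_pos hv.2]
  linarith

theorem hypVolume_eq_map : hypVolume k =
    ((volume : Measure (EuclideanSpace ℝ (Fin k))).withDensity
      (fun x => ENNReal.ofReal (1 / Real.sqrt (1 + ‖x‖ ^ 2)))).map (shellLift 1) := rfl

theorem lintegral_hypVolume {f : Mink k → ENNReal} (hf : Measurable f) :
    ∫⁻ v, f v ∂hypVolume k =
      ∫⁻ x, ENNReal.ofReal (1 / Real.sqrt (1 + ‖x‖ ^ 2)) * f (shellLift 1 x) := by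
  rw [hypVolume_eq_map, lintegral_map hf (measurable_shellLift 1)]
  exact lintegral_withDensity_eq_lintegral_mul _ (by fun_prop) (hf.comp (measurable_shellLift 1))

instance : SFinite (hypVolume k) := by
  unfold hypVolume
  infer_instance

theorem ae_mem_Hyp : ∀ᵐ v ∂hypVolume k, v ∈ Hyp k := by
  have hm : MeasurableSet (Hyp k) :=
    ((isClosed_eq (by fun_prop : Continuous fun v : Mink k => lor v v)
      continuous_const).measurableSet).inter (isOpen_lt continuous_const continuous_snd).measurableSet
  rw [hypVolume_eq_map]
  refine (ae_map_iff (measurable_shellLift 1).aemeasurable hm).2 ?_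
  exact Eventually.of_forall shellLift_one_mem

theorem lintegral_hypVolume_reflMap {b : Mink k} (hb : 0 < lor b b) {f : Mink k → ENNReal}
    (hf : Measurable f) :
    ∫⁻ v, f (reflMap b v) ∂hypVolume k = ∫⁻ v, f v ∂hypVolume k := by
  have hc : Continuous (reflMap b) := (reflMap b).continuous_of_finiteDimensional
  rw [lintegral_hypVolume hf, lintegral_hypVolume (f := fun v => f (reflMap b v)) (hf.comp hc.measurable)]
  have huniv : {x : EuclideanSpace ℝ (Fin k) | 0 < 1 + ‖x‖ ^ 2} = univ :=
    eq_univ_of_forall one_add_norm_sq_pos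
  have := lintegral_shellMap zero_le_one hb (fun x => f (shellLift 1 x))
  rw [huniv, setLIntegral_univ, setLIntegral_univ] at this
  rw [← this]
  refine lintegral_congr fun x => ?_
  rw [← reflMap_shellLift zero_le_one hb (one_add_norm_sq_pos x)]

/-- An integral over hyperbolic space does not change if the origin is interchanged with another
point by a reflection. -/
theorem exists_swap {p : Mink k} (hp : p ∈ Hyp k) :
    ∃ A : HypIsom k, A.1 p = origin k ∧ A.1 (origin k) = p ∧ (∀ v, A.1 (A.1 v) = v) ∧
      ∀ f : Mink k → ENNReal, Measurable f →
        ∫⁻ v, f (A.1 v) ∂hypVolume k = ∫⁻ v, f v ∂hypVolume k := by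
  by_cases h : p = origin k
  · exact ⟨1, h, h.symm, fun _ => rfl, fun _ _ => rfl⟩
  · have hb := lor_sub_self_pos hp origin_mem h
    have h1 := reflMap_sub_left hp origin_mem h
    refine ⟨reflIsom _ hb, h1, ?_, reflMap_reflMap hb, fun f hf => lintegral_hypVolume_reflMap hb hf⟩
    change reflMap (p - origin k) (origin k) = p
    have := reflMap_reflMap hb p
    rwa [h1] at this

end Volume

end

end HypGeom

namespace HypGeom

noncomputable section

/-! ### Jacobians on the sphere at infinity -/

section Sphere

variable {k : ℕ}

/-- The surface measure of the unit sphere. -/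
abbrev sphereMeasure (n : ℕ) : Measure (SphereInf n) :=
  (volume : Measure (EuclideanSpace ℝ (Fin n))).toSphere

theorem lintegral_polar {g : EuclideanSpace ℝ (Fin (k + 1)) → ENNReal} (hg : Measurable g) :
    ∫⁻ x, g x = ∫⁻ ω, (∫⁻ r in Ioi (0 : ℝ), ENNReal.ofReal (r ^ k) * g (r • ω.1))
      ∂sphereMeasure (k + 1) := by
  have hP := (volume : Measure (EuclideanSpace ℝ (Fin (k + 1)))).measurePreserving_homeomorphUnitSphereProd
  have h0 : ∫⁻ x, g x = ∫⁻ x in ({0}ᶜ : Set (EuclideanSpace ℝ (Fin (k + 1)))), g x := by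
    rw [restrict_compl_singleton]
  rw [h0, ← lintegral_subtype_comap (measurableSet_singleton _).compl]
  have h1 (x : ({0}ᶜ : Set (EuclideanSpace ℝ (Fin (k + 1))))) : g x.1 =
      g ((homeomorphUnitSphereProd _ x).2.1 • (homeomorphUnitSphereProd _ x).1.1) := by
    have := congrArg Subtype.val ((homeomorphUnitSphereProd _).symm_apply_apply x)
    rw [homeomorphUnitSphereProd_symm_apply_coe] at this
    rw [this]
  simp_rw [h1]
  have hm : Measurable fun z : SphereInf (k + 1) × Ioi (0 : ℝ) => g (z.2.1 • z.1.1) := by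
    fun_prop
  rw [hP.lintegral_comp hm, lintegral_prod _ hm.aemeasurable]
  refine lintegral_congr fun ω => ?_
  have hr : Measurable fun r : Ioi (0 : ℝ) => g (r.1 • ω.1) := by fun_prop
  rw [finrank_euclideanSpace_fin, Nat.add_sub_cancel, Measure.volumeIoiPow,
    lintegral_withDensity_eq_lintegral_mul _ (by fun_prop) hr,
    ← lintegral_subtype_comap measurableSet_Ioi]
  rfl

/-- The cutoff `r * a < 1` is the trace on a ray of a star-shaped region; the power of `a` that
results becomes a conformal factor or a density. -/
theorem lintegral_radial (k : ℕ) {a : ℝ} (ha : 0 < a) :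
    ∫⁻ r in Ioi (0 : ℝ), ENNReal.ofReal (r ^ k) * (if r * a < 1 then 1 else 0) =
      ENNReal.ofReal (a⁻¹ ^ (k + 1) / (k + 1)) := by
  have h1 : ∀ r : ℝ, ENNReal.ofReal (r ^ k) * (if r * a < 1 then 1 else 0) =
      (Iio a⁻¹).indicator (fun r => ENNReal.ofReal (r ^ k)) r := by
    intro r
    have h : r * a < 1 ↔ r ∈ Iio a⁻¹ := by rw [mem_Iio, inv_eq_one_div, lt_div_iff₀ ha]
    by_cases h' : r * a < 1
    · rw [if_pos h', indicator_of_mem (h.1 h'), mul_one]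
    · rw [if_neg h', indicator_of_notMem (fun h2 => h' (h.2 h2)), mul_zero]
  simp_rw [h1]
  rw [setLIntegral_indicator measurableSet_Iio, inter_comm, Ioi_inter_Iio,
    Measure.restrict_congr_set Ioo_ae_eq_Ioc, ← ofReal_integral_eq_lintegral_ofReal,
    ← intervalIntegral.integral_of_le (inv_pos.2 ha).le]
  · simp
  · exact (intervalIntegral.intervalIntegrable_pow _).1
  · filter_upwards [ae_restrict_mem measurableSet_Ioc] with y hy
    exact pow_nonneg hy.1.le _

theorem exists_measurable_extension {n : ℕ} {f : SphereInf n → ENNReal} (hf : Measurable f) :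
    ∃ F : EuclideanSpace ℝ (Fin n) → ENNReal, Measurable F ∧ ∀ ω : SphereInf n, F ω.1 = f ω := by
  refine ⟨Function.extend Subtype.val f 0, ?_, fun ω => Subtype.val_injective.extend_apply _ _ _⟩
  exact (MeasurableEmbedding.subtype_coe Metric.isClosed_sphere.measurableSet).measurable_extend hf
    measurable_const

/-- The surface measure of the sphere at infinity is changed by the isometry `A` by the conformal
factor, to the power of the dimension. -/
def HasSphereJacobian (A : HypIsom (k + 1)) : Prop :=
  ∀ f : SphereInf (k + 1) → ENNReal, Measurable f →
    ∫⁻ ω, ENNReal.ofReal ((A.1 (nullVec ω)).2⁻¹ ^ k) * f (A • ω) ∂sphereMeasure (k + 1) =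
      ∫⁻ ω, f ω ∂sphereMeasure (k + 1)

theorem shellLift_zero_smul (ω : SphereInf k) {r : ℝ} (hr : 0 < r) :
    shellLift 0 (r • ω.1) = r • nullVec ω := by
  refine Prod.ext rfl ?_
  change Real.sqrt (0 + ‖r • ω.1‖ ^ 2) = r * 1
  rw [zero_add, norm_smul, norm_eq_of_mem_sphere ω, mul_one, mul_one, Real.sqrt_sq (norm_nonneg _),
    Real.norm_of_nonneg hr.le]

/-- A function on the sphere is extended to be constant on rays, cut off at the unit ball, and
integrated over the light cone, whose measure `dx / ‖x‖` is preserved. On the ray of `ω` the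
reflection stretches by `l = (A.1 (nullVec ω)).2`: the cutoff contributes `l⁻¹ ^ (k + 1)`, and the
factor `‖x‖` that compensates the density contributes `l`. -/
theorem hasSphereJacobian_reflIsom {b : Mink (k + 1)} (hb : 0 < lor b b) :
    HasSphereJacobian (reflIsom b hb) := by
  intro f hf
  obtain ⟨F, hF, hFf⟩ := exists_measurable_extension hf
  set A := reflIsom b hb with hA
  set T := shellMap 0 b with hT
  have hTm : Measurable T := by
    have hc : Continuous (reflMap b) := (reflMap b).continuous_of_finiteDimensional
    exact (hc.measurable.comp (measurable_shellLift 0)).fst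
  set g : EuclideanSpace ℝ (Fin (k + 1)) → ENNReal :=
    fun x => F (‖x‖⁻¹ • x) * (if ‖x‖ < 1 then 1 else 0) with hg
  have hgm : Measurable g := by
    refine (hF.comp (by fun_prop)).mul ?_
    exact Measurable.ite (measurableSet_lt measurable_norm measurable_const) measurable_const
      measurable_const
  have hs : {x : EuclideanSpace ℝ (Fin (k + 1)) | 0 < 0 + ‖x‖ ^ 2} = {0}ᶜ := by
    ext x
    simp [sq_pos_iff]
  have hae : ∀ h : EuclideanSpace ℝ (Fin (k + 1)) → ENNReal,
      ∫⁻ x in {x : EuclideanSpace ℝ (Fin (k + 1)) | 0 < 0 + ‖x‖ ^ 2}, h x = ∫⁻ x, h x := by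
    intro h
    rw [hs, restrict_compl_singleton]
  have key := lintegral_shellMap le_rfl hb (fun x => ENNReal.ofReal ‖x‖ * g x)
  rw [hae, hae] at key
  have hsq (x : EuclideanSpace ℝ (Fin (k + 1))) : Real.sqrt (0 + ‖x‖ ^ 2) = ‖x‖ := by
    rw [zero_add, Real.sqrt_sq (norm_nonneg _)]
  simp only [hsq] at key
  have hm1 : Measurable fun x : EuclideanSpace ℝ (Fin (k + 1)) => ENNReal.ofReal (1 / ‖x‖) *
      (ENNReal.ofReal ‖T x‖ * g (T x)) := by
    refine Measurable.mul (by fun_prop) (Measurable.mul (by fun_prop) (hgm.comp hTm))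
  have hm2 : Measurable fun x : EuclideanSpace ℝ (Fin (k + 1)) => ENNReal.ofReal (1 / ‖x‖) *
      (ENNReal.ofReal ‖x‖ * g x) := by
    refine Measurable.mul (by fun_prop) (Measurable.mul (by fun_prop) hgm)
  rw [lintegral_polar hm1, lintegral_polar hm2] at key
  have e2 (ω : SphereInf (k + 1)) : ∫⁻ r in Ioi (0 : ℝ), ENNReal.ofReal (r ^ k) *
      (ENNReal.ofReal (1 / ‖r • ω.1‖) * (ENNReal.ofReal ‖r • ω.1‖ * g (r • ω.1))) =
      ENNReal.ofReal (1 / (k + 1)) * f ω := by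
    have := lintegral_radial k one_pos
    rw [inv_one, one_pow] at this
    rw [← this, ← lintegral_mul_const _ (by
      refine Measurable.mul (by fun_prop) (Measurable.ite ?_ measurable_const measurable_const)
      exact measurableSet_lt (by fun_prop) measurable_const)]
    refine setLIntegral_congr_fun measurableSet_Ioi fun r hr => ?_
    have hr0 : 0 < r := hr
    have hn : ‖r • ω.1‖ = r := by
      rw [norm_smul, norm_eq_of_mem_sphere ω, mul_one, Real.norm_of_nonneg hr0.le]
    simp only [hg, hn]
    rw [smul_smul, inv_mul_cancel₀ hr0.ne', one_smul, hFf, ← mul_assoc (ENNReal.ofReal (1 / r)),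
      ← ENNReal.ofReal_mul (by positivity), one_div_mul_cancel hr0.ne', ENNReal.ofReal_one, one_mul,
      mul_one, mul_comm (f ω), mul_assoc]
  have e1 (ω : SphereInf (k + 1)) : ∫⁻ r in Ioi (0 : ℝ), ENNReal.ofReal (r ^ k) *
      (ENNReal.ofReal (1 / ‖r • ω.1‖) * (ENNReal.ofReal ‖T (r • ω.1)‖ * g (T (r • ω.1)))) =
      ENNReal.ofReal (1 / (k + 1)) *
        (ENNReal.ofReal ((A.1 (nullVec ω)).2⁻¹ ^ k) * f (A • ω)) := by
    obtain ⟨hpos, hnorm⟩ := isom_nullVec A ω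
    set l := (A.1 (nullVec ω)).2 with hl
    have h1 : ENNReal.ofReal (1 / (k + 1)) * (ENNReal.ofReal (l⁻¹ ^ k) * f (A • ω)) =
        ENNReal.ofReal (l⁻¹ ^ (k + 1) / (k + 1)) * (ENNReal.ofReal l * f (A • ω)) := by
      rw [← mul_assoc, ← mul_assoc, ← ENNReal.ofReal_mul (by positivity),
        ← ENNReal.ofReal_mul (by positivity)]
      congr 2
      rw [pow_succ]
      field_simp
    rw [h1, ← lintegral_radial k hpos, ← lintegral_mul_const _ (by
      refine Measurable.mul (by fun_prop) (Measurable.ite ?_ measurable_const measurable_const)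
      exact measurableSet_lt (by fun_prop) measurable_const)]
    refine setLIntegral_congr_fun measurableSet_Ioi fun r hr => ?_
    have hr0 : 0 < r := hr
    have hn : ‖r • ω.1‖ = r := by
      rw [norm_smul, norm_eq_of_mem_sphere ω, mul_one, Real.norm_of_nonneg hr0.le]
    have hTr : T (r • ω.1) = r • (A.1 (nullVec ω)).1 := by
      change (reflMap b (shellLift 0 (r • ω.1))).1 = _
      rw [shellLift_zero_smul ω hr0, map_smul]
      rfl
    have hTn : ‖T (r • ω.1)‖ = r * l := by
      rw [hTr, norm_smul, hnorm, Real.norm_of_nonneg hr0.le]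
    have hdir : (r * l)⁻¹ • T (r • ω.1) = (A • ω : SphereInf (k + 1)).1 := by
      rw [hTr, smul_smul, mul_inv, mul_right_comm, inv_mul_cancel₀ hr0.ne', one_mul]
      rfl
    simp only [hg, hn, hTn]
    rw [hdir, hFf, ← mul_assoc (ENNReal.ofReal (1 / r)), ← ENNReal.ofReal_mul (by positivity)]
    have : 1 / r * (r * l) = l := by field_simp
    rw [this]
    ring
  simp_rw [e1, e2] at key
  have hsm : Measurable fun ω : SphereInf (k + 1) =>
      ENNReal.ofReal ((A.1 (nullVec ω)).2⁻¹ ^ k) * f (A • ω) := by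
    refine Measurable.mul ?_ (hf.comp (HypManifold.measurable_smul A))
    have hN : Continuous fun x : SphereInf (k + 1) => A.1 (nullVec x) :=
      A.continuous.comp (continuous_subtype_val.prodMk continuous_const)
    have := hN.snd.measurable
    fun_prop
  rw [lintegral_const_mul _ hsm, lintegral_const_mul _ hf] at key
  refine (ENNReal.mul_right_inj ?_ ENNReal.ofReal_ne_top).1 key
  rw [ne_eq, ENNReal.ofReal_eq_zero, not_le]
  positivity

end Sphere

end

end HypGeom

namespace HypGeom

noncomputable section

/-! ### Jacobians of all isometries, and invariance of the Liouville measure. -/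

section Invariance

variable {k : ℕ}

/-- Polar coordinates for a function that is constant on rays. This moves statements about the
sphere to Lebesgue measure. -/
theorem lintegral_cone {F : EuclideanSpace ℝ (Fin (k + 1)) → ENNReal} (hF : Measurable F) :
    ∫⁻ x, F (‖x‖⁻¹ • x) * (if ‖x‖ < 1 then 1 else 0) =
      ENNReal.ofReal (1 / (k + 1)) * ∫⁻ ω, F ω.1 ∂sphereMeasure (k + 1) := by
  have hgm : Measurable fun x : EuclideanSpace ℝ (Fin (k + 1)) =>
      F (‖x‖⁻¹ • x) * (if ‖x‖ < 1 then 1 else 0) := by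
    refine (hF.comp (by fun_prop)).mul ?_
    exact Measurable.ite (measurableSet_lt measurable_norm measurable_const) measurable_const
      measurable_const
  rw [lintegral_polar hgm, ← lintegral_const_mul _ (by fun_prop)]
  refine lintegral_congr fun ω => ?_
  have := lintegral_radial k one_pos
  rw [inv_one, one_pow] at this
  rw [← this, ← lintegral_mul_const _ (by
    refine Measurable.mul (by fun_prop) (Measurable.ite ?_ measurable_const measurable_const)
    exact measurableSet_lt (by fun_prop) measurable_const)]
  refine setLIntegral_congr_fun measurableSet_Ioi fun r hr => ?_
  have hr0 : 0 < r := hr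
  have hn : ‖r • ω.1‖ = r := by
    rw [norm_smul, norm_eq_of_mem_sphere ω, mul_one, Real.norm_of_nonneg hr0.le]
  simp only [hn]
  rw [smul_smul, inv_mul_cancel₀ hr0.ne', one_smul, mul_one, mul_comm (F ω), mul_assoc]

theorem ofReal_one_div_ne_zero (k : ℕ) : ENNReal.ofReal (1 / (k + 1)) ≠ 0 := by
  rw [ne_eq, ENNReal.ofReal_eq_zero, not_le]
  positivity

theorem lintegral_sphere_comp_isometry
    (O : EuclideanSpace ℝ (Fin (k + 1)) ≃ₗᵢ[ℝ] EuclideanSpace ℝ (Fin (k + 1)))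
    {F : EuclideanSpace ℝ (Fin (k + 1)) → ENNReal} (hF : Measurable F) :
    ∫⁻ ω, F (O ω.1) ∂sphereMeasure (k + 1) = ∫⁻ ω, F ω.1 ∂sphereMeasure (k + 1) := by
  refine (ENNReal.mul_right_inj (ofReal_one_div_ne_zero k) ENNReal.ofReal_ne_top).1 ?_
  rw [← lintegral_cone hF, ← lintegral_cone (F := fun x => F (O x))
    (hF.comp O.continuous.measurable)]
  have hgm : Measurable fun x : EuclideanSpace ℝ (Fin (k + 1)) =>
      F (‖x‖⁻¹ • x) * (if ‖x‖ < 1 then 1 else 0) := by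
    refine (hF.comp (by fun_prop)).mul ?_
    exact Measurable.ite (measurableSet_lt measurable_norm measurable_const) measurable_const
      measurable_const
  have := (LinearIsometryEquiv.measurePreserving O).lintegral_comp hgm
  simpa only [map_smul, LinearIsometryEquiv.norm_map] using this

/-- An isometry that fixes the origin preserves the time coordinate, so it acts on the sphere as an
orthogonal map with conformal factor one. -/
theorem hasSphereJacobian_of_fix {A : HypIsom (k + 1)} (hA : A.1 (origin (k + 1)) = origin (k + 1)) :
    HasSphereJacobian A := by
  intro f hf
  obtain ⟨F, hF, hFf⟩ := exists_measurable_extension hf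
  have hsnd (v : Mink (k + 1)) : (A.1 v).2 = v.2 := by
    have := A.lor_map v (origin (k + 1))
    rw [hA, lor_origin, lor_origin] at this
    linarith
  let O : EuclideanSpace ℝ (Fin (k + 1)) →ₗᵢ[ℝ] EuclideanSpace ℝ (Fin (k + 1)) :=
    { toLinearMap := LinearMap.fst ℝ _ _ ∘ₗ A.1.toLinearMap ∘ₗ LinearMap.inl ℝ _ _
      norm_map' := fun x => by
        change ‖(A.1 (x, 0)).1‖ = ‖x‖
        have h1 := A.lor_map (x, 0) (x, 0)
        rw [lor_self, lor_self, hsnd] at h1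
        have h2 : ‖(A.1 (x, 0)).1‖ ^ 2 = ‖x‖ ^ 2 := by simpa using h1
        exact (pow_left_inj₀ (norm_nonneg _) (norm_nonneg _) two_ne_zero).1 h2 }
  have hsmul (ω : SphereInf (k + 1)) : (A • ω : SphereInf (k + 1)).1 = O ω.1 := by
    change (A.1 (nullVec ω)).2⁻¹ • (A.1 (nullVec ω)).1 = (A.1 (ω.1, 0)).1
    have h3 : nullVec ω = (ω.1, 0) + origin (k + 1) := by ext1 <;> simp [nullVec, origin]
    rw [hsnd, nullVec_snd, inv_one, one_smul, h3, map_add, hA, Prod.fst_add]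
    simp [origin]
  rw [← lintegral_congr hFf, ← lintegral_sphere_comp_isometry (O.toLinearIsometryEquiv rfl) hF]
  refine lintegral_congr fun ω => ?_
  rw [hsnd, nullVec_snd, inv_one, one_pow, ENNReal.ofReal_one, one_mul, ← hFf, hsmul]
  rfl

theorem measurable_conformal_factor (A : HypIsom (k + 1)) :
    Measurable fun ω : SphereInf (k + 1) => ENNReal.ofReal ((A.1 (nullVec ω)).2⁻¹ ^ k) := by
  have hN : Continuous fun x : SphereInf (k + 1) => A.1 (nullVec x) :=
    A.continuous.comp (continuous_subtype_val.prodMk continuous_const)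
  have := hN.snd.measurable
  fun_prop

theorem HasSphereJacobian.mul {A B : HypIsom (k + 1)} (hA : HasSphereJacobian A)
    (hB : HasSphereJacobian B) : HasSphereJacobian (A * B) := by
  intro f hf
  rw [← hA f hf]
  refine Eq.trans ?_ (hB (fun ω => ENNReal.ofReal ((A.1 (nullVec ω)).2⁻¹ ^ k) * f (A • ω))
    ((measurable_conformal_factor A).mul (hf.comp (HypManifold.measurable_smul A))))
  refine lintegral_congr fun ω => ?_
  have h0 := (isom_nullVec B ω).1
  have h1 := (isom_nullVec A (B • ω)).1
  rw [← mul_assoc, ← ENNReal.ofReal_mul (by positivity), ← mul_pow, mul_smul]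
  congr 3
  rw [B.nullVec_smul, map_smul, HypIsom.mul_apply]
  simp only [Prod.smul_snd, smul_eq_mul, mul_inv, inv_inv]
  field_simp

/-- A reflection moves the image of the origin back to the origin, so every isometry is a reflection
times an element of the stabiliser, or lies in it. -/
theorem hasSphereJacobian (A : HypIsom (k + 1)) : HasSphereJacobian A := by
  have ho := origin_mem (n := k + 1)
  by_cases h : A.1 (origin (k + 1)) = origin (k + 1)
  · exact hasSphereJacobian_of_fix h
  · have hb := lor_sub_self_pos (A.map_mem ho) ho h
    set R := reflIsom _ hb with hR
    have h1 : HasSphereJacobian (R * A) := by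
      refine hasSphereJacobian_of_fix ?_
      rw [HypIsom.mul_apply]
      exact reflMap_sub_left (A.map_mem ho) ho h
    have h2 : R * (R * A) = A := by
      refine Subtype.ext (LinearEquiv.ext fun v => ?_)
      exact reflMap_reflMap hb _
    rw [← h2]
    exact (hasSphereJacobian_reflIsom hb).mul h1

/-! ### The Liouville measure as an iterated integral -/

/-- The density of the Liouville measure. -/
def liouvilleDensity (x y : SphereInf (k + 1)) : ENNReal :=
  ENNReal.ofReal (2 / ‖(x : EuclideanSpace ℝ (Fin (k + 1))) - y‖ ^ (2 * (k + 1) - 2))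

theorem liouvilleDensity_eq (x y : SphereInf (k + 1)) : liouvilleDensity x y =
    ENNReal.ofReal (2 / (-2 * lor (nullVec x) (nullVec y)) ^ k) := by
  rw [liouvilleDensity, ← norm_sub_sq_eq, ← pow_mul]
  rfl

theorem measurable_liouvilleDensity :
    Measurable fun z : SphereInf (k + 1) × SphereInf (k + 1) => liouvilleDensity z.1 z.2 := by
  unfold liouvilleDensity
  fun_prop

theorem measurableSet_image_val {B : Set (Geod (k + 1))} (hB : MeasurableSet B) :
    MeasurableSet (Subtype.val '' B : Set (SphereInf (k + 1) × SphereInf (k + 1))) :=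
  (MeasurableEmbedding.subtype_coe
    (isOpen_ne_fun continuous_fst continuous_snd).measurableSet).measurableSet_image.2 hB

theorem liouville_apply {B : Set (Geod (k + 1))} (hB : MeasurableSet B) :
    liouville (k + 1) B = ∫⁻ x, (∫⁻ y, liouvilleDensity x y *
      (Subtype.val '' B).indicator 1 (x, y) ∂sphereMeasure (k + 1)) ∂sphereMeasure (k + 1) := by
  have hemb : MeasurableEmbedding
      (Subtype.val : Geod (k + 1) → SphereInf (k + 1) × SphereInf (k + 1)) :=
    MeasurableEmbedding.subtype_coe (isOpen_ne_fun continuous_fst continuous_snd).measurableSet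
  have hm := measurableSet_image_val hB
  rw [liouville, hemb.comap_apply, withDensity_apply _ hm, ← lintegral_indicator hm,
    lintegral_prod]
  · refine lintegral_congr fun x => lintegral_congr fun y => ?_
    by_cases h : (x, y) ∈ (Subtype.val '' B : Set (SphereInf (k + 1) × SphereInf (k + 1)))
    · rw [indicator_of_mem h, indicator_of_mem h, Pi.one_apply, mul_one]
      rfl
    · rw [indicator_of_notMem h, indicator_of_notMem h, mul_zero]
  · exact (measurable_liouvilleDensity.indicator hm).aemeasurable

/-- Isometries preserve the Liouville measure. -/
theorem measurePreserving_geod_smul (A : HypIsom (k + 1)) :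
    MeasurePreserving (fun g : Geod (k + 1) => A • g) (liouville (k + 1)) (liouville (k + 1)) := by
  refine ⟨HypManifold.measurable_geod_smul A, Measure.ext fun B hB => ?_⟩
  have hAB := HypManifold.measurable_geod_smul A hB
  rw [Measure.map_apply (HypManifold.measurable_geod_smul A) hB, liouville_apply hAB,
    liouville_apply hB]
  set D : SphereInf (k + 1) × SphereInf (k + 1) → ENNReal := fun z =>
    liouvilleDensity z.1 z.2 * (Subtype.val '' B).indicator 1 z with hD
  have hDm : Measurable D :=
    measurable_liouvilleDensity.mul (measurable_one.indicator (measurableSet_image_val hB))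
  set l : SphereInf (k + 1) → ℝ := fun x => (A.1 (nullVec x)).2⁻¹ with hl
  have hl0 (x) : 0 < l x := inv_pos.2 (isom_nullVec A x).1
  have key (x y : SphereInf (k + 1)) : liouvilleDensity x y *
      (Subtype.val '' ((fun g : Geod (k + 1) => A • g) ⁻¹' B)).indicator 1 (x, y) =
      ENNReal.ofReal (l x ^ k) * (ENNReal.ofReal (l y ^ k) * D (A • x, A • y)) := by
    have hmem : (x, y) ∈ (Subtype.val '' ((fun g : Geod (k + 1) => A • g) ⁻¹' B) :
        Set (SphereInf (k + 1) × SphereInf (k + 1))) ↔ (A • x, A • y) ∈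
        (Subtype.val '' B : Set (SphereInf (k + 1) × SphereInf (k + 1))) := by
      constructor
      · rintro ⟨g, hg, h⟩
        obtain ⟨rfl, rfl⟩ := Prod.ext_iff.1 h
        exact ⟨A • g, hg, rfl⟩
      · rintro ⟨g, hg, h⟩
        have hne : x ≠ y := fun e => g.2 (by rw [h, e])
        refine ⟨⟨(x, y), hne⟩, ?_, rfl⟩
        change A • (⟨(x, y), hne⟩ : Geod (k + 1)) ∈ B
        have : A • (⟨(x, y), hne⟩ : Geod (k + 1)) = g := Subtype.ext h.symm
        rwa [this]
    -- The density is a function of the Lorentz product of the endpoints, which scales by both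
    -- conformal factors; these cancel against the two sphere Jacobians.
    have hdens : liouvilleDensity x y =
        ENNReal.ofReal (l x ^ k) * (ENNReal.ofReal (l y ^ k) * liouvilleDensity (A • x) (A • y)) := by
      have h1 := hl0 x
      have h2 := hl0 y
      have h3 : lor (nullVec (A • x)) (nullVec (A • y)) =
          l x * l y * lor (nullVec x) (nullVec y) := by
        rw [A.nullVec_smul, A.nullVec_smul, lor_smul_left, lor_smul_right, A.lor_map, mul_assoc]
      rw [liouvilleDensity_eq, liouvilleDensity_eq, h3, ← ENNReal.ofReal_mul (by positivity),
        ← ENNReal.ofReal_mul (by positivity)]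
      congr 1
      have h4 : -2 * (l x * l y * lor (nullVec x) (nullVec y)) =
          (l x * l y) * (-2 * lor (nullVec x) (nullVec y)) := by ring
      rw [h4, mul_pow (l x * l y), mul_pow (l x), ← div_div, mul_div_assoc', mul_div_assoc']
      congr 1
      field_simp
    rw [hD]
    by_cases h : (A • x, A • y) ∈ (Subtype.val '' B : Set (SphereInf (k + 1) × SphereInf (k + 1)))
    · rw [indicator_of_mem (hmem.2 h)]
      simp only
      rw [indicator_of_mem h, hdens]
      simp only [Pi.one_apply, mul_one]
    · rw [indicator_of_notMem (fun h' => h (hmem.1 h'))]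
      simp only
      rw [indicator_of_notMem h]
      simp only [mul_zero]
  simp_rw [key]
  have hJ := hasSphereJacobian A
  have h1 (x : SphereInf (k + 1)) :
      ∫⁻ y, ENNReal.ofReal (l x ^ k) * (ENNReal.ofReal (l y ^ k) * D (A • x, A • y))
        ∂sphereMeasure (k + 1) =
      ENNReal.ofReal (l x ^ k) * ∫⁻ y, D (A • x, y) ∂sphereMeasure (k + 1) := by
    have hDx : Measurable fun y => D (A • x, y) := hDm.comp measurable_prodMk_left
    have hm : Measurable fun y => ENNReal.ofReal (l y ^ k) * D (A • x, A • y) :=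
      (measurable_conformal_factor A).mul (hDx.comp (HypManifold.measurable_smul A))
    rw [lintegral_const_mul _ hm]
    exact congrArg _ (hJ _ hDx)
  simp_rw [h1]
  exact hJ (fun x => ∫⁻ y, D (x, y) ∂sphereMeasure (k + 1)) hDm.lintegral_prod_right'

end Invariance

end

end HypGeom

namespace HypGeom

noncomputable section

/-! ### Hemispheres -/

/-- A linear isometric embedding of codimension one and a unit vector normal to its image. -/
structure Frame (k : ℕ) where
  toIsometry : EuclideanSpace ℝ (Fin k) →ₗᵢ[ℝ] EuclideanSpace ℝ (Fin (k + 1))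
  e : EuclideanSpace ℝ (Fin (k + 1))
  norm_e : ‖e‖ = 1
  inner_eq_zero : ∀ x, inner ℝ e (toIsometry x) = 0

namespace Frame

variable {k : ℕ} (F : Frame k)

/-- The frame with the opposite normal. -/
def neg : Frame k where
  toIsometry := F.toIsometry
  e := -F.e
  norm_e := by rw [norm_neg, F.norm_e]
  inner_eq_zero x := by rw [inner_neg_left, F.inner_eq_zero, neg_zero]

theorem neg_neg : F.neg.neg = F := by
  cases F; simp [neg]

/-- Orthogonal coordinates. -/
def coord : WithLp 2 (EuclideanSpace ℝ (Fin k) × ℝ) ≃ₗᵢ[ℝ] EuclideanSpace ℝ (Fin (k + 1)) :=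
  LinearIsometry.toLinearIsometryEquiv
    { toFun := fun z => F.toIsometry z.fst + z.snd • F.e
      map_add' := fun z z' => by
        simp only [WithLp.add_fst, WithLp.add_snd, map_add]; module
      map_smul' := fun r z => by
        simp only [WithLp.smul_fst, WithLp.smul_snd, map_smul, RingHom.id_apply]; module
      norm_map' := fun z => by
        refine (pow_left_inj₀ (norm_nonneg _) (norm_nonneg _) two_ne_zero).1 ?_
        rw [WithLp.prod_norm_sq_eq_of_L2]
        change ‖F.toIsometry z.fst + z.snd • F.e‖ ^ 2 = _
        rw [norm_add_sq_real, inner_smul_right, real_inner_comm, F.inner_eq_zero, norm_smul,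
          F.norm_e, F.toIsometry.norm_map]
        ring }
    (by
      rw [(WithLp.linearEquiv 2 ℝ (EuclideanSpace ℝ (Fin k) × ℝ)).finrank_eq]
      simp)

theorem coord_apply (z : WithLp 2 (EuclideanSpace ℝ (Fin k) × ℝ)) :
    F.coord z = F.toIsometry z.fst + z.snd • F.e := rfl

theorem measurePreserving_coord :
    MeasurePreserving fun z : EuclideanSpace ℝ (Fin k) × ℝ => F.toIsometry z.1 + z.2 • F.e :=
  (LinearIsometryEquiv.measurePreserving F.coord).comp
    (WithLp.volume_preserving_toLp (EuclideanSpace ℝ (Fin k)) ℝ)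

theorem norm_sq_eq (x : EuclideanSpace ℝ (Fin k)) (t : ℝ) :
    ‖F.toIsometry x + t • F.e‖ ^ 2 = ‖x‖ ^ 2 + t ^ 2 := by
  rw [norm_add_sq_real, inner_smul_right, real_inner_comm, F.inner_eq_zero, norm_smul,
    F.norm_e, F.toIsometry.norm_map, Real.norm_eq_abs, mul_one, sq_abs]
  ring

theorem norm_toIsometry_add_e (x : EuclideanSpace ℝ (Fin k)) :
    ‖F.toIsometry x + F.e‖ = Real.sqrt (1 + ‖x‖ ^ 2) := by
  have := F.norm_sq_eq x 1
  rw [one_smul] at this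
  rw [eq_comm, Real.sqrt_eq_iff_eq_sq (by positivity) (norm_nonneg _), this]
  ring

/-- The central projection from the tangent plane to the hemisphere. -/
def point (x : EuclideanSpace ℝ (Fin k)) : SphereInf (k + 1) :=
  ⟨(Real.sqrt (1 + ‖x‖ ^ 2))⁻¹ • (F.toIsometry x + F.e), by
    have h := Real.sqrt_pos.2 (one_add_norm_sq_pos x)
    rw [mem_sphere_zero_iff_norm, norm_smul, norm_toIsometry_add_e, norm_inv,
      Real.norm_of_nonneg h.le, inv_mul_cancel₀ h.ne']⟩

theorem measurable_point : Measurable F.point := by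
  have h : Continuous fun x => F.toIsometry x := F.toIsometry.continuous
  refine Measurable.subtype_mk ?_
  fun_prop

theorem inner_e_coord (x : EuclideanSpace ℝ (Fin k)) (t : ℝ) :
    inner ℝ F.e (F.toIsometry x + t • F.e) = t := by
  rw [inner_add_right, F.inner_eq_zero, inner_smul_right, real_inner_self_eq_norm_sq, F.norm_e]
  ring

theorem lintegral_smul_scale {t : ℝ} (ht : 0 < t) {g : EuclideanSpace ℝ (Fin k) → ENNReal}
    (hg : Measurable g) : ∫⁻ y, g y = ENNReal.ofReal (t ^ k) * ∫⁻ x, g (t • x) := by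
  have h := Measure.map_addHaar_smul (volume : Measure (EuclideanSpace ℝ (Fin k))) ht.ne'
  have h1 : ∫⁻ x, g (t • x) = ENNReal.ofReal |(t ^ k)⁻¹| * ∫⁻ y, g y := by
    rw [← lintegral_map hg (measurable_const_smul t), h, lintegral_smul_measure,
      finrank_euclideanSpace_fin, smul_eq_mul]
  rw [h1, ← mul_assoc, ← ENNReal.ofReal_mul (by positivity), abs_of_pos (by positivity),
    mul_inv_cancel₀ (by positivity), ENNReal.ofReal_one, one_mul]

/-- The half ball under the hemisphere is sliced at height `t` and each slice is rescaled to the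
tangent plane at `F.e`. In the central projection the remaining integral over `t` is radial, and its
cutoff depends only on `‖x‖`. -/
theorem lintegral_hemisphere_euclidean {f : SphereInf (k + 1) → ENNReal} (hf : Measurable f) :
    ∫⁻ ω, (if 0 < inner ℝ F.e ω.1 then f ω else 0) ∂sphereMeasure (k + 1) =
      ∫⁻ x, ENNReal.ofReal ((Real.sqrt (1 + ‖x‖ ^ 2))⁻¹ ^ (k + 1)) * f (F.point x) := by
  obtain ⟨G, hG, hGf⟩ := exists_measurable_extension hf
  set G' : EuclideanSpace ℝ (Fin (k + 1)) → ENNReal :=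
    fun x => if 0 < inner ℝ F.e x then G x else 0 with hG'
  have hG'm : Measurable G' :=
    Measurable.ite (measurableSet_lt measurable_const (by fun_prop)) hG measurable_const
  refine (ENNReal.mul_right_inj (ofReal_one_div_ne_zero k) ENNReal.ofReal_ne_top).1 ?_
  have e0 : ∫⁻ ω, (if 0 < inner ℝ F.e ω.1 then f ω else 0) ∂sphereMeasure (k + 1) =
      ∫⁻ ω, G' ω.1 ∂sphereMeasure (k + 1) := by
    refine lintegral_congr fun ω => ?_
    simp only [hG', hGf]
  have hgm : Measurable fun x : EuclideanSpace ℝ (Fin (k + 1)) =>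
      G' (‖x‖⁻¹ • x) * (if ‖x‖ < 1 then 1 else 0) := by
    refine (hG'm.comp (by fun_prop)).mul ?_
    exact Measurable.ite (measurableSet_lt measurable_norm measurable_const) measurable_const
      measurable_const
  have hpm := F.measurable_point
  rw [e0, ← lintegral_cone hG'm, ← F.measurePreserving_coord.lintegral_comp hgm]
  set g : EuclideanSpace ℝ (Fin k) × ℝ → ENNReal := fun z =>
    G' (‖F.toIsometry z.1 + z.2 • F.e‖⁻¹ • (F.toIsometry z.1 + z.2 • F.e)) *
      (if ‖F.toIsometry z.1 + z.2 • F.e‖ < 1 then 1 else 0) with hg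
  have hgm' : Measurable g := hgm.comp F.measurePreserving_coord.measurable
  change ∫⁻ z, g z ∂(volume.prod volume) = _
  rw [lintegral_prod_symm' _ hgm']
  have e1 (x : EuclideanSpace ℝ (Fin k)) (t : ℝ) : inner ℝ F.e
      (‖F.toIsometry x + t • F.e‖⁻¹ • (F.toIsometry x + t • F.e)) =
      ‖F.toIsometry x + t • F.e‖⁻¹ * t := by
    rw [inner_smul_right, F.inner_e_coord]
  have e2 (t : ℝ) (ht : t ∉ Ioi (0 : ℝ)) : ∫⁻ x, g (x, t) = 0 := by
    have ht' : t ≤ 0 := not_lt.1 ht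
    rw [← lintegral_zero]
    refine lintegral_congr fun x => ?_
    simp only [hg, hG', e1]
    rw [if_neg (not_lt.2 (mul_nonpos_of_nonneg_of_nonpos (by positivity) ht')), zero_mul]
  have e3 (t : ℝ) (ht : t ∈ Ioi (0 : ℝ)) : ∫⁻ x, g (x, t) =
      ∫⁻ x, ENNReal.ofReal (t ^ k) * (if t * Real.sqrt (1 + ‖x‖ ^ 2) < 1 then 1 else 0) *
        f (F.point x) := by
    have ht0 : 0 < t := ht
    have hgt : Measurable fun x => g (x, t) := hgm'.comp measurable_prodMk_right
    have hgt' : Measurable fun x => g (t • x, t) := hgt.comp (measurable_const_smul t)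
    rw [lintegral_smul_scale ht0 hgt, ← lintegral_const_mul _ hgt']
    refine lintegral_congr fun x => ?_
    have hs := Real.sqrt_pos.2 (one_add_norm_sq_pos x)
    have h1 : F.toIsometry (t • x) + t • F.e = t • (F.toIsometry x + F.e) := by
      rw [map_smul, smul_add]
    have h2 : ‖t • (F.toIsometry x + F.e)‖ = t * Real.sqrt (1 + ‖x‖ ^ 2) := by
      rw [norm_smul, F.norm_toIsometry_add_e, Real.norm_of_nonneg ht0.le]
    have h3 : (t * Real.sqrt (1 + ‖x‖ ^ 2))⁻¹ • t • (F.toIsometry x + F.e) = (F.point x).1 := by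
      rw [smul_smul, mul_inv, mul_right_comm, inv_mul_cancel₀ ht0.ne', one_mul]
      rfl
    have h4 : 0 < inner ℝ F.e (F.point x).1 := by
      have := F.inner_e_coord x 1
      rw [one_smul] at this
      change 0 < inner ℝ F.e (_ • (F.toIsometry x + F.e))
      rw [inner_smul_right, this]
      positivity
    simp only [hg, hG', h1, h2, h3, if_pos h4, hGf, mul_assoc]
    rw [mul_comm (f _)]
  have hind : (fun t => ∫⁻ x, g (x, t)) = (Ioi (0 : ℝ)).indicator fun t => ∫⁻ x,
      ENNReal.ofReal (t ^ k) * (if t * Real.sqrt (1 + ‖x‖ ^ 2) < 1 then 1 else 0) *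
        f (F.point x) := by
    funext t
    by_cases ht : t ∈ Ioi (0 : ℝ)
    · rw [indicator_of_mem ht, e3 t ht]
    · rw [indicator_of_notMem ht, e2 t ht]
  have hm1 : Measurable fun z : ℝ × EuclideanSpace ℝ (Fin k) => ENNReal.ofReal (z.1 ^ k) *
      (if z.1 * Real.sqrt (1 + ‖z.2‖ ^ 2) < 1 then (1 : ENNReal) else 0) := by
    refine Measurable.mul (by fun_prop) (Measurable.ite ?_ measurable_const measurable_const)
    exact measurableSet_lt (by fun_prop) measurable_const
  rw [hind, lintegral_indicator measurableSet_Ioi, lintegral_lintegral_swap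
    (hm1.mul (hf.comp (hpm.comp measurable_snd))).aemeasurable,
    ← lintegral_const_mul _ (by fun_prop)]
  refine lintegral_congr fun x => ?_
  have hm2 : Measurable fun t : ℝ => ENNReal.ofReal (t ^ k) *
      (if t * Real.sqrt (1 + ‖x‖ ^ 2) < 1 then (1 : ENNReal) else 0) :=
    hm1.comp measurable_prodMk_right
  have hs := Real.sqrt_pos.2 (one_add_norm_sq_pos x)
  rw [lintegral_mul_const _ hm2, lintegral_radial k hs, ← mul_assoc,
    ← ENNReal.ofReal_mul (by positivity), one_div_mul_eq_div]

/-- The integral over a hemisphere as an integral over hyperbolic space. -/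
theorem lintegral_hemisphere {f : SphereInf (k + 1) → ENNReal} (hf : Measurable f) :
    ∫⁻ ω, (if 0 < inner ℝ F.e ω.1 then f ω else 0) ∂sphereMeasure (k + 1) =
      ∫⁻ p, ENNReal.ofReal (p.2⁻¹ ^ k) * f (F.point p.1) ∂hypVolume k := by
  have hpm := F.measurable_point
  rw [F.lintegral_hemisphere_euclidean hf, lintegral_hypVolume (by fun_prop)]
  refine lintegral_congr fun x => ?_
  change _ = _ * (ENNReal.ofReal ((Real.sqrt (1 + ‖x‖ ^ 2))⁻¹ ^ k) * f (F.point x))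
  -- One of the `k + 1` powers is the density of the hyperbolic volume.
  rw [← mul_assoc, ← ENNReal.ofReal_mul (by positivity), pow_succ']
  congr 3
  rw [one_div]

/-! ### Geodesics in terms of the projections of their endpoints to a hyperplane. -/

/-- The embedding of Minkowski spaces given by a frame. -/
def emb : Mink k →ₗ[ℝ] Mink (k + 1) where
  toFun v := (F.toIsometry v.1, v.2)
  map_add' v w := by ext1 <;> simp
  map_smul' r v := by ext1 <;> simp

theorem emb_apply (v : Mink k) : F.emb v = (F.toIsometry v.1, v.2) := rfl

/-- The normal vector of a frame, as a vector in Minkowski space. -/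
def normal : Mink (k + 1) := (F.e, 0)

theorem lor_emb (v w : Mink k) : lor (F.emb v) (F.emb w) = lor v w := by
  simp only [lor, emb_apply, F.toIsometry.inner_map_map]

theorem lor_normal_emb (v : Mink k) : lor F.normal (F.emb v) = 0 := by
  simp [lor, normal, emb_apply, F.inner_eq_zero]

theorem lor_normal_normal : lor F.normal F.normal = 1 := by
  simp [lor, normal, F.norm_e]

theorem normal_neg : F.neg.normal = -F.normal := by
  simp [normal, neg]

theorem emb_neg : F.neg.emb = F.emb := rfl

theorem lor_normal_nullVec (ω : SphereInf (k + 1)) :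
    lor F.normal (nullVec ω) = inner ℝ F.e ω.1 := by
  simp [lor, normal, nullVec]

/-- Hence `F.point p.1` is the end at infinity of the ray that leaves the hyperplane perpendicularly
at `p`, in direction of the normal. -/
theorem nullVec_point {p : Mink k} (hp : p ∈ Hyp k) :
    nullVec (F.point p.1) = p.2⁻¹ • (F.emb p + F.normal) := by
  have h := congrArg Prod.snd (shellLift_fst hp)
  have h' : Real.sqrt (1 + ‖p.1‖ ^ 2) = p.2 := h
  ext1
  · change (Real.sqrt (1 + ‖p.1‖ ^ 2))⁻¹ • (F.toIsometry p.1 + F.e) = _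
    rw [h']
    rfl
  · simp [nullVec_snd, normal, emb_apply, hp.2.ne']

theorem exists_emb_eq {v : Mink (k + 1)} (hv : v ∈ Hyp (k + 1)) (h : lor F.normal v = 0) :
    ∃ p ∈ Hyp k, F.emb p = v := by
  obtain ⟨z, hz⟩ := F.coord.surjective v.1
  rw [coord_apply] at hz
  have h1 : lor F.normal v = inner ℝ F.e v.1 := by simp [lor, normal]
  rw [h1, ← hz, F.inner_e_coord] at h
  rw [h, zero_smul, add_zero] at hz
  have h2 : F.emb (z.fst, v.2) = v := Prod.ext hz rfl
  refine ⟨(z.fst, v.2), ⟨?_, hv.2⟩, h2⟩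
  rw [← F.lor_emb, h2, hv.1]

/-- The density of the Liouville measure in terms of the orthogonal projections of the endpoints to
a hyperplane. -/
def _root_.HypGeom.kernel (p q : Mink k) : ENNReal := ENNReal.ofReal (2 / (2 * (1 - lor p q)) ^ k)

theorem _root_.HypGeom.measurable_kernel : Measurable fun z : Mink k × Mink k => kernel z.1 z.2 := by
  have h : Measurable fun z : Mink k × Mink k => lor z.1 z.2 := continuous_lor.measurable
  unfold kernel
  fun_prop

/-- With opposite normals the product of `F.emb p + F.normal` and `F.emb q - F.normal` is `lor p q -
1`, and the normalising factors cancel against the hemisphere Jacobians. -/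
theorem kernel_eq {p q : Mink k} (hp : p ∈ Hyp k) (hq : q ∈ Hyp k) :
    ENNReal.ofReal (p.2⁻¹ ^ k) * (ENNReal.ofReal (q.2⁻¹ ^ k) *
      liouvilleDensity (F.point p.1) (F.neg.point q.1)) = kernel p q := by
  have h1 := hp.2
  have h2 := hq.2
  have h3 : lor (F.emb p + F.normal) (F.neg.emb q + F.neg.normal) = lor p q - 1 := by
    rw [emb_neg, normal_neg, lor_add_left, lor_add_right, lor_add_right, lor_neg_right,
      lor_neg_right, F.lor_emb, F.lor_normal_emb, lor_comm (F.emb p), F.lor_normal_emb, F.lor_normal_normal]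
    ring
  rw [liouvilleDensity_eq, F.nullVec_point hp, F.neg.nullVec_point hq, lor_smul_left,
    lor_smul_right, h3, ← ENNReal.ofReal_mul (by positivity), ← ENNReal.ofReal_mul (by positivity),
    kernel]
  congr 1
  have h4 : -2 * (p.2⁻¹ * (q.2⁻¹ * (lor p q - 1))) =
      p.2⁻¹ * q.2⁻¹ * (2 * (1 - lor p q)) := by ring
  rw [h4, mul_pow (p.2⁻¹ * q.2⁻¹), mul_pow p.2⁻¹, ← div_div, mul_div_assoc', mul_div_assoc']
  congr 1
  field_simp

/-- The Liouville measure of a set of geodesics that start in one hemisphere and end in the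
opposite one. -/
theorem liouville_eq {B : Set (Geod (k + 1))} (hB : MeasurableSet B)
    (h1 : ∀ g ∈ B, 0 < inner ℝ F.e g.1.1.1) (h2 : ∀ g ∈ B, 0 < inner ℝ F.neg.e g.1.2.1) :
    liouville (k + 1) B = ∫⁻ p, (∫⁻ q, kernel p q *
      (Subtype.val '' B).indicator 1 (F.point p.1, F.neg.point q.1) ∂hypVolume k)
        ∂hypVolume k := by
  set D : SphereInf (k + 1) × SphereInf (k + 1) → ENNReal := fun z =>
    liouvilleDensity z.1 z.2 * (Subtype.val '' B).indicator 1 z with hD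
  have hDm : Measurable D :=
    measurable_liouvilleDensity.mul (measurable_one.indicator (measurableSet_image_val hB))
  have e1 (x y : SphereInf (k + 1)) : D (x, y) =
      if 0 < inner ℝ F.neg.e y.1 then (if 0 < inner ℝ F.e x.1 then D (x, y) else 0) else 0 := by
    by_cases h : (x, y) ∈ (Subtype.val '' B : Set (SphereInf (k + 1) × SphereInf (k + 1)))
    · obtain ⟨g, hg, hgxy⟩ := h
      obtain ⟨rfl, rfl⟩ := Prod.ext_iff.1 hgxy
      rw [if_pos (h2 g hg), if_pos (h1 g hg)]
    · have : D (x, y) = 0 := by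
        simp only [hD]
        rw [indicator_of_notMem h, mul_zero]
      simp [this]
  have hpm := F.measurable_point
  have hpm' := F.neg.measurable_point
  have e2 (x : SphereInf (k + 1)) : ∫⁻ y, D (x, y) ∂sphereMeasure (k + 1) =
      if 0 < inner ℝ F.e x.1 then
        ∫⁻ q, ENNReal.ofReal (q.2⁻¹ ^ k) * D (x, F.neg.point q.1) ∂hypVolume k else 0 := by
    have hx : Measurable fun y => (if 0 < inner ℝ F.e x.1 then D (x, y) else 0) := by
      split_ifs
      · exact hDm.comp measurable_prodMk_left
      · exact measurable_const
    rw [lintegral_congr (e1 x), F.neg.lintegral_hemisphere hx]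
    split_ifs <;> simp
  have hm : Measurable fun z : SphereInf (k + 1) × Mink k =>
      ENNReal.ofReal (z.2.2⁻¹ ^ k) * D (z.1, F.neg.point z.2.1) := by fun_prop
  rw [liouville_apply hB]
  change ∫⁻ x, (∫⁻ y, D (x, y) ∂sphereMeasure (k + 1)) ∂sphereMeasure (k + 1) = _
  rw [lintegral_congr e2, F.lintegral_hemisphere hm.lintegral_prod_right']
  refine lintegral_congr_ae ?_
  filter_upwards [ae_mem_Hyp] with p hp
  have hmp : Measurable fun q : Mink k =>
      ENNReal.ofReal (q.2⁻¹ ^ k) * D (F.point p.1, F.neg.point q.1) :=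
    hm.comp measurable_prodMk_left
  rw [← lintegral_const_mul _ hmp]
  refine lintegral_congr_ae ?_
  filter_upwards [ae_mem_Hyp] with q hq
  simp only [hD]
  rw [← F.kernel_eq hp hq]
  ring

end Frame

end

end HypGeom

namespace HypGeom

noncomputable section

/-! ### Midpoints -/

section Midpoint

variable {k : ℕ}

theorem measurable_lor_left (m : Mink k) : Measurable fun q => lor m q :=
  (continuous_const.lor continuous_id).measurable

theorem measurable_nrm : Measurable (nrm : Mink k → Mink k) := by
  have h : Measurable fun v : Mink k => lor v v := (continuous_id.lor continuous_id).measurable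
  unfold nrm
  fun_prop

theorem lintegral_lor {f : ℝ → ENNReal} (hf : Measurable f) {m : Mink k} (hm : m ∈ Hyp k) :
    ∫⁻ q, f (-lor m q) ∂hypVolume k = ∫⁻ q, f q.2 ∂hypVolume k := by
  obtain ⟨A, hA, -, hAA, hint⟩ := exists_swap hm
  rw [← hint (fun q => f (-lor m q)) (hf.comp (measurable_lor_left m).neg)]
  refine lintegral_congr fun q => ?_
  rw [← A.lor_map, hAA, hA, lor_comm, lor_origin, _root_.neg_neg]

/-- Doubling of the distance from the origin, in the space coordinate. -/
def double (y : EuclideanSpace ℝ (Fin k)) : EuclideanSpace ℝ (Fin k) :=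
  (2 * Real.sqrt (1 + ‖y‖ ^ 2)) • y

theorem sqrt_double (y : EuclideanSpace ℝ (Fin k)) :
    Real.sqrt (1 + ‖double y‖ ^ 2) = 2 * Real.sqrt (1 + ‖y‖ ^ 2) ^ 2 - 1 := by
  have hs := Real.sq_sqrt (one_add_norm_sq_pos y).le
  have h0 := one_add_norm_sq_pos y
  rw [Real.sqrt_eq_iff_eq_sq (one_add_norm_sq_pos _).le (by rw [hs]; nlinarith [sq_nonneg ‖y‖]),
    double, norm_smul, mul_pow, Real.norm_eq_abs, sq_abs, mul_pow, hs]
  ring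

/-- The midpoint of the origin and the doubled point is the original point, by `cosh (2 d) = 2 *
cosh d ^ 2 - 1` for the time coordinates. -/
theorem shellLift_double (y : EuclideanSpace ℝ (Fin k)) :
    shellLift 1 (double y) + origin k = (2 * Real.sqrt (1 + ‖y‖ ^ 2)) • shellLift 1 y := by
  ext1
  · simp [shellLift, origin, double]
  · change Real.sqrt (1 + ‖double y‖ ^ 2) + 1 = 2 * Real.sqrt (1 + ‖y‖ ^ 2) * Real.sqrt (1 + ‖y‖ ^ 2)
    rw [sqrt_double]
    ring

theorem nrm_shellLift_double (y : EuclideanSpace ℝ (Fin k)) :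
    nrm (shellLift 1 (double y) + origin k) = shellLift 1 y := by
  have := Real.sqrt_pos.2 (one_add_norm_sq_pos y)
  rw [shellLift_double, nrm_smul (by positivity), nrm_of_mem (shellLift_one_mem y)]

theorem double_surjective : Function.Surjective (double : EuclideanSpace ℝ (Fin k) → _) := by
  intro x
  have hp := shellLift_one_mem x
  set p := shellLift 1 x with hpdef
  have ht := timelike_of_mem hp (origin_mem (n := k)) zero_le_one zero_le_one (by norm_num)
  rw [one_smul, one_smul] at ht
  have hm := nrm_mem ht.1 ht.2
  obtain ⟨r, hr, h⟩ := nrm_eq_smul ht.1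
  refine ⟨(nrm (p + origin k)).1, ?_⟩
  have h1 : Real.sqrt (1 + ‖(nrm (p + origin k)).1‖ ^ 2) = (nrm (p + origin k)).2 :=
    congrArg Prod.snd (shellLift_fst hm)
  have h2 : 2 * r ^ 2 * (p.2 + 1) = 1 := by
    have := hm.1
    rw [h, lor_smul_left, lor_smul_right, lor_add_left, lor_add_right, lor_add_right, hp.1,
      origin_mem.1, lor_comm (origin k), lor_origin] at this
    linarith
  have h3 : (p + origin k).2 = p.2 + 1 := rfl
  have h4 : (p + origin k).1 = x := by simp [hpdef, shellLift, origin]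
  rw [double, h1, h, Prod.smul_fst, Prod.smul_snd, h3, h4, smul_smul, smul_eq_mul]
  have h5 : 2 * (r * (p.2 + 1)) * r = 2 * r ^ 2 * (p.2 + 1) := by ring
  rw [h5, h2, one_smul]

/-- The derivative of `double`. -/
def doubleDeriv (y : EuclideanSpace ℝ (Fin k)) :
    EuclideanSpace ℝ (Fin k) →L[ℝ] EuclideanSpace ℝ (Fin k) :=
  (2 * Real.sqrt (1 + ‖y‖ ^ 2)) • ContinuousLinearMap.id ℝ _ +
    (2 • (1 / Real.sqrt (1 + ‖y‖ ^ 2)) • innerSL ℝ y).smulRight y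

theorem hasFDerivAt_double (y : EuclideanSpace ℝ (Fin k)) :
    HasFDerivAt double (doubleDeriv y) y := by
  have h := ((hasFDerivAt_sqrt_add_norm_sq (one_add_norm_sq_pos y)).const_mul 2).smul
    (hasFDerivAt_id y)
  convert! h using 1
  rw [doubleDeriv, ← Nat.cast_smul_eq_nsmul ℝ]
  rfl

/-- The derivative is a scalar times a transvection. Only its dependence on `‖y‖` alone matters
later. -/
theorem det_doubleDeriv (y : EuclideanSpace ℝ (Fin k)) :
    (doubleDeriv y).det = (2 * Real.sqrt (1 + ‖y‖ ^ 2)) ^ k *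
      (2 - 1 / Real.sqrt (1 + ‖y‖ ^ 2) ^ 2) := by
  have hs := Real.sqrt_pos.2 (one_add_norm_sq_pos y)
  have hs2 := Real.sq_sqrt (one_add_norm_sq_pos y).le
  set s := Real.sqrt (1 + ‖y‖ ^ 2) with hsdef
  set f : EuclideanSpace ℝ (Fin k) →L[ℝ] ℝ := (1 / s ^ 2) • innerSL ℝ y with hf
  have h1 : ((doubleDeriv y : EuclideanSpace ℝ (Fin k) →L[ℝ] _) :
      EuclideanSpace ℝ (Fin k) →ₗ[ℝ] _) =
      (2 * s) • LinearMap.transvection f.toLinearMap y := by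
    apply LinearMap.ext
    intro x
    change (2 * s) • x + (2 • (1 / s * inner ℝ y x)) • y =
      (2 * s) • (x + (1 / s ^ 2 * inner ℝ y x) • y)
    rw [smul_add, smul_smul, nsmul_eq_mul]
    congr 2
    push_cast
    field_simp
  change LinearMap.det ((doubleDeriv y : EuclideanSpace ℝ (Fin k) →L[ℝ] _) :
      EuclideanSpace ℝ (Fin k) →ₗ[ℝ] _) = _
  rw [h1, LinearMap.det_smul, finrank_euclideanSpace_fin, LinearMap.transvection.det]
  congr 1
  change 1 + 1 / s ^ 2 * inner ℝ y y = _
  rw [real_inner_self_eq_norm_sq]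
  have : ‖y‖ ^ 2 = s ^ 2 - 1 := by rw [hs2]; ring
  rw [this]
  field_simp
  ring

/-- For a density that depends on the distance from the origin, the midpoint with the origin has
again such a density. -/
theorem exists_lintegral_midpoint_origin {c : ℝ → ENNReal} (hc : Measurable c) :
    ∃ G : ℝ → ENNReal, Measurable G ∧ ∀ h : Mink k → ENNReal, Measurable h →
      ∫⁻ p, c p.2 * h (nrm (p + origin k)) ∂hypVolume k = ∫⁻ m, G m.2 * h m ∂hypVolume k := by
  refine ⟨fun s => c (2 * s ^ 2 - 1) *
    ENNReal.ofReal (s / (2 * s ^ 2 - 1) * |(2 * s) ^ k * (2 - 1 / s ^ 2)|),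
    (hc.comp (by fun_prop)).mul (by fun_prop), fun h hh => ?_⟩
  have hm : Measurable fun p : Mink k => c p.2 * h (nrm (p + origin k)) := by
    have := measurable_nrm.comp (measurable_id.add_const (origin k))
    exact (hc.comp measurable_snd).mul (hh.comp this)
  rw [lintegral_hypVolume hm, lintegral_hypVolume ((by fun_prop : Measurable fun m : Mink k =>
    c (2 * m.2 ^ 2 - 1) * ENNReal.ofReal
      (m.2 / (2 * m.2 ^ 2 - 1) * |(2 * m.2) ^ k * (2 - 1 / m.2 ^ 2)|) * h m))]
  have hinj : InjOn (double : EuclideanSpace ℝ (Fin k) → _) univ := fun x _ y _ hxy => by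
    have := nrm_shellLift_double x
    rw [hxy, nrm_shellLift_double] at this
    exact (congrArg Prod.fst this).symm
  have key := lintegral_image_eq_lintegral_abs_det_fderiv_mul volume MeasurableSet.univ
    (fun x _ => (hasFDerivAt_double x).hasFDerivWithinAt) hinj
    (fun x => ENNReal.ofReal (1 / Real.sqrt (1 + ‖x‖ ^ 2)) *
      (c (shellLift 1 x).2 * h (nrm (shellLift 1 x + origin k))))
  rw [image_univ, double_surjective.range_eq, setLIntegral_univ, setLIntegral_univ] at key
  rw [key]
  refine lintegral_congr fun y => ?_
  rw [nrm_shellLift_double, det_doubleDeriv]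
  change ENNReal.ofReal _ * (ENNReal.ofReal (1 / Real.sqrt (1 + ‖double y‖ ^ 2)) *
    (c (Real.sqrt (1 + ‖double y‖ ^ 2)) * _)) = _
  rw [sqrt_double]
  have hsnd : (shellLift 1 y).2 = Real.sqrt (1 + ‖y‖ ^ 2) := rfl
  rw [hsnd]
  have hs := Real.sqrt_pos.2 (one_add_norm_sq_pos y)
  have hs1 : 0 < 2 * Real.sqrt (1 + ‖y‖ ^ 2) ^ 2 - 1 := by
    rw [Real.sq_sqrt (one_add_norm_sq_pos y).le]; nlinarith [sq_nonneg ‖y‖]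
  set s := Real.sqrt (1 + ‖y‖ ^ 2)
  set d := |(2 * s) ^ k * (2 - 1 / s ^ 2)|
  have e1 : ENNReal.ofReal (1 / s) * ENNReal.ofReal (s / (2 * s ^ 2 - 1) * d) =
      ENNReal.ofReal d * ENNReal.ofReal (1 / (2 * s ^ 2 - 1)) := by
    rw [← ENNReal.ofReal_mul (by positivity), ← ENNReal.ofReal_mul (by positivity)]
    congr 1
    field_simp
  calc _ = (ENNReal.ofReal d * ENNReal.ofReal (1 / (2 * s ^ 2 - 1))) *
        (c (2 * s ^ 2 - 1) * h (shellLift 1 y)) := by ring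
    _ = _ := by rw [← e1]; ring

/-! ### The endpoint kernel and the distribution of the midpoint. -/

/-- The total mass of the kernel. -/
def kernelMass (k : ℕ) : ENNReal := ∫⁻ p, kernel p (origin k) ∂hypVolume k

theorem kernel_origin (p : Mink k) :
    kernel p (origin k) = ENNReal.ofReal (2 / (2 * (1 + p.2)) ^ k) := by
  rw [kernel, lor_origin, sub_neg_eq_add]

theorem kernel_comm (p q : Mink k) : kernel p q = kernel q p := by
  rw [kernel, kernel, lor_comm]

theorem lintegral_kernel {q : Mink k} (hq : q ∈ Hyp k) :
    ∫⁻ p, kernel p q ∂hypVolume k = kernelMass k := by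
  have hm : Measurable fun s : ℝ => ENNReal.ofReal (2 / (2 * (1 + s)) ^ k) := by fun_prop
  simp only [kernelMass, kernel_origin]
  rw [← lintegral_lor hm hq]
  refine lintegral_congr fun p => ?_
  rw [kernel, lor_comm, sub_eq_add_neg]

/-- For fixed `q` the midpoint has a density `G` that depends only on its distance from `q`. After
exchanging the integrals, `G` is integrated over `q` around a fixed midpoint; by homogeneity the
result is its total mass, which is that of the kernel. The explicit form of `G` is never needed. -/
theorem lintegral_kernel_midpoint {U : Set (Mink k)} (hU : MeasurableSet U) :
    ∫⁻ p, (∫⁻ q, kernel p q * U.indicator 1 (nrm (p + q)) ∂hypVolume k) ∂hypVolume k =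
      kernelMass k * hypVolume k U := by
  have hc : Measurable fun s : ℝ => ENNReal.ofReal (2 / (2 * (1 + s)) ^ k) := by fun_prop
  obtain ⟨G, hG, hGh⟩ := exists_lintegral_midpoint_origin (k := k) hc
  have hGh' : ∀ h : Mink k → ENNReal, Measurable h →
      ∫⁻ p, kernel p (origin k) * h (nrm (p + origin k)) ∂hypVolume k =
        ∫⁻ m, G m.2 * h m ∂hypVolume k := by
    intro h hh
    simp only [kernel_origin]
    exact hGh h hh
  have hUi : Measurable (U.indicator 1 : Mink k → ENNReal) := measurable_one.indicator hU
  have hlor : Measurable fun z : Mink k × Mink k => lor z.1 z.2 := continuous_lor.measurable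
  have inner_eq (q : Mink k) (hq : q ∈ Hyp k) :
      ∫⁻ p, kernel p q * U.indicator 1 (nrm (p + q)) ∂hypVolume k =
        ∫⁻ m, G (-lor m q) * U.indicator 1 m ∂hypVolume k := by
    obtain ⟨A, hA, hA', hAA, hint⟩ := exists_swap hq
    have hAm : Measurable A.1 := A.continuous.measurable
    have hm1 : Measurable fun p => kernel p q * U.indicator 1 (nrm (p + q)) :=
      (measurable_kernel.comp measurable_prodMk_right).mul
        (hUi.comp (measurable_nrm.comp (measurable_id.add_const q)))
    have hm2 : Measurable fun m => G (-lor m q) * U.indicator 1 m :=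
      (hG.comp (hlor.comp measurable_prodMk_right).neg).mul hUi
    rw [← hint _ hm1, ← hint _ hm2]
    have e1 (p : Mink k) : kernel (A.1 p) q * U.indicator 1 (nrm (A.1 p + q)) =
        kernel p (origin k) * U.indicator 1 (A.1 (nrm (p + origin k))) := by
      have h1 : A.1 p + q = A.1 (p + origin k) := by rw [map_add, hA']
      rw [h1, A.nrm_map, kernel, kernel]
      nth_rewrite 1 [← hA']
      rw [A.lor_map]
    have e2 (m : Mink k) : G (-lor (A.1 m) q) = G m.2 := by
      rw [← hA', A.lor_map, lor_origin, _root_.neg_neg]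
    simp only [e1, e2]
    exact hGh' (fun v => U.indicator 1 (A.1 v)) (hUi.comp hAm)
  have hmk : Measurable fun z : Mink k × Mink k =>
      kernel z.1 z.2 * U.indicator 1 (nrm (z.1 + z.2)) :=
    measurable_kernel.mul (hUi.comp (measurable_nrm.comp (measurable_fst.add measurable_snd)))
  have hmG : Measurable fun z : Mink k × Mink k => G (-lor z.2 z.1) * U.indicator 1 z.2 :=
    (hG.comp (hlor.comp measurable_swap).neg).mul (hUi.comp measurable_snd)
  have hmass : ∫⁻ m, G m.2 ∂hypVolume k = kernelMass k := by
    -- The constant test function compares the masses of `G` and of the kernel.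
    have := hGh' 1 measurable_one
    simp only [Pi.one_apply, mul_one] at this
    exact this.symm
  rw [lintegral_lintegral_swap hmk.aemeasurable]
  calc ∫⁻ q, (∫⁻ p, kernel p q * U.indicator 1 (nrm (p + q)) ∂hypVolume k) ∂hypVolume k
      = ∫⁻ q, (∫⁻ m, G (-lor m q) * U.indicator 1 m ∂hypVolume k) ∂hypVolume k := by
        refine lintegral_congr_ae ?_
        filter_upwards [ae_mem_Hyp] with q hq using inner_eq q hq
    _ = ∫⁻ m, (∫⁻ q, G (-lor m q) * U.indicator 1 m ∂hypVolume k) ∂hypVolume k :=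
        lintegral_lintegral_swap hmG.aemeasurable
    _ = ∫⁻ m, kernelMass k * U.indicator 1 m ∂hypVolume k := by
        refine lintegral_congr_ae ?_
        filter_upwards [ae_mem_Hyp] with m hm
        have hm1 : Measurable fun q => G (-lor m q) := hG.comp (measurable_lor_left m).neg
        rw [lintegral_mul_const _ hm1, lintegral_lor hG hm, hmass]
    _ = kernelMass k * hypVolume k U := by
        rw [lintegral_const_mul _ hUi, lintegral_indicator_one hU]

theorem measurable_kernel_origin : Measurable fun p : Mink k => kernel p (origin k) := by
  simp only [kernel_origin]
  fun_prop

theorem kernelMass_ne_zero : kernelMass k ≠ 0 := by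
  intro h
  have hm : Measurable fun x : EuclideanSpace ℝ (Fin k) =>
      ENNReal.ofReal (1 / Real.sqrt (1 + ‖x‖ ^ 2)) * kernel (shellLift 1 x) (origin k) :=
    Measurable.mul (by fun_prop) (measurable_kernel_origin.comp (measurable_shellLift 1))
  rw [kernelMass, lintegral_hypVolume measurable_kernel_origin, lintegral_eq_zero_iff hm] at h
  obtain ⟨x, hx⟩ := h.exists
  have hs := Real.sqrt_pos.2 (one_add_norm_sq_pos x)
  have h2 : 0 < (shellLift 1 x).2 := hs
  have hx' : ENNReal.ofReal (1 / Real.sqrt (1 + ‖x‖ ^ 2)) *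
    kernel (shellLift 1 x) (origin k) = 0 := hx
  rw [kernel_origin] at hx'
  refine absurd hx' (mul_ne_zero ?_ ?_)
  · rw [ne_eq, ENNReal.ofReal_eq_zero, not_le]; positivity
  · rw [ne_eq, ENNReal.ofReal_eq_zero, not_le]; positivity

/-- In the space coordinate the kernel decays like the power `-k` and the volume density like the
power `-1`, which together is integrable in dimension `k`. -/
theorem kernelMass_ne_top : kernelMass k ≠ ⊤ := by
  rw [kernelMass, lintegral_hypVolume measurable_kernel_origin]
  have hfin := finite_integral_one_add_norm (E := EuclideanSpace ℝ (Fin k)) (μ := volume)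
    (r := (k + 1 : ℕ)) (by rw [finrank_euclideanSpace_fin]; exact_mod_cast Nat.lt_succ_self k)
  refine ne_top_of_le_ne_top (ENNReal.mul_ne_top (ENNReal.ofReal_ne_top (r := 4)) hfin.ne) ?_
  rw [← lintegral_const_mul _ (by fun_prop)]
  refine lintegral_mono fun x => ?_
  have hs := Real.sqrt_pos.2 (one_add_norm_sq_pos x)
  rw [kernel_origin]
  change ENNReal.ofReal (1 / Real.sqrt (1 + ‖x‖ ^ 2)) *
    ENNReal.ofReal (2 / (2 * (1 + Real.sqrt (1 + ‖x‖ ^ 2))) ^ k) ≤ _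
  rw [← ENNReal.ofReal_mul (by positivity), ← ENNReal.ofReal_mul (by norm_num)]
  refine ENNReal.ofReal_le_ofReal ?_
  have hr : 0 ≤ ‖x‖ := norm_nonneg x
  have hsr : ‖x‖ ≤ Real.sqrt (1 + ‖x‖ ^ 2) := Real.le_sqrt_of_sq_le (by linarith)
  have hs1 : 1 ≤ Real.sqrt (1 + ‖x‖ ^ 2) := Real.le_sqrt_of_sq_le (by nlinarith)
  set s := Real.sqrt (1 + ‖x‖ ^ 2)
  have e1 : 1 / s ≤ 2 / (1 + ‖x‖) := by
    rw [div_le_div_iff₀ hs (by positivity)]; linarith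
  have e2 : 2 / (2 * (1 + s)) ^ k ≤ 2 / (1 + ‖x‖) ^ k := by
    refine div_le_div_of_nonneg_left (by norm_num) (by positivity)
      (pow_le_pow_left₀ (by positivity) (by linarith) k)
  calc 1 / s * (2 / (2 * (1 + s)) ^ k) ≤ 2 / (1 + ‖x‖) * (2 / (1 + ‖x‖) ^ k) :=
        mul_le_mul e1 e2 (by positivity) (by positivity)
    _ = 4 * (1 + ‖x‖) ^ (-((k + 1 : ℕ) : ℝ)) := by
        rw [Real.rpow_neg (by positivity), Real.rpow_natCast, pow_succ]
        field_simp
        norm_num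

end Midpoint

end

end HypGeom

namespace HypGeom

noncomputable section

/-! ### Geodesics that cross a hyperplane -/

namespace Frame

variable {k : ℕ} (F : Frame k)

theorem emb_injective : Function.Injective F.emb := fun v w h => by
  have h2 : v.2 = w.2 := congrArg (fun z : Mink (k + 1) => z.2) h
  exact Prod.ext (F.toIsometry.injective (congrArg Prod.fst h)) h2

theorem nrm_emb (v : Mink k) : nrm (F.emb v) = F.emb (nrm v) := by
  rw [nrm, nrm, F.lor_emb, map_smul]

theorem measurableSet_emb_image {U : Set (Mink k)} (hU : MeasurableSet U) :
    MeasurableSet (F.emb '' U) :=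
  (LinearMap.isClosedEmbedding_of_injective
    (LinearMap.ker_eq_bot.2 F.emb_injective)).measurableEmbedding.measurableSet_image' hU

theorem lor_normal_nullVec_point {p : Mink k} (hp : p ∈ Hyp k) :
    lor F.normal (nullVec (F.point p.1)) = p.2⁻¹ := by
  rw [F.nullVec_point hp, lor_smul_right, lor_add_right, F.lor_normal_emb, F.lor_normal_normal]
  ring

theorem lor_normal_nullVec_neg_point {p : Mink k} (hp : p ∈ Hyp k) :
    lor F.normal (nullVec (F.neg.point p.1)) = -p.2⁻¹ := by
  have h := F.neg.lor_normal_nullVec_point hp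
  rw [normal_neg, lor_neg_left] at h
  linarith

theorem point_ne {p q : Mink k} (hp : p ∈ Hyp k) (hq : q ∈ Hyp k) :
    F.point p.1 ≠ F.neg.point q.1 := by
  intro h
  have h1 := F.lor_normal_nullVec_point hp
  rw [h, F.lor_normal_nullVec_neg_point hq] at h1
  have h2 := inv_pos.2 hp.2
  have h3 := inv_pos.2 hq.2
  linarith

/-- The point at which a geodesic meets the hyperplane of the frame, if it crosses it in the
negative direction. -/
def crossPoint (g : Geod (k + 1)) : Mink (k + 1) :=
  nrm ((-lor F.normal (nullVec g.1.2)) • nullVec g.1.1 +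
    lor F.normal (nullVec g.1.1) • nullVec g.1.2)

/-- The geodesics that cross the hyperplane of the frame in the negative direction, at a point of
the given set. -/
def crossSet (U : Set (Mink k)) : Set (Geod (k + 1)) :=
  {g | 0 < lor F.normal (nullVec g.1.1) ∧ lor F.normal (nullVec g.1.2) < 0 ∧
    F.crossPoint g ∈ F.emb '' U}

theorem eq_crossPoint {g : Geod (k + 1)} (h1 : 0 < lor F.normal (nullVec g.1.1))
    {v : Mink (k + 1)} (hv : v ∈ g.line) (h : lor F.normal v = 0) : v = F.crossPoint g := by
  obtain ⟨hvH, a, b, rfl⟩ := hv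
  obtain ⟨ha, hb⟩ := g.pos_of_mem hvH
  rw [lor_add_right, lor_smul_right, lor_smul_right] at h
  have h2 : b / lor F.normal (nullVec g.1.1) * -lor F.normal (nullVec g.1.2) = a := by
    rw [div_mul_eq_mul_div, div_eq_iff h1.ne']
    linarith
  rw [crossPoint, ← nrm_smul (div_pos hb h1), smul_add, smul_smul, smul_smul,
    div_mul_cancel₀ _ h1.ne', h2, nrm_of_mem hvH]

theorem crossPoint_mem {g : Geod (k + 1)} (h1 : 0 < lor F.normal (nullVec g.1.1))
    (h2 : lor F.normal (nullVec g.1.2) < 0) : F.crossPoint g ∈ g.line :=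
  g.nrm_mem_line (neg_pos.2 h2) h1

theorem crossSet_subset_transverseTo (U : Set (Mink k)) : F.crossSet U ⊆ transverseTo F.emb U := by
  rintro g ⟨h1, h2, h3⟩
  refine ⟨⟨_, F.crossPoint_mem h1 h2, h3⟩, fun h => ?_⟩
  have ha : 0 < 1 - lor F.normal (nullVec g.1.2) := by linarith
  obtain ⟨q, -, hq⟩ := h (g.nrm_mem_line ha h1)
  have h4 := F.lor_normal_emb q
  rw [hq, lor_nrm_eq_zero_iff (g.timelike ha h1).1, lor_add_right, lor_smul_right,
    lor_smul_right] at h4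
  linarith

/-- A geodesic that meets the hyperplane without lying in it has its endpoints strictly on opposite
sides; the two sets are the two directions of crossing. -/
theorem transverseTo_emb {U : Set (Mink k)} :
    transverseTo F.emb U = F.crossSet U ∪ F.neg.crossSet U := by
  refine Subset.antisymm ?_ (union_subset (F.crossSet_subset_transverseTo U)
    (F.neg.crossSet_subset_transverseTo U))
  rintro g ⟨⟨v, hv, hvU⟩, hg⟩
  have hv0 : lor F.normal v = 0 := by
    obtain ⟨p, -, rfl⟩ := hvU
    exact F.lor_normal_emb p
  rcases HypManifold.OrthoConfig.lor_nullVec_opposite hv hv0 with h | h | h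
  · refine absurd (fun z hz => ?_) hg
    obtain ⟨hzH, a, b, rfl⟩ := hz
    obtain ⟨p, hp, hp'⟩ := F.exists_emb_eq hzH (by
      rw [lor_add_right, lor_smul_right, lor_smul_right, h.1, h.2]; ring)
    exact ⟨p, hp, hp'⟩
  · have e1 : 0 < lor F.neg.normal (nullVec g.1.1) := by
      rw [normal_neg, lor_neg_left]; linarith [h.1]
    have e2 : lor F.neg.normal (nullVec g.1.2) < 0 := by
      rw [normal_neg, lor_neg_left]; linarith [h.2]
    refine .inr ⟨e1, e2, ?_⟩
    rwa [← F.neg.eq_crossPoint e1 hv (by rw [normal_neg, lor_neg_left, hv0, neg_zero])]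
  · refine .inl ⟨h.1, h.2, ?_⟩
    rwa [← F.eq_crossPoint h.1 hv hv0]

theorem measurable_lor_nullVec (n : ℕ) (u : Mink n) :
    Measurable fun x : SphereInf n => lor u (nullVec x) :=
  (continuous_const.lor (continuous_subtype_val.prodMk continuous_const)).measurable

theorem measurableSet_crossSet {U : Set (Mink k)} (hU : MeasurableSet U) :
    MeasurableSet (F.crossSet U) := by
  have h := measurable_lor_nullVec (k + 1) F.normal
  have h1 : Measurable fun g : Geod (k + 1) => lor F.normal (nullVec g.1.1) :=
    h.comp (measurable_fst.comp measurable_subtype_coe)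
  have h2 : Measurable fun g : Geod (k + 1) => lor F.normal (nullVec g.1.2) :=
    h.comp (measurable_snd.comp measurable_subtype_coe)
  have hN : Measurable fun x : SphereInf (k + 1) => nullVec x :=
    (continuous_subtype_val.prodMk continuous_const).measurable
  have h3 : Measurable F.crossPoint := by
    have hn : Measurable (nrm : Mink (k + 1) → _) := measurable_nrm
    unfold crossPoint
    fun_prop
  exact (measurableSet_lt measurable_const h1).inter
    ((measurableSet_lt h2 measurable_const).inter (h3 (F.measurableSet_emb_image hU)))

/-- In the combination that defines the crossing point the two normals cancel and a positive
multiple of `F.emb (p + q)` remains, so the crossing point is the midpoint of the projections. -/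
theorem mem_crossSet_iff {U : Set (Mink k)} {p q : Mink k} (hp : p ∈ Hyp k) (hq : q ∈ Hyp k) :
    (F.point p.1, F.neg.point q.1) ∈ (Subtype.val '' F.crossSet U) ↔ nrm (p + q) ∈ U := by
  have hp' := inv_pos.2 hp.2
  have hq' := inv_pos.2 hq.2
  set g : Geod (k + 1) := ⟨(F.point p.1, F.neg.point q.1), F.point_ne hp hq⟩ with hg
  have h1 : lor F.normal (nullVec g.1.1) = p.2⁻¹ := F.lor_normal_nullVec_point hp
  have h2 : lor F.normal (nullVec g.1.2) = -q.2⁻¹ := F.lor_normal_nullVec_neg_point hq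
  have h3 : F.crossPoint g = F.emb (nrm (p + q)) := by
    rw [crossPoint, h1, h2, _root_.neg_neg, ← F.nrm_emb, ← nrm_smul (v := F.emb (p + q)) (mul_pos hp' hq')]
    congr 1
    change q.2⁻¹ • nullVec (F.point p.1) + p.2⁻¹ • nullVec (F.neg.point q.1) = _
    rw [F.nullVec_point hp, F.neg.nullVec_point hq, emb_neg, normal_neg, map_add]
    module
  constructor
  · rintro ⟨g', ⟨-, -, h⟩, hg'⟩
    have : g' = g := Subtype.ext hg'
    rw [this, h3, F.emb_injective.mem_set_image] at h
    exact h
  · exact fun h => ⟨g, ⟨by rwa [h1], by rw [h2]; linarith, by rw [h3]; exact ⟨_, h, rfl⟩⟩, rfl⟩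

theorem inner_neg_e_pos {ω : SphereInf (k + 1)} (h : lor F.normal (nullVec ω) < 0) :
    0 < inner ℝ F.neg.e ω.1 := by
  rw [← lor_normal_nullVec, normal_neg, lor_neg_left]
  linarith

theorem liouville_crossSet {U : Set (Mink k)} (hU : MeasurableSet U) :
    liouville (k + 1) (F.crossSet U) = kernelMass k * hypVolume k U := by
  rw [F.liouville_eq (F.measurableSet_crossSet hU)
    (fun g hg => by rw [← lor_normal_nullVec]; exact hg.1) (fun g hg => F.inner_neg_e_pos hg.2.1),
    ← lintegral_kernel_midpoint hU]
  refine lintegral_congr_ae ?_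
  filter_upwards [ae_mem_Hyp] with p hp
  refine lintegral_congr_ae ?_
  filter_upwards [ae_mem_Hyp] with q hq
  congr 1
  by_cases h : nrm (p + q) ∈ U
  · rw [indicator_of_mem h, indicator_of_mem ((F.mem_crossSet_iff hp hq).2 h)]; rfl
  · rw [indicator_of_notMem h, indicator_of_notMem (mt (F.mem_crossSet_iff hp hq).1 h)]

theorem liouville_transverseTo_emb {U : Set (Mink k)} (hU : MeasurableSet U) :
    liouville (k + 1) (transverseTo F.emb U) = 2 * kernelMass k * hypVolume k U := by
  rw [F.transverseTo_emb, measure_union ?_ (F.neg.measurableSet_crossSet hU),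
    F.liouville_crossSet hU, F.neg.liouville_crossSet hU]
  · ring
  · refine disjoint_left.2 fun g h1 h2 => ?_
    have := h2.1
    rw [normal_neg, lor_neg_left] at this
    linarith [h1.1]

theorem measurableSet_transverseTo_emb {U : Set (Mink k)} (hU : MeasurableSet U) :
    MeasurableSet (transverseTo F.emb U) := by
  rw [F.transverseTo_emb]
  exact (F.measurableSet_crossSet hU).union (F.neg.measurableSet_crossSet hU)

theorem exists_of_isometry
    (L : EuclideanSpace ℝ (Fin k) →ₗᵢ[ℝ] EuclideanSpace ℝ (Fin (k + 1))) :
    ∃ F : Frame k, F.toIsometry = L := by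
  have h1 : L.toLinearMap.range ≠ ⊤ := by
    intro h
    have := L.toLinearMap.finrank_range_le
    rw [h, finrank_top, finrank_euclideanSpace_fin, finrank_euclideanSpace_fin] at this
    omega
  have h2 : (L.toLinearMap.range)ᗮ ≠ ⊥ := mt (Submodule.orthogonal_eq_bot_iff).1 h1
  obtain ⟨e, he, he0⟩ := Submodule.exists_mem_ne_zero_of_ne_bot h2
  refine ⟨⟨L, ‖e‖⁻¹ • e, ?_, fun x => ?_⟩, rfl⟩
  · rw [norm_smul, norm_inv, norm_norm, inv_mul_cancel₀ (norm_ne_zero_iff.2 he0)]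
  · have h3 := (Submodule.mem_orthogonal' _ _).1 he (L x) ⟨x, rfl⟩
    rw [real_inner_smul_left, h3, mul_zero]

theorem exists_of_unit {e : EuclideanSpace ℝ (Fin (k + 1))} (he : ‖e‖ = 1) :
    ∃ F : Frame k, F.e = e := by
  have : Fact (Module.finrank ℝ (EuclideanSpace ℝ (Fin (k + 1))) = k + 1) :=
    ⟨finrank_euclideanSpace_fin⟩
  have he0 : e ≠ 0 := norm_ne_zero_iff.1 (by rw [he]; exact one_ne_zero)
  set b := OrthonormalBasis.fromOrthogonalSpanSingleton (𝕜 := ℝ) k he0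
  refine ⟨⟨(Submodule.subtypeₗᵢ _).comp b.repr.symm.toLinearIsometry, e, he, fun x => ?_⟩, rfl⟩
  exact (Submodule.mem_orthogonal_singleton_iff_inner_right).1 (b.repr.symm x).2

end Frame

/-- Once an isometry brings the image of the origin back to the origin, the embedding preserves time
coordinates and is therefore the one of a frame. -/
theorem liouville_transverseTo {k : ℕ} {φ : Mink k →ₗ[ℝ] Mink (k + 1)} (hφ : IsHypEmbedding φ)
    {U : Set (Mink k)} (hU : MeasurableSet U) :
    liouville (k + 1) (transverseTo φ U) = 2 * kernelMass k * hypVolume k U := by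
  obtain ⟨A, hA, -, -, -⟩ := exists_swap (hφ.2 _ origin_mem)
  -- From here on `A.1 ∘ φ` takes the place of `φ`.
  have hlor (v w : Mink k) : lor (A.1 (φ v)) (A.1 (φ w)) = lor v w := by rw [A.lor_map, hφ.1]
  have hsnd (v : Mink k) : (A.1 (φ v)).2 = v.2 := by
    have h := hlor v (origin k)
    rw [hA, lor_origin, lor_origin] at h
    linarith
  obtain ⟨F, hF⟩ := Frame.exists_of_isometry (k := k)
    { toFun := fun x => (A.1 (φ (x, 0))).1
      map_add' := fun x y => by
        have : ((x + y, 0) : Mink k) = (x, 0) + (y, 0) := by ext1 <;> simp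
        rw [this, map_add, map_add, Prod.fst_add]
      map_smul' := fun r x => by
        have : ((r • x, 0) : Mink k) = r • (x, 0) := by ext1 <;> simp
        rw [this, map_smul, map_smul, Prod.smul_fst, RingHom.id_apply]
      norm_map' := fun x => by
        have h := hlor (x, 0) (x, 0)
        rw [lor_self, lor_self, hsnd] at h
        refine (pow_left_inj₀ (norm_nonneg _) (norm_nonneg _) two_ne_zero).1 ?_
        change ‖(A.1 (φ (x, 0))).1‖ ^ 2 = _
        linarith }
  have hemb (v : Mink k) : F.emb v = A.1 (φ v) := by
    have h1 : v = (v.1, 0) + v.2 • origin k := by ext1 <;> simp [origin]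
    have h2 : F.toIsometry v.1 = (A.1 (φ (v.1, 0))).1 := by rw [hF]; rfl
    have h3 : A.1 (φ v) = A.1 (φ (v.1, 0)) + v.2 • origin (k + 1) := by
      rw [← hA, ← map_smul, ← map_smul, ← map_add, ← map_add, ← h1]
    refine Prod.ext ?_ (hsnd v).symm
    rw [F.emb_apply, h2, h3]
    simp [origin]
  have himg (V : Set (Mink k)) : F.emb '' V = A.1 '' (φ '' V) := by
    rw [image_image]
    exact image_congr fun v _ => hemb v
  have hpre : transverseTo φ U = (fun g => A • g) ⁻¹' transverseTo F.emb U := by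
    ext g
    change _ ↔ ((A • g).line ∩ F.emb '' U).Nonempty ∧ ¬ (A • g).line ⊆ F.emb '' Hyp k
    rw [Geod.line_smul, himg, himg, ← image_inter A.1.injective, image_nonempty,
      image_subset_image_iff A.1.injective]
    rfl
  rw [hpre, (measurePreserving_geod_smul A).measure_preimage
    (F.measurableSet_transverseTo_emb hU).nullMeasurableSet, F.liouville_transverseTo_emb hU]

/-! ### Geodesics that join two half-spaces -/

/-- The variable `q` is unrestricted, and integrating it out gives `kernelMass k` whatever `p` is.
This is why the constant agrees with that of the midpoint. -/
theorem lintegral_kernel_left {k : ℕ} {V : Set (Mink k)} (hV : MeasurableSet V) :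
    ∫⁻ p, (∫⁻ q, kernel p q * V.indicator 1 p ∂hypVolume k) ∂hypVolume k =
      kernelMass k * hypVolume k V := by
  have hVi : Measurable (V.indicator 1 : Mink k → ENNReal) := measurable_one.indicator hV
  rw [← lintegral_indicator_one hV, ← lintegral_const_mul _ hVi]
  refine lintegral_congr_ae ?_
  filter_upwards [ae_mem_Hyp] with p hp
  have hm : Measurable fun q => kernel q p := by
    have h := measurable_lor_left p
    simp only [kernel, lor_comm _ p]
    fun_prop
  simp only [kernel_comm p]
  rw [lintegral_mul_const _ hm, lintegral_kernel hp]

theorem lintegral_kernel_right {k : ℕ} {V : Set (Mink k)} (hV : MeasurableSet V) :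
    ∫⁻ p, (∫⁻ q, kernel p q * V.indicator 1 q ∂hypVolume k) ∂hypVolume k =
      kernelMass k * hypVolume k V := by
  have hVi : Measurable (V.indicator 1 : Mink k → ENNReal) := measurable_one.indicator hV
  have hm : Measurable fun z : Mink k × Mink k => kernel z.1 z.2 * V.indicator 1 z.2 :=
    measurable_kernel.mul (hVi.comp measurable_snd)
  rw [lintegral_lintegral_swap hm.aemeasurable, ← lintegral_kernel_left hV]
  simp only [kernel_comm]

namespace Frame

variable {k : ℕ} (F : Frame k) {C S : ℝ}

theorem measurableSet_cap (C S : ℝ) : MeasurableSet {q : Mink k | S * q.2 < C} :=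
  measurableSet_lt (measurable_snd.const_mul S) measurable_const

theorem lor_opposite (C S : ℝ) (ω : SphereInf (k + 1)) :
    lor (-(S • origin (k + 1) + C • F.normal)) (nullVec ω) =
      S - C * lor F.normal (nullVec ω) := by
  rw [lor_neg_left, lor_add_left, lor_smul_left, lor_smul_left, lor_comm (origin _), lor_origin,
    nullVec_snd]
  ring

theorem lor_normal_pos_of_opposite (hC : 0 < C) (hS : 0 < S) {ω : SphereInf (k + 1)}
    (h : lor (-(S • origin (k + 1) + C • F.normal)) (nullVec ω) < 0) :
    0 < lor F.normal (nullVec ω) := by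
  rw [lor_opposite] at h
  exact pos_of_mul_pos_right (by linarith) hC.le

/-- An endpoint lies beyond the second wall exactly when the hyperbolic cosine of the distance of
its projection from the origin is less than `C / S`: the shadow of the second wall is a ball. -/
theorem opposite_point_iff {p : Mink k} (hp : p ∈ Hyp k) :
    lor (-(S • origin (k + 1) + C • F.normal)) (nullVec (F.point p.1)) < 0 ↔ S * p.2 < C := by
  rw [lor_opposite, F.lor_normal_nullVec_point hp, sub_neg, ← div_eq_mul_inv, lt_div_iff₀ hp.2]

/-- The vector `-(S • origin (k + 1) + C • F.normal)` is the normal of the second wall when `p` is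
the origin. Starting beyond that wall forces the start into the hemisphere of `F`, so the hemisphere
coordinates apply. -/
theorem liouville_fromTo_opposite (hC : 0 < C) (hS : 0 < S) :
    liouville (k + 1) (fromTo (-(S • origin (k + 1) + C • F.normal)) F.normal) =
      kernelMass k * hypVolume k {q | S * q.2 < C} := by
  rw [F.liouville_eq (measurableSet_fromTo _ _)
    (fun g hg => by
      rw [← lor_normal_nullVec]; exact F.lor_normal_pos_of_opposite hC hS hg.1)
    (fun g hg => F.inner_neg_e_pos hg.2), ← lintegral_kernel_left (measurableSet_cap C S)]
  refine lintegral_congr_ae ?_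
  filter_upwards [ae_mem_Hyp] with p hp
  refine lintegral_congr_ae ?_
  filter_upwards [ae_mem_Hyp] with q hq
  congr 1
  have key : (F.point p.1, F.neg.point q.1) ∈
      Subtype.val '' fromTo (-(S • origin (k + 1) + C • F.normal)) F.normal ↔
        p ∈ {q : Mink k | S * q.2 < C} := by
    refine Iff.trans ?_ (F.opposite_point_iff hp)
    constructor
    · rintro ⟨g, hg, hgpq⟩
      have h1 : g.1.1 = F.point p.1 := congrArg Prod.fst hgpq
      rw [← h1]
      exact hg.1
    · intro h
      have h1 : lor F.normal (nullVec (F.neg.point q.1)) < 0 := by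
        rw [F.lor_normal_nullVec_neg_point hq]
        linarith [inv_pos.2 hq.2]
      set g : Geod (k + 1) := ⟨(F.point p.1, F.neg.point q.1), F.point_ne hp hq⟩ with hg
      have hgm : g ∈ fromTo (-(S • origin (k + 1) + C • F.normal)) F.normal := And.intro h h1
      exact mem_image_of_mem Subtype.val hgm
  by_cases h : p ∈ {q : Mink k | S * q.2 < C}
  · rw [indicator_of_mem h, indicator_of_mem (key.2 h)]; rfl
  · rw [indicator_of_notMem h, indicator_of_notMem (mt key.1 h)]

theorem liouville_fromTo_normal (hC : 0 < C) (hS : 0 < S) :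
    liouville (k + 1) (fromTo F.normal (-(S • origin (k + 1) + C • F.normal))) =
      kernelMass k * hypVolume k {q | S * q.2 < C} := by
  -- These geodesics start on the negative side of the normal, so the opposite frame is used and the
  -- cap constrains the second variable.
  rw [F.neg.liouville_eq (measurableSet_fromTo _ _)
    (fun g hg => F.inner_neg_e_pos hg.1)
    (fun g hg => by
      rw [neg_neg, ← lor_normal_nullVec]; exact F.lor_normal_pos_of_opposite hC hS hg.2),
    ← lintegral_kernel_right (measurableSet_cap C S)]
  refine lintegral_congr_ae ?_
  filter_upwards [ae_mem_Hyp] with p hp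
  refine lintegral_congr_ae ?_
  filter_upwards [ae_mem_Hyp] with q hq
  congr 1
  rw [neg_neg]
  have key : (F.neg.point p.1, F.point q.1) ∈
      Subtype.val '' fromTo F.normal (-(S • origin (k + 1) + C • F.normal)) ↔
        q ∈ {q : Mink k | S * q.2 < C} := by
    refine Iff.trans ?_ (F.opposite_point_iff hq)
    constructor
    · rintro ⟨g, hg, hgpq⟩
      have h1 : g.1.2 = F.point q.1 := congrArg Prod.snd hgpq
      rw [← h1]
      exact hg.2
    · intro h
      have h1 : lor F.normal (nullVec (F.neg.point p.1)) < 0 := by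
        rw [F.lor_normal_nullVec_neg_point hp]
        linarith [inv_pos.2 hp.2]
      set g : Geod (k + 1) := ⟨(F.neg.point p.1, F.point q.1), (F.point_ne hq hp).symm⟩ with hg
      have hgm : g ∈ fromTo F.normal (-(S • origin (k + 1) + C • F.normal)) := And.intro h1 h
      exact mem_image_of_mem Subtype.val hgm
  by_cases h : q ∈ {q : Mink k | S * q.2 < C}
  · rw [indicator_of_mem h, indicator_of_mem (key.2 h)]; rfl
  · rw [indicator_of_notMem h, indicator_of_notMem (mt key.1 h)]

end Frame

theorem fromTo_preimage {n : ℕ} (A : HypIsom n) (u w : Mink n) :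
    (fun g => A • g) ⁻¹' fromTo (A.1 u) (A.1 w) = fromTo u w := by
  have key (v : Mink n) (x : SphereInf n) :
      lor (A.1 v) (nullVec (A • x)) < 0 ↔ lor v (nullVec x) < 0 := by
    rw [A.nullVec_smul, lor_smul_right, A.lor_map]
    have h := inv_pos.2 (isom_nullVec A x).1
    exact ⟨fun h1 => by by_contra! h2; linarith [mul_nonneg h.le h2],
      fun h1 => mul_neg_of_pos_of_neg h h1⟩
  ext g
  exact and_congr (key u g.1.1) (key w g.1.2)

theorem liouville_fromTo_map {k : ℕ} (A : HypIsom (k + 1)) (u w : Mink (k + 1)) :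
    liouville (k + 1) (fromTo (A.1 u) (A.1 w)) = liouville (k + 1) (fromTo u w) := by
  rw [← fromTo_preimage A u w, (measurePreserving_geod_smul A).measure_preimage
    (measurableSet_fromTo _ _).nullMeasurableSet]

theorem HypManifold.OrthoConfig.liouville_eq {k : ℕ} {M : HypManifold (k + 1)} {α : M.GeodArc}
    {u w : Mink (k + 1)} {C S : ℝ} (c : OrthoConfig M α.source α.target u w C S) :
    M.liouville α.homotopicGeod = 2 * kernelMass k * hypVolume k {q | S * q.2 < C} := by
  obtain ⟨A, hA, -, -, -⟩ := exists_swap c.left_mem_Hyp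
  have hu2 : (A.1 u).2 = 0 := by
    have h := A.lor_map u α.source
    rw [hA, lor_origin, c.normal_left.2.1] at h
    linarith
  have hu1 : ‖(A.1 u).1‖ = 1 := by
    have h := A.lor_map u u
    rw [lor_self, hu2, c.normal_left.1] at h
    refine (pow_left_inj₀ (norm_nonneg _) zero_le_one two_ne_zero).1 ?_
    linarith
  obtain ⟨F, hF⟩ := Frame.exists_of_unit hu1
  have hFu : A.1 u = F.normal := Prod.ext hF.symm hu2
  have hFw : A.1 w = -(S • origin (k + 1) + C • F.normal) := by
    rw [c.normal_right_eq, map_neg, map_add, map_smul, map_smul, hA, hFu]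
  rw [c.liouville_homotopicGeod measurePreserving_geod_smul, ← liouville_fromTo_map A u w,
    ← liouville_fromTo_map A w u, hFu, hFw, F.liouville_fromTo_normal c.C_pos c.S_pos,
    F.liouville_fromTo_opposite c.C_pos c.S_pos]
  ring

/-! ### Balls -/

/-- The mean of `coth (l / 2)` and its inverse is `coth l`, by the duplication formulas. -/
theorem cosh_log_coth {l : ℝ} (hl : 0 < l) :
    Real.cosh (Real.log (Real.cosh (l / 2) / Real.sinh (l / 2))) = Real.cosh l / Real.sinh l := by
  have hs : 0 < Real.sinh (l / 2) := Real.sinh_pos_iff.2 (by linarith)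
  have hc := Real.cosh_pos (l / 2)
  have h1 : Real.cosh l = Real.cosh (l / 2) ^ 2 + Real.sinh (l / 2) ^ 2 := by
    rw [← Real.cosh_two_mul, mul_div_cancel₀ l two_ne_zero]
  have h2 : Real.sinh l = 2 * Real.sinh (l / 2) * Real.cosh (l / 2) := by
    rw [← Real.sinh_two_mul, mul_div_cancel₀ l two_ne_zero]
  rw [Real.cosh_log (by positivity), h1, h2]
  field_simp

theorem log_coth_nonneg {l : ℝ} (hl : 0 < l) :
    0 ≤ Real.log (Real.cosh (l / 2) / Real.sinh (l / 2)) := by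
  have hs : 0 < Real.sinh (l / 2) := Real.sinh_pos_iff.2 (by linarith)
  exact Real.log_nonneg ((one_le_div hs).2 (Real.sinh_lt_cosh _).le)

/-- The time coordinate is the hyperbolic cosine of the distance from the origin. The two sets agree
only on the hyperboloid, which carries the measure. -/
theorem ballVolume_eq {k : ℕ} {r C S : ℝ} (hr : 0 ≤ r) (hS : 0 < S) (h : Real.cosh r = C / S) :
    ballVolume k r = hypVolume k {q | S * q.2 < C} := by
  refine measure_congr ?_
  filter_upwards [ae_mem_Hyp] with v hv
  have h1 : 1 ≤ v.2 := by
    have := lor_le_neg_one hv origin_mem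
    rw [lor_origin] at this
    linarith
  have h2 : hdist ((0, 1) : Mink k) v = Real.arcosh v.2 := by
    rw [hdist, lor_comm]
    exact congrArg _ (by rw [← origin, lor_origin, neg_neg])
  refine propext ?_
  change (v ∈ Hyp k ∧ hdist ((0, 1) : Mink k) v < r) ↔ S * v.2 < C
  rw [and_iff_right hv, h2, mul_comm, ← lt_div_iff₀ hS, ← h]
  nth_rewrite 2 [← Real.cosh_arcosh h1]
  rw [Real.cosh_lt_cosh, abs_of_nonneg (Real.arcosh_nonneg h1), abs_of_nonneg hr]

theorem HypManifold.GeodArc.IsOrthogeodesic.liouville_homotopicGeod {k : ℕ}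
    {M : HypManifold (k + 1)} {α : M.GeodArc} (h : α.IsOrthogeodesic) :
    M.liouville α.homotopicGeod = 2 * kernelMass k *
      ballVolume k (Real.log (Real.cosh (α.length / 2) / Real.sinh (α.length / 2))) := by
  obtain ⟨u, w, c⟩ := h.exists_config
  have hC : 1 < -lor α.source α.target := by
    have h1 := c.sq_sub_sq
    nlinarith [c.C_pos, sq_pos_of_pos c.S_pos]
  have hl : 0 < α.length := Real.arcosh_pos hC
  have hcosh : Real.cosh α.length = -lor α.source α.target := Real.cosh_arcosh hC.le
  have hsinh : Real.sinh α.length = Real.sqrt (lor α.source α.target ^ 2 - 1) := by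
    rw [GeodArc.length, hdist, Real.sinh_arcosh hC.le, neg_sq]
  rw [c.liouville_eq, ballVolume_eq (log_coth_nonneg hl) c.S_pos
    (by rw [cosh_log_coth hl, hcosh, hsinh])]

end

end HypGeom

theorem mainTheorem5 (n : ℕ) (hn : 2 ≤ n) :
    ∃ K : ℝ, 0 < K ∧
      (∀ φ : HypGeom.Mink (n - 1) →ₗ[ℝ] HypGeom.Mink n, HypGeom.IsHypEmbedding φ →
        ∀ U : Set (HypGeom.Mink (n - 1)), U ⊆ HypGeom.Hyp (n - 1) → MeasurableSet U →
          HypGeom.liouville n (HypGeom.transverseTo φ U) =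
            ENNReal.ofReal K * HypGeom.hypVolume (n - 1) U) ∧
      ∀ (X : HypGeom.HypManifold n) (α : X.GeodArc), α.IsOrthogeodesic →
        X.liouville α.homotopicGeod =
          ENNReal.ofReal K * HypGeom.ballVolume (n - 1)
            (Real.log (Real.cosh (α.length / 2) / Real.sinh (α.length / 2))) := by
  obtain ⟨k, rfl⟩ : ∃ k, n = k + 1 := ⟨n - 1, by omega⟩
  have h0 : 2 * HypGeom.kernelMass k ≠ 0 := mul_ne_zero two_ne_zero HypGeom.kernelMass_ne_zero
  have h1 : 2 * HypGeom.kernelMass k ≠ ⊤ :=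
    ENNReal.mul_ne_top ENNReal.ofNat_ne_top HypGeom.kernelMass_ne_top
  -- The factor 2 counts the two directions of crossing in the first claim and the two orientations
  -- in the second.
  refine ⟨(2 * HypGeom.kernelMass k).toReal, ENNReal.toReal_pos h0 h1, ?_, ?_⟩ <;>
    rw [ENNReal.ofReal_toReal h1]
  · exact fun φ hφ U _ hU => HypGeom.liouville_transverseTo hφ hU
  · exact fun X α hα => hα.liouville_homotopicGeod
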